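/- Let $V$ be a complex vector space of dimension $10$. For a $3$-form $\alpha\in\Lambda^3V^*$ let $F(X)\subset Gr(6,V)$ be the variety of $6$-dimensional subspaces $W\subset V$ with $\alpha|_W=0$, and for $[W]\in F(X)$ put $Z_W=Gr(3,W)\subset Gr(3,V)$. Let $$I=\overline{\{([W_1],[W_2])\in F(X)\times F(X)\;:\; W_1\neq W_2,\ Z_{W_1}\cap Z_{W_2}\neq\emptyset\}}\subset F(X)\times F(X)$$ (Zariski closure), and let $$I_3^o=\{([W_1],[W_2],[W_3])\in F(X)^3\;:\;\dim(W_i\cap W_j)\ge 3\ \ \forall i,j,\ \ \dim(W_1\cap W_2\cap W_3)=0\}.$$ Let $\pi_{12}$ and $\pi_3$ be the projections of $I_3^o$ to the first two factors and to the third factor. There is a non-empty Zariski open subset of $\Lambda^3V^*$ such that for every $\alpha$ in it the following holds. 1. $I$ is non-empty, $\pi_{12}$ is a morphism from $I_3^o$ to $I$, and it has degree one: there is a dense open subset $U\subset I$, with $\pi_{12}^{-1}(U)$ dense in $I_3^o$, over each point of which the fibre of $\pi_{12}$ consists of exactly one point. 2. Consequently $\pi_{12}$ has a rational inverse $\pi_{12}^{-1}\colon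 I\dashrightarrow I_3^o$, that is, a morphism on a dense open subset $D\subset I$ which is inverse to $\pi_{12}\colon\pi_{12}^{-1}(D)\to D$, and there is a rational map $$\varphi=\pi_3\circ\pi_{12}^{-1}\colon I\dashrightarrow F(X),$$ regular on $D$. -/

import Mathlib

/-!
Classical algebraic geometry over `ℂ` on products of Grassmannians, and the varieties attached to
a 3-form `α` on a complex vector space `V`: the Debarre-Voisin variety `F(X)`, the incidence
variety `I`, and the open triangle variety `I₃ᵒ`.
-/

open Module

noncomputable section

namespace DebarreVoisin

/-! ### Zariski topology on vector spaces and on powers of Grassmannians -/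

section Zariski

variable (E : Type*) [AddCommGroup E] [Module ℂ E]

/-- Polynomial functions on a complex vector space: the algebra of functions generated by the
linear forms. -/
def polyFun : Subalgebra ℂ (E → ℂ) :=
  Algebra.adjoin ℂ (Set.range fun l : Dual ℂ E => (l : E → ℂ))

/-- The Zariski topology on a (finite-dimensional) complex vector space: the sets
`{x | f x ≠ 0}`, with `f` polynomial, form a basis of open sets. -/
@[reducible] def zariskiTopology : TopologicalSpace E :=
  TopologicalSpace.generateFrom {U | ∃ f ∈ polyFun E, U = {x | f x ≠ 0}}

variable {E} in
/-- Polynomial maps between complex vector spaces. -/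
def IsPolyMap {E' : Type*} [AddCommGroup E'] [Module ℂ E'] (B : E → E') : Prop :=
  ∀ l : Dual ℂ E', (fun x => l (B x)) ∈ polyFun E

end Zariski

section Grassmannian

variable (V : Type*) [AddCommGroup V] [Module ℂ V]

/-- The points of the Grassmannian `Gr(k, V)` of `k`-dimensional subspaces of `V`. -/
abbrev Gr (k : ℕ) : Type _ := {W : Submodule ℂ V // finrank ℂ W = k}

/-- The points of the `m`-fold product `Gr(k, V) × ⋯ × Gr(k, V)`. -/
def GrPow (k m : ℕ) : Type _ := Fin m → Gr V k

/-- `m`-tuples of `k`-frames of `V` (a `k`-frame is a linearly independent `k`-tuple). -/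
abbrev Frames (k m : ℕ) : Type _ :=
  {b : Fin m → Fin k → V // ∀ i, LinearIndependent ℂ (b i)}

variable {V}

/-- The tuple of subspaces spanned by a tuple of frames. -/
def Frames.span {k m : ℕ} (b : Frames V k m) : GrPow V k m := fun i =>
  ⟨Submodule.span ℂ (Set.range (b.1 i)), by
    simpa using finrank_span_eq_card (b.2 i)⟩

/-- The Zariski topology on `Gr(k, V)^m`. The variety of tuples of frames is a
Zariski open subset of the vector space `(V^k)^m`, and it is a principal bundle over
`Gr(k, V)^m`; hence the Zariski topology of `Gr(k, V)^m` is the quotient topology. -/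
instance GrPow.instTopologicalSpace (k m : ℕ) : TopologicalSpace (GrPow V k m) :=
  TopologicalSpace.coinduced Frames.span
    (TopologicalSpace.induced Subtype.val (zariskiTopology (Fin m → Fin k → V)))

/-- `f` is a regular map (a morphism of varieties, for the reduced structures) on the
subset `S` of `Gr(k, V)^m`, with values in `Gr(l, V)^n`: Zariski locally on `S`, frames of the
value of `f` can be chosen that are polynomial in frames of the argument. (In affine charts of the
target the components of a morphism are locally quotients of polynomials, and the denominators
can be cleared by rescaling the frame.) -/
def IsRegularOn {k l m n : ℕ} (f : GrPow V k m → GrPow V l n) (S : Set (GrPow V k m)) : Prop :=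
  ∀ p ∈ S, ∃ N : Set (GrPow V k m), IsOpen N ∧ p ∈ N ∧
    ∃ B : (Fin m → Fin k → V) → (Fin n → Fin l → V), IsPolyMap B ∧
      ∀ b : Frames V k m, b.span ∈ S ∩ N →
        ∃ h : ∀ i, LinearIndependent ℂ (B b.1 i), Frames.span ⟨B b.1, h⟩ = f b.span

/-- `U` is a dense (relatively) open subset of `S`. -/
def IsDenseOpenIn {T : Type*} [TopologicalSpace T] (U S : Set T) : Prop :=
  (∃ O : Set T, IsOpen O ∧ U = S ∩ O) ∧ S ⊆ closure U

/-- The regular map `f` from `S` to `T` is dominant and generically finite of degree `d`: there is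
a dense open `U ⊆ T`, with dense preimage in `S`, over each point of which the fibre has exactly
`d` points (over `ℂ` this is the usual degree). -/
def HasDegree {k l m n : ℕ} (f : GrPow V k m → GrPow V l n)
    (S : Set (GrPow V k m)) (T : Set (GrPow V l n)) (d : ℕ) : Prop :=
  IsRegularOn f S ∧ Set.MapsTo f S T ∧ T.Nonempty ∧
    ∃ U : Set (GrPow V l n), IsDenseOpenIn U T ∧ S ⊆ closure (S ∩ f ⁻¹' U) ∧
      ∀ p ∈ U, {q | q ∈ S ∧ f q = p}.encard = d

/-- A representative of a rational map `S ⇢ T`: a regular map to `T` defined on a dense open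
subset of `S`. (The values of `toFun` outside `domain` carry no meaning.) -/
structure RationalMap {k l m n : ℕ} (S : Set (GrPow V k m)) (T : Set (GrPow V l n)) where
  domain : Set (GrPow V k m)
  toFun : GrPow V k m → GrPow V l n
  isDenseOpenIn_domain : IsDenseOpenIn domain S
  isRegularOn : IsRegularOn toFun domain
  mapsTo : Set.MapsTo toFun domain T

/-- The projection of `Gr(k, V)^m` to the factors with indices `s 0, …, s (n-1)`. -/
def proj {k m n : ℕ} (s : Fin n → Fin m) (w : GrPow V k m) : GrPow V k n := fun i => w (s i)

end Grassmannian

/-! ### The varieties attached to a 3-form -/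

section Varieties

variable {V : Type*} [AddCommGroup V] [Module ℂ V]

/-- `F(X)`: the 6-dimensional subspaces on which `α` vanishes identically. -/
def fano (α : V [⋀^Fin 3]→ₗ[ℂ] ℂ) : Set (Gr V 6) :=
  {W | ∀ v : Fin 3 → V, (∀ i, v i ∈ W.1) → α v = 0}

/-- The `m`-fold product `F(X) × ⋯ × F(X)` inside `Gr(6, V)^m`. -/
def fanoPow (α : V [⋀^Fin 3]→ₗ[ℂ] ℂ) (m : ℕ) : Set (GrPow V 6 m) :=
  {w | ∀ i, w i ∈ fano α}

/-- `Z_W = Gr(3, W) ⊆ Gr(3, V)`. -/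
def subGr (W : Gr V 6) : Set (Gr V 3) := {K | K.1 ≤ W.1}

/-- The incidence variety `I`: the Zariski closure in `F(X) × F(X)` of the set of pairs
`(W₁, W₂)` with `W₁ ≠ W₂` such that `Z_{W₁}` and `Z_{W₂}` have a common point. -/
def incidence (α : V [⋀^Fin 3]→ₗ[ℂ] ℂ) : Set (GrPow V 6 2) :=
  fanoPow α 2 ∩
    closure {w | w ∈ fanoPow α 2 ∧ (subGr (w 0) ∩ subGr (w 1)).Nonempty ∧ w 0 ≠ w 1}

/-- The open triangle variety `I₃ᵒ`: triples in `F(X)` with pairwise intersections of dimension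
at least 3 and with zero common intersection. -/
def openTriangles (α : V [⋀^Fin 3]→ₗ[ℂ] ℂ) : Set (GrPow V 6 3) :=
  {w | w ∈ fanoPow α 3 ∧
    (∀ i j, 3 ≤ finrank ℂ ((w i).1 ⊓ (w j).1 : Submodule ℂ V)) ∧
    finrank ℂ ((w 0).1 ⊓ (w 1).1 ⊓ (w 2).1 : Submodule ℂ V) = 0}

/-- The projection to the first two factors. -/
def π₁₂ : GrPow V 6 3 → GrPow V 6 2 := proj ![0, 1]

/-- The projection to the third factor. -/
def π₃ : GrPow V 6 3 → GrPow V 6 1 := proj ![2]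

end Varieties

end DebarreVoisin

end

/-!
A triangle `(W₁, W₂, W₃)` of isotropic 6-dimensional subspaces with zero common intersection is
spanned by nine vectors `x = (k, a, b)`, three for each pairwise intersection: `W₁ = ⟨k, a⟩`,
`W₂ = ⟨k, b⟩`, `W₃ = ⟨a, b⟩`. Conversely, suppose `W₁ = ⟨k, a⟩` and `W₂ = ⟨k, b⟩` are given. A third
vertex has the form `⟨a + φ a, b + ψ b⟩` with `φ : ⟨a⟩ → ⟨k⟩` and `ψ : ⟨b⟩ → ⟨k⟩`. Since `α`
vanishes on `W₁` and `W₂`, the terms quadratic in `φ` drop out of the condition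
`α(a + φ a, a + φ a, b + ψ b) = 0`, and so do all terms in `ψ`. What remains are nine linear
equations for the nine coefficients of `φ`, and symmetrically for `ψ`. If both determinants are
nonzero (`IsAdapted`), the third vertex exists and is unique
(`IsAdapted.isIsotropic_thirdVertex`, `IsAdapted.eq_thirdVertex`), and by Cramer's rule it depends
polynomially on `x`. The inverse of `π₁₂` is therefore defined on the set `adaptedSides α` of pairs
of this kind. This set is open in the incidence variety, and near each of its points the tuple `x`
can be chosen polynomially in frames of `W₁` and `W₂`, again by Cramer's rule (`FrameChart`); this
makes the inverse a morphism.

It remains to see that, for generic `α`, the set `adaptedSides α` is nonempty and dense in the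
incidence variety, and that its preimage is dense in the variety of triangles. Both density
statements are proved for the total space of the family, where `α` may be deformed as well.

* A pair meeting in dimension three is a limit of adapted ones: move `α` towards a determinant form,
  for which the two determinants do not vanish (`inPolyClosure_of_linearIndependent`). The same
  works for triangles (`inPolyClosure_triangles`).
* A pair meeting in dimension four or five has to be moved together with `α` to pairs with smaller
  intersection (`inPolyClosure_of_inf_four`, `inPolyClosure_of_inf_five`). To first order this needs
  a vector `q` outside `W₁ + W₂`, or two such vectors, for which `α(q, ·, ·)` is compatible with a
  3-dimensional subspace of `W₁ ∩ W₂`. Such vectors exist since a pencil of skew forms on a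
  4-dimensional space has a degenerate member, and since certain linear maps attached to a net of
  skew forms on a 5-dimensional space have an eigenvector (`exists_isotropic_of_pencil`,
  `exists_wedgeContract_add_eq_zero`). Dimensions three to five are all that occur, so every incident
  pair is a limit of adapted ones (`exists_lift`).

Density in the total space passes to the fibre over a generic `α` (`exists_generic_dense`). This is
an instance of generic flatness: let `I` be the ideal of the closure of a family and let `g` be a
nonzerodivisor modulo `I`. Pseudo-division by finitely many elements of `I` shows that `g` remains a
nonzerodivisor modulo the specialisation of `I` at a generic parameter
(`exists_generic_nonzerodivisor`), and by the Nullstellensatz the set `g ≠ 0` is then dense in the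
zero locus. In the same way `exists_generic_nonempty` gives points over a generic `α` as soon as the
projection of the family to the space of 3-forms is dominant. For adapted tuples it is
(`polyFun_eq_zero_of_adaptedPairs`): every 3-form is the sum of a form isotropic on two fixed sides
and a tangent vector to the `GL(V)`-orbit of `baseForm` (`exists_isIsotropic_sub_lieAction`), so the
translates of the forms with these isotropic sides fill up the space of 3-forms along curves through
`baseForm` in all directions (`polyFun_eq_zero_of_curves`).
-/


namespace DebarreVoisin

/-! ### Pseudo-division and generic fibres of families of ideals -/

section PseudoDivision

open MvPolynomial MonomialOrder

variable {σ R : Type*} [CommRing R] (m : MonomialOrder σ)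

/-- One step of pseudo-division cancels the leading term without dividing by the leading
coefficient. -/
theorem degree_pseudoReduce_lt {p f : MvPolynomial σ R} (hfp : m.degree f ≤ m.degree p) {s r : R}
    (hs : s = r * m.leadingCoeff f)
    (hne : C s * p - monomial (m.degree p - m.degree f) (r * m.leadingCoeff p) * f ≠ 0) :
    m.toSyn (m.degree (C s * p - monomial (m.degree p - m.degree f) (r * m.leadingCoeff p) * f))
      < m.toSyn (m.degree p) := by
  set p' := C s * p - monomial (m.degree p - m.degree f) (r * m.leadingCoeff p) * f with hp'
  have h1 : m.toSyn (m.degree p') ≤ m.toSyn (m.degree p) := by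
    refine m.degree_sub_le.trans (sup_le ?_ ?_)
    · refine m.degree_mul_le.trans ?_
      simp
    · refine m.degree_mul_le.trans ?_
      calc m.toSyn (m.degree (monomial (m.degree p - m.degree f) (r * m.leadingCoeff p))
              + m.degree f)
          ≤ m.toSyn ((m.degree p - m.degree f) + m.degree f) := by
            rw [map_add, map_add]
            exact add_le_add (m.degree_monomial_le _) le_rfl
        _ = m.toSyn (m.degree p) := by rw [tsub_add_cancel_of_le hfp]
  refine lt_of_le_of_ne h1 fun h => hne ?_
  have h2 : m.degree p' = m.degree p := m.toSyn.injective h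
  rw [← m.leadingCoeff_eq_zero_iff, leadingCoeff, h2, hp', coeff_sub, coeff_C_mul,
    coeff_monomial_mul', if_pos tsub_le_self, tsub_tsub_cancel_of_le hfp]
  change s * m.leadingCoeff p - r * m.leadingCoeff p * m.leadingCoeff f = 0
  rw [hs]; ring

/-- Finitely many elements of an ideal suffice to pseudo-divide all its elements. -/
theorem exists_finset_degree_le [Finite σ] (I : Ideal (MvPolynomial σ R)) :
    ∃ T : Finset (MvPolynomial σ R), (∀ f ∈ T, f ∈ I ∧ f ≠ 0) ∧
      ∀ p ∈ I, p ≠ 0 → ∃ f ∈ T, m.degree f ≤ m.degree p := by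
  classical
  set D : Set (σ →₀ ℕ) := {d | ∃ f ∈ I, f ≠ 0 ∧ m.degree f = d} with hD
  have hfin : {d | Minimal (· ∈ D) d}.Finite :=
    WellQuasiOrderedLE.finite_of_isAntichain (setOfPred_minimal_antichain _)
  choose! F hFI hF0 hFd using fun d (hd : d ∈ D) => hd
  refine ⟨hfin.toFinset.image F, ?_, ?_⟩
  · intro f hf
    obtain ⟨d, hd, rfl⟩ := Finset.mem_image.1 hf
    have hd' : d ∈ D := ((Set.Finite.mem_toFinset _).1 hd).prop
    exact ⟨hFI d hd', hF0 d hd'⟩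
  · intro p hp hp0
    obtain ⟨d, hdle, hd⟩ := exists_minimal_le_of_wellFoundedLT (· ∈ D) (m.degree p)
        ⟨p, hp, hp0, rfl⟩
    refine ⟨F d, Finset.mem_image_of_mem _ ((Set.Finite.mem_toFinset _).2 hd), ?_⟩
    rw [hFd d hd.prop]; exact hdle

variable [IsDomain R]

/-- For an ideal `I` of polynomials over a domain, there is a nonzero constant `s` such that every
nonzero `p ∈ I` admits a pseudo-reduction step by some `f ∈ I`, with multiplier `s`. -/
theorem exists_pseudoReduce [Finite σ] (I : Ideal (MvPolynomial σ R)) :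
    ∃ s : R, s ≠ 0 ∧ ∀ p ∈ I, p ≠ 0 → ∃ f ∈ I, ∃ (r : R) (d : σ →₀ ℕ),
      (C s * p - monomial d (r * m.leadingCoeff p) * f ≠ 0 →
        m.toSyn (m.degree (C s * p - monomial d (r * m.leadingCoeff p) * f))
          < m.toSyn (m.degree p)) := by
  classical
  obtain ⟨T, hT, hT'⟩ := exists_finset_degree_le m I
  refine ⟨∏ f ∈ T, m.leadingCoeff f, ?_, ?_⟩
  · exact Finset.prod_ne_zero_iff.2 fun f hf => m.leadingCoeff_ne_zero_iff.2 (hT f hf).2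
  · intro p hp hp0
    obtain ⟨f, hf, hfp⟩ := hT' p hp hp0
    refine ⟨f, (hT f hf).1, ∏ f' ∈ T.erase f, m.leadingCoeff f', m.degree p - m.degree f, ?_⟩
    exact degree_pseudoReduce_lt m hfp (Finset.prod_erase_mul _ _ hf).symm

/-- Away from the zeros of some `s ≠ 0`, an ideal `I` of polynomials meets `𝔪[X]` in `𝔪 I`:
this is the flatness of the generic quotient by `I`. -/
theorem exists_generic_flat [Finite σ] (I : Ideal (MvPolynomial σ R)) :
    ∃ s : R, s ≠ 0 ∧ ∀ 𝔪 : Ideal R, ∀ p ∈ I, p ∈ 𝔪.map (C : R →+* MvPolynomial σ R) →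
      ∃ N : ℕ, C (s ^ N) * p ∈ 𝔪.map (C : R →+* MvPolynomial σ R) * I := by
  classical
  let _ : LinearOrder σ := linearOrderOfSTO WellOrderingRel
  let m : MonomialOrder σ := MonomialOrder.lex
  obtain ⟨s, hs, H⟩ := exists_pseudoReduce m I
  refine ⟨s, hs, fun 𝔪 p => ?_⟩
  induction hd : m.toSyn (m.degree p) using WellFoundedLT.induction generalizing p with
  | ind e ih =>
  intro hp hpm
  by_cases hp0 : p = 0
  · exact ⟨0, by simp [hp0]⟩
  obtain ⟨f, hf, r, d, hlt⟩ := H p hp hp0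
  have hmem : monomial d (r * m.leadingCoeff p) * f ∈ 𝔪.map (C : R →+* MvPolynomial σ R) * I := by
    refine Ideal.mul_mem_mul ?_ hf
    rw [mem_map_C_iff]
    intro n
    rw [coeff_monomial]
    split_ifs
    · exact Ideal.mul_mem_left _ _ ((mem_map_C_iff.1 hpm) _)
    · exact zero_mem _
  by_cases h0 : C s * p - monomial d (r * m.leadingCoeff p) * f = 0
  · refine ⟨1, ?_⟩
    rw [pow_one, sub_eq_zero.1 h0]; exact hmem
  · have h1 : C s * p - monomial d (r * m.leadingCoeff p) * f ∈ I :=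
      sub_mem (I.mul_mem_left _ hp) (I.mul_mem_left _ hf)
    have h2 : C s * p - monomial d (r * m.leadingCoeff p) * f
        ∈ 𝔪.map (C : R →+* MvPolynomial σ R) :=
      sub_mem (Ideal.mul_mem_left _ _ hpm) (Ideal.mul_le_left hmem)
    obtain ⟨N, hN⟩ := ih _ (hd ▸ hlt h0) _ rfl h1 h2
    refine ⟨N + 1, ?_⟩
    have : C (s ^ (N + 1)) * p = C (s ^ N) * (C s * p - monomial d (r * m.leadingCoeff p) * f)
        + C (s ^ N) * (monomial d (r * m.leadingCoeff p) * f) := by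
      rw [pow_succ, C_mul]; ring
    rw [this]
    exact add_mem hN (Ideal.mul_mem_left _ _ hmem)

end PseudoDivision

section GenericFibre

open MvPolynomial MonomialOrder

variable {σ τ : Type*}

/-- Specialisation of the parameters at the point `y`. -/
noncomputable abbrev specialize (σ : Type*) {τ : Type*} (y : τ → ℂ) :
    MvPolynomial σ (MvPolynomial τ ℂ) →+* MvPolynomial σ ℂ := map (eval y)

theorem specialize_surjective (y : τ → ℂ) : Function.Surjective (specialize σ y) :=
  map_surjective _ fun c => ⟨C c, by simp⟩

theorem mem_map_C_ker_of_specialize_eq_zero {y : τ → ℂ} {p : MvPolynomial σ (MvPolynomial τ ℂ)}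
    (h : specialize σ y p = 0) :
    p ∈ (RingHom.ker (eval y : MvPolynomial τ ℂ →+* ℂ)).map
      (C : MvPolynomial τ ℂ →+* MvPolynomial σ (MvPolynomial τ ℂ)) := by
  rw [mem_map_C_iff]
  intro n
  have := congrArg (coeff n) h
  rwa [coeff_map, coeff_zero] at this

/-- A polynomial which is a nonzerodivisor modulo `I` remains so modulo the specialisation of `I`
at a generic point. -/
theorem exists_generic_nonzerodivisor [Finite σ] (I : Ideal (MvPolynomial σ (MvPolynomial τ ℂ)))
    (g : MvPolynomial σ (MvPolynomial τ ℂ)) (hg : ∀ h, g * h ∈ I → h ∈ I) :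
    ∃ s : MvPolynomial τ ℂ, s ≠ 0 ∧ ∀ y, eval y s ≠ 0 → ∀ h,
      specialize σ y g * h ∈ I.map (specialize σ y) → h ∈ I.map (specialize σ y) := by
  obtain ⟨s, hs, H⟩ := exists_generic_flat (I ⊔ Ideal.span {g})
  refine ⟨s, hs, fun y hy h hh => ?_⟩
  obtain ⟨h', rfl⟩ := specialize_surjective y h
  rw [← map_mul] at hh
  obtain ⟨i, hi, hi'⟩ := (Ideal.mem_map_iff_of_surjective _ (specialize_surjective y)).1 hh
  have hmem : g * h' - i ∈ I ⊔ Ideal.span {g} :=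
    sub_mem (Ideal.mul_mem_right _ _ (Ideal.mem_sup_right
      (Ideal.mem_span_singleton_self g))) (Ideal.mem_sup_left hi)
  obtain ⟨N, hN⟩ := H (RingHom.ker (eval y)) (g * h' - i) hmem
    (mem_map_C_ker_of_specialize_eq_zero (by rw [map_sub, hi', sub_self]))
  rw [Ideal.mul_sup, Submodule.mem_sup] at hN
  obtain ⟨j, hj, k, hk, hjk⟩ := hN
  obtain ⟨r, hr, rfl⟩ := Ideal.mem_mul_span_singleton.1 hk
  have h1 : C (s ^ N) * h' - r ∈ I := by
    apply hg
    have : g * (C (s ^ N) * h' - r) = j + C (s ^ N) * i := by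
      linear_combination -hjk
    rw [this]
    exact add_mem (Ideal.mul_le_right hj) (I.mul_mem_left _ hi)
  have h2 := Ideal.mem_map_of_mem (specialize σ y) h1
  have h3 : specialize σ y r = 0 := by
    ext n
    rw [coeff_map, coeff_zero]
    exact (mem_map_C_iff.1 hr) n
  rw [map_sub, h3, sub_zero, map_mul] at h2
  have h4 := Ideal.mul_mem_left _ (C ((eval y s ^ N)⁻¹)) h2
  rwa [← mul_assoc, map_C, ← C_mul, map_pow, inv_mul_cancel₀ (pow_ne_zero _ hy), C_1, one_mul]
    at h4

/-- If `I` contains no nonzero polynomial in the parameters alone, its specialisation at a generic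
point is a proper ideal. -/
theorem exists_generic_ne_top [Finite σ] (I : Ideal (MvPolynomial σ (MvPolynomial τ ℂ)))
    (hI : ∀ a, C a ∈ I → a = 0) :
    ∃ s : MvPolynomial τ ℂ, s ≠ 0 ∧ ∀ y, eval y s ≠ 0 → I.map (specialize σ y) ≠ ⊤ := by
  classical
  let _ : LinearOrder σ := linearOrderOfSTO WellOrderingRel
  let m : MonomialOrder σ := MonomialOrder.lex
  obtain ⟨s, hs, H⟩ := exists_pseudoReduce m I
  refine ⟨s, hs, fun y hy htop => ?_⟩
  have key : ∀ p ∈ I, ∀ c : ℂ, c ≠ 0 → specialize σ y p ≠ C c := by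
    intro p
    induction hd : m.toSyn (m.degree p) using WellFoundedLT.induction generalizing p with
    | ind e ih =>
    intro hp c hc hpc
    have hp0 : p ≠ 0 := by
      rintro rfl
      rw [map_zero] at hpc
      exact hc (C_injective σ ℂ (by rw [← hpc, C_0]))
    by_cases hdeg : m.degree p = 0
    · have h1 := m.eq_C_of_degree_eq_zero hdeg
      rw [h1] at hp
      have h2 := hI _ hp
      rw [h2, C_0] at h1
      exact hp0 h1
    obtain ⟨f, hf, r, d, hlt⟩ := H p hp hp0
    have hlc : eval y (m.leadingCoeff p) = 0 := by
      have := congrArg (coeff (m.degree p)) hpc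
      rwa [coeff_map, coeff_C, if_neg (Ne.symm hdeg)] at this
    have himg : specialize σ y (C s * p - monomial d (r * m.leadingCoeff p) * f)
        = C (eval y s * c) := by
      rw [map_sub, map_mul, map_mul, hpc, map_C, map_monomial, map_mul, hlc, mul_zero,
        monomial_zero, zero_mul, sub_zero, C_mul]
    have h0 : C s * p - monomial d (r * m.leadingCoeff p) * f ≠ 0 := by
      intro h0
      rw [h0, map_zero] at himg
      exact mul_ne_zero hy hc (C_injective σ ℂ (by rw [← himg, C_0]))
    exact ih _ (hd ▸ hlt h0) _ rfl (I.sub_mem (I.mul_mem_left _ hp) (I.mul_mem_left _ hf)) _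
      (mul_ne_zero hy hc) himg
  obtain ⟨p, hp, hp'⟩ := (Ideal.mem_map_iff_of_surjective _ (specialize_surjective y)).1
    (htop ▸ Submodule.mem_top : (1 : MvPolynomial σ ℂ) ∈ I.map (specialize σ y))
  exact key p hp 1 one_ne_zero (by rw [hp', C_1])

end GenericFibre

/-! ### Polynomial functions and polynomial maps -/

section PolyFun

variable {E E' E'' : Type*} [AddCommGroup E] [Module ℂ E] [AddCommGroup E'] [Module ℂ E']
  [AddCommGroup E''] [Module ℂ E'']

theorem const_mem_polyFun (c : ℂ) : (fun _ : E => c) ∈ polyFun E :=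
  (polyFun E).algebraMap_mem c

theorem linear_mem_polyFun (l : E →ₗ[ℂ] ℂ) : (fun x => l x) ∈ polyFun E :=
  Algebra.subset_adjoin ⟨l, rfl⟩

theorem polyFun_add {f g : E → ℂ} (hf : f ∈ polyFun E) (hg : g ∈ polyFun E) :
    (fun x => f x + g x) ∈ polyFun E := (polyFun E).add_mem hf hg

theorem polyFun_mul {f g : E → ℂ} (hf : f ∈ polyFun E) (hg : g ∈ polyFun E) :
    (fun x => f x * g x) ∈ polyFun E := (polyFun E).mul_mem hf hg

theorem polyFun_neg {f : E → ℂ} (hf : f ∈ polyFun E) : (fun x => -f x) ∈ polyFun E :=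
  (polyFun E).neg_mem hf

theorem polyFun_pow {f : E → ℂ} (hf : f ∈ polyFun E) (n : ℕ) : (fun x => f x ^ n) ∈ polyFun E :=
  (polyFun E).pow_mem hf n

theorem polyFun_sum {ι : Type*} (s : Finset ι) {f : ι → E → ℂ} (hf : ∀ i ∈ s, f i ∈ polyFun E) :
    (fun x => ∑ i ∈ s, f i x) ∈ polyFun E := by
  convert (polyFun E).sum_mem hf using 1
  ext x; simp

theorem polyFun_prod {ι : Type*} (s : Finset ι) {f : ι → E → ℂ} (hf : ∀ i ∈ s, f i ∈ polyFun E) :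
    (fun x => ∏ i ∈ s, f i x) ∈ polyFun E := by
  convert (polyFun E).prod_mem hf using 1
  ext x; simp

theorem polyFun_ite {f g : E → ℂ} {p : Prop} [Decidable p] (hf : f ∈ polyFun E)
    (hg : g ∈ polyFun E) : (fun x => if p then f x else g x) ∈ polyFun E := by
  split_ifs <;> assumption

theorem polyFun_det {n : Type*} [Fintype n] [DecidableEq n] {A : E → Matrix n n ℂ}
    (hA : ∀ i j, (fun x => A x i j) ∈ polyFun E) : (fun x => (A x).det) ∈ polyFun E := by
  simp only [Matrix.det_apply']
  refine polyFun_sum _ fun s _ => polyFun_mul (const_mem_polyFun _)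
      (polyFun_prod _ fun i _ => hA _ _)

theorem polyFun_adjugate {n : Type*} [Fintype n] [DecidableEq n] {A : E → Matrix n n ℂ}
    (hA : ∀ i j, (fun x => A x i j) ∈ polyFun E) (i j : n) :
    (fun x => (A x).adjugate i j) ∈ polyFun E := by
  simp only [Matrix.adjugate_apply]
  refine polyFun_det fun k l => ?_
  simp only [Matrix.updateRow_apply]
  exact polyFun_ite (const_mem_polyFun _) (hA _ _)

theorem polyFun_comp {f : E' → ℂ} (hf : f ∈ polyFun E') {B : E → E'} (hB : IsPolyMap B) :
    (fun x => f (B x)) ∈ polyFun E := by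
  induction hf using Algebra.adjoin_induction with
  | mem f hf => obtain ⟨l, rfl⟩ := hf; exact hB l
  | algebraMap c => exact const_mem_polyFun c
  | add f g _ _ hf hg => exact polyFun_add hf hg
  | mul f g _ _ hf hg => exact polyFun_mul hf hg

theorem IsPolyMap.comp {B : E' → E''} (hB : IsPolyMap B) {A : E → E'} (hA : IsPolyMap A) :
    IsPolyMap (fun x => B (A x)) := fun l => polyFun_comp (hB l) hA

theorem isPolyMap_linear (f : E →ₗ[ℂ] E') : IsPolyMap (fun x => f x) := fun l =>
  linear_mem_polyFun (l.comp f)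

theorem isPolyMap_id : IsPolyMap (fun x : E => x) := isPolyMap_linear LinearMap.id

theorem isPolyMap_const (c : E') : IsPolyMap (fun _ : E => c) := fun l => const_mem_polyFun (l c)

theorem IsPolyMap.add {A B : E → E'} (hA : IsPolyMap A) (hB : IsPolyMap B) :
    IsPolyMap (fun x => A x + B x) := fun l => by
  simpa only [map_add] using polyFun_add (hA l) (hB l)

theorem IsPolyMap.smul {f : E → ℂ} (hf : f ∈ polyFun E) {B : E → E'} (hB : IsPolyMap B) :
    IsPolyMap (fun x => f x • B x) := fun l => by
  simpa only [map_smul, smul_eq_mul] using polyFun_mul hf (hB l)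

theorem IsPolyMap.sum {ι : Type*} (s : Finset ι) {B : ι → E → E'} (hB : ∀ i ∈ s, IsPolyMap (B i)) :
    IsPolyMap (fun x => ∑ i ∈ s, B i x) := fun l => by
  simpa only [map_sum] using polyFun_sum s fun i hi => hB i hi l

theorem isPolyMap_pi {ι : Type*} [Finite ι] {F : ι → Type*} [∀ i, AddCommGroup (F i)]
    [∀ i, Module ℂ (F i)] {B : E → ∀ i, F i} (hB : ∀ i, IsPolyMap (fun x => B x i)) :
    IsPolyMap B := fun l => by
  classical
  cases nonempty_fintype ι
  have : ∀ x, l (B x) = ∑ i, (l ∘ₗ LinearMap.single ℂ F i) (B x i) := fun x => by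
    conv_lhs => rw [← Finset.univ_sum_single (B x), map_sum]
    rfl
  simp only [this]
  exact polyFun_sum _ fun i _ => hB i _

theorem IsPolyMap.apply {ι : Type*} {F : ι → Type*} [∀ i, AddCommGroup (F i)]
    [∀ i, Module ℂ (F i)] {B : E → ∀ i, F i} (hB : IsPolyMap B) (i : ι) :
    IsPolyMap (fun x => B x i) := (isPolyMap_linear (LinearMap.proj i)).comp hB

theorem IsPolyMap.prodMk {A : E → E'} {B : E → E''} (hA : IsPolyMap A) (hB : IsPolyMap B) :
    IsPolyMap (fun x => (A x, B x)) := fun l => by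
  have : ∀ x, l (A x, B x) =
      (l ∘ₗ LinearMap.inl ℂ E' E'') (A x) + (l ∘ₗ LinearMap.inr ℂ E' E'') (B x) :=
    fun x => by simp [← map_add]
  simp only [this]
  exact polyFun_add (hA _) (hB _)

theorem IsPolyMap.fst {A : E → E' × E''} (hA : IsPolyMap A) : IsPolyMap (fun x => (A x).1) :=
  (isPolyMap_linear (LinearMap.fst ℂ E' E'')).comp hA

theorem IsPolyMap.snd {A : E → E' × E''} (hA : IsPolyMap A) : IsPolyMap (fun x => (A x).2) :=
  (isPolyMap_linear (LinearMap.snd ℂ E' E'')).comp hA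

/-- A polynomial function of one variable is given by a polynomial. -/
theorem exists_polynomial_of_mem_polyFun {f : ℂ → ℂ} (hf : f ∈ polyFun ℂ) :
    ∃ P : Polynomial ℂ, ∀ t, f t = P.eval t := by
  induction hf using Algebra.adjoin_induction with
  | mem f hf =>
    obtain ⟨l, rfl⟩ := hf
    refine ⟨Polynomial.C (l 1) * Polynomial.X, fun t => ?_⟩
    simp only [Polynomial.eval_mul, Polynomial.eval_C, Polynomial.eval_X]
    rw [mul_comm, ← smul_eq_mul, ← map_smul, smul_eq_mul, mul_one]
  | algebraMap c => exact ⟨Polynomial.C c, fun t => by simp⟩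
  | add f g _ _ hf hg =>
    obtain ⟨P, hP⟩ := hf; obtain ⟨Q, hQ⟩ := hg
    exact ⟨P + Q, fun t => by simp [hP, hQ]⟩
  | mul f g _ _ hf hg =>
    obtain ⟨P, hP⟩ := hf; obtain ⟨Q, hQ⟩ := hg
    exact ⟨P * Q, fun t => by simp [hP, hQ]⟩

/-- A polynomial function of one variable vanishing on an infinite set is zero. -/
theorem polyFun_eq_zero_of_infinite {f : ℂ → ℂ} (hf : f ∈ polyFun ℂ) (h : {t | f t = 0}.Infinite)
    (t : ℂ) : f t = 0 := by
  obtain ⟨P, hP⟩ := exists_polynomial_of_mem_polyFun hf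
  have : P = 0 := P.eq_zero_of_infinite_isRoot (h.mono fun t ht => by simpa [hP] using ht)
  rw [hP, this, Polynomial.eval_zero]

theorem polyFun_finite_zeros {f : ℂ → ℂ} (hf : f ∈ polyFun ℂ) {t₀ : ℂ} (h : f t₀ ≠ 0) :
    {t | f t = 0}.Finite := by
  by_contra hinf
  exact h (polyFun_eq_zero_of_infinite hf hinf t₀)

theorem isPolyMap_line (x y : E) : IsPolyMap (fun t : ℂ => x + t • y) :=
  (isPolyMap_const x).add (IsPolyMap.smul (linear_mem_polyFun LinearMap.id) (isPolyMap_const y))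

/-- The algebra of polynomial functions is a domain. -/
theorem polyFun_mul_ne_zero {f g : E → ℂ} (hf : f ∈ polyFun E) (hg : g ∈ polyFun E)
    (hf0 : ∃ x, f x ≠ 0) (hg0 : ∃ x, g x ≠ 0) : ∃ x, f x * g x ≠ 0 := by
  obtain ⟨x, hx⟩ := hf0
  obtain ⟨y, hy⟩ := hg0
  have h1 := polyFun_finite_zeros (polyFun_comp hf (isPolyMap_line x (y - x))) (t₀ := 0) (by simpa)
  have h2 := polyFun_finite_zeros (polyFun_comp hg (isPolyMap_line x (y - x))) (t₀ := 1) (by simpa)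
  obtain ⟨t, ht⟩ := (h1.union h2).infinite_compl.nonempty
  simp only [Set.mem_compl_iff, Set.mem_union, Set.mem_ofPred_eq, not_or] at ht
  exact ⟨_, mul_ne_zero ht.1 ht.2⟩

end PolyFun

instance (V : Type*) [AddCommGroup V] [Module ℂ V] [FiniteDimensional ℂ V] :
    FiniteDimensional ℂ (V [⋀^Fin 3]→ₗ[ℂ] ℂ) :=
  Module.Finite.of_injective (AlternatingMap.toMultilinearMapLM (S := ℂ))
    AlternatingMap.coe_multilinearMap_injective

theorem alternating_apply_mem_polyFun {E V : Type*} [AddCommGroup E] [Module ℂ E]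
    [AddCommGroup V] [Module ℂ V] [FiniteDimensional ℂ V] {a : E → V [⋀^Fin 3]→ₗ[ℂ] ℂ}
    {v : E → Fin 3 → V} (ha : IsPolyMap a) (hv : ∀ i, IsPolyMap (fun x => v x i)) :
    (fun x => a x (v x)) ∈ polyFun E := by
  classical
  let b := Module.finBasis ℂ V
  have key : ∀ x, a x (v x) = ∑ r : Fin 3 → Fin (finrank ℂ V),
      (∏ i, b.repr (v x i) (r i)) * a x (fun i => b (r i)) := fun x => by
    have h : v x = fun i => ∑ j, b.repr (v x i) j • b j := by
      ext i; exact (b.sum_repr (v x i)).symm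
    conv_lhs => rw [h]
    rw [← AlternatingMap.coe_multilinearMap, MultilinearMap.map_sum]
    refine Finset.sum_congr rfl fun r _ => ?_
    rw [MultilinearMap.map_smul_univ, smul_eq_mul]
  simp only [key]
  refine polyFun_sum _ fun r _ => polyFun_mul (polyFun_prod _ fun i _ => ?_) ?_
  · exact hv i (b.coord (r i))
  · exact ha { toFun := fun β => β (fun i => b (r i)), map_add' := fun _ _ => rfl,
               map_smul' := fun _ _ => rfl }

/-! ### Generic fibres of families of quasi-affine varieties -/

section Generic

open MvPolynomial

variable {E P : Type*} [AddCommGroup E] [Module ℂ E] [AddCommGroup P] [Module ℂ P]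

/-- `p` is in the Zariski closure of `S`: every polynomial function vanishing on `S` vanishes
at `p`. -/
def InPolyClosure (S : Set E) (p : E) : Prop :=
  ∀ f ∈ polyFun E, (∀ q ∈ S, f q = 0) → f p = 0

theorem InPolyClosure.subset {S : Set E} {p : E} (h : p ∈ S) : InPolyClosure S p :=
  fun _ _ h' => h' p h

/-- Limits along polynomial curves stay in the Zariski closure. -/
theorem InPolyClosure.of_curve {S : Set E} {γ : ℂ → E} (hγ : IsPolyMap γ)
    (h : {t | ¬ InPolyClosure S (γ t)}.Finite) (t : ℂ) : InPolyClosure S (γ t) := by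
  intro f hf hS
  refine polyFun_eq_zero_of_infinite (polyFun_comp hf hγ) (h.infinite_compl.mono ?_) t
  intro t ht
  simp only [Set.mem_compl_iff, Set.mem_ofPred_eq, not_not] at ht
  exact ht f hf hS

variable [FiniteDimensional ℂ E] [FiniteDimensional ℂ P]

/-- The function on `E × P` given by a polynomial in coordinates of `E` whose coefficients are
polynomials in coordinates of `P`. -/
noncomputable def evalPair
    (p : MvPolynomial (Fin (finrank ℂ E)) (MvPolynomial (Fin (finrank ℂ P)) ℂ)) (q : E × P) : ℂ :=
  eval ((finBasis ℂ E).equivFun q.1) (specialize _ ((finBasis ℂ P).equivFun q.2) p)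

theorem eval_repr_mem_polyFun (p : MvPolynomial (Fin (finrank ℂ E)) ℂ) :
    (fun x => eval ((finBasis ℂ E).equivFun x) p) ∈ polyFun E := by
  induction p using MvPolynomial.induction_on with
  | C c => simpa using const_mem_polyFun c
  | add p q hp hq => simpa using polyFun_add hp hq
  | mul_X p i hp =>
    simpa using polyFun_mul hp (linear_mem_polyFun ((finBasis ℂ E).coord i))

theorem evalPair_mem_polyFun
    (p : MvPolynomial (Fin (finrank ℂ E)) (MvPolynomial (Fin (finrank ℂ P)) ℂ)) :
    (evalPair p : E × P → ℂ) ∈ polyFun (E × P) := by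
  unfold evalPair
  induction p using MvPolynomial.induction_on with
  | C c =>
    simpa using polyFun_comp (eval_repr_mem_polyFun c) (isPolyMap_linear (LinearMap.snd ℂ E P))
  | add p q hp hq => simpa using polyFun_add hp hq
  | mul_X p i hp =>
    simpa using polyFun_mul hp
      (linear_mem_polyFun (((finBasis ℂ E).coord i).comp (LinearMap.fst ℂ E P)))

theorem exists_eval_eq {f : E → ℂ} (hf : f ∈ polyFun E) :
    ∃ p : MvPolynomial (Fin (finrank ℂ E)) ℂ, ∀ x, f x = eval ((finBasis ℂ E).equivFun x) p := by
  induction hf using Algebra.adjoin_induction with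
  | mem f hf =>
    obtain ⟨l, rfl⟩ := hf
    refine ⟨∑ i, C (l (finBasis ℂ E i)) * X i, fun x => ?_⟩
    conv_lhs => rw [← (finBasis ℂ E).sum_equivFun x]
    simp only [map_sum, map_smul, smul_eq_mul, map_mul, eval_C, eval_X, mul_comm]
  | algebraMap c => exact ⟨C c, fun t => by simp⟩
  | add f g _ _ hf hg =>
    obtain ⟨P, hP⟩ := hf; obtain ⟨Q, hQ⟩ := hg
    exact ⟨P + Q, fun t => by simp [hP, hQ]⟩
  | mul f g _ _ hf hg =>
    obtain ⟨P, hP⟩ := hf; obtain ⟨Q, hQ⟩ := hg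
    exact ⟨P * Q, fun t => by simp [hP, hQ]⟩

theorem exists_evalPair_eq {f : E × P → ℂ} (hf : f ∈ polyFun (E × P)) :
    ∃ p, ∀ q, f q = evalPair p q := by
  unfold evalPair
  induction hf using Algebra.adjoin_induction with
  | mem f hf =>
    obtain ⟨l, rfl⟩ := hf
    obtain ⟨p₁, h₁⟩ := exists_eval_eq (linear_mem_polyFun (l.comp (LinearMap.inl ℂ E P)))
    obtain ⟨p₂, h₂⟩ := exists_eval_eq (linear_mem_polyFun (l.comp (LinearMap.inr ℂ E P)))
    refine ⟨map C p₁ + C p₂, fun q => ?_⟩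
    have h3 : l q = l.comp (LinearMap.inl ℂ E P) q.1 + l.comp (LinearMap.inr ℂ E P) q.2 := by
      simp [← map_add]
    change l q = _
    rw [h3, h₁, h₂, map_add, map_add, map_map, map_C, eval_C]
    congr 2
    have : (eval ((finBasis ℂ P).equivFun q.2)).comp C = RingHom.id ℂ := by ext; simp
    rw [this, map_id]
  | algebraMap c => exact ⟨C (C c), fun t => by simp⟩
  | add f g _ _ hf hg =>
    obtain ⟨P, hP⟩ := hf; obtain ⟨Q, hQ⟩ := hg
    exact ⟨P + Q, fun t => by simp [hP, hQ]⟩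
  | mul f g _ _ hf hg =>
    obtain ⟨P, hP⟩ := hf; obtain ⟨Q, hQ⟩ := hg
    exact ⟨P * Q, fun t => by simp [hP, hQ]⟩

/-- The ideal of polynomials vanishing on a subset of `E × P`. -/
noncomputable def idealOf (S : Set (E × P)) :
    Ideal (MvPolynomial (Fin (finrank ℂ E)) (MvPolynomial (Fin (finrank ℂ P)) ℂ)) where
  carrier := {p | ∀ q ∈ S, evalPair p q = 0}
  add_mem' hp hq x hx := by
    have h1 := hp x hx
    have h2 := hq x hx
    unfold evalPair at *
    rw [map_add, map_add, h1, h2, add_zero]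
  zero_mem' x hx := by simp [evalPair]
  smul_mem' c p hp x hx := by
    have h1 := hp x hx
    unfold evalPair at *
    rw [smul_eq_mul, map_mul, map_mul, h1, mul_zero]

theorem mem_zeroLocus_specialize {S : Set (E × P)} {x : E} {α : P} :
    (finBasis ℂ E).equivFun x ∈
        zeroLocus ℂ ((idealOf S).map (specialize _ ((finBasis ℂ P).equivFun α))) ↔
      InPolyClosure S (x, α) := by
  rw [mem_zeroLocus_iff]
  constructor
  · intro h f hf hS
    obtain ⟨p, hp⟩ := exists_evalPair_eq hf
    rw [hp]
    have := h _ (Ideal.mem_map_of_mem _ (show p ∈ idealOf S from fun q hq => by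
      rw [← hp, hS q hq]))
    simpa [evalPair, aeval_eq_eval] using this
  · intro h p hp
    obtain ⟨i, hi, rfl⟩ :=
      (Ideal.mem_map_iff_of_surjective _ (specialize_surjective _)).1 hp
    have := h _ (evalPair_mem_polyFun i) hi
    simpa [evalPair, aeval_eq_eval] using this

/-- In a family `S ⊆ E × P` which is open, given by `g ≠ 0`, in its Zariski closure, the fibre of
`S` over a generic parameter is dense in the fibre of the closure. -/
theorem exists_generic_dense (S : Set (E × P)) (g : E × P → ℂ) (hg : g ∈ polyFun (E × P))
    (hgS : ∀ q ∈ S, g q ≠ 0) (hS : ∀ q, InPolyClosure S q → g q ≠ 0 → q ∈ S) :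
    ∃ s ∈ polyFun P, (∃ α, s α ≠ 0) ∧ ∀ α, s α ≠ 0 → ∀ x, InPolyClosure S (x, α) →
      InPolyClosure {x' | (x', α) ∈ S} x := by
  obtain ⟨G, hG⟩ := exists_evalPair_eq hg
  have hmul : ∀ p q : MvPolynomial (Fin (finrank ℂ E)) (MvPolynomial (Fin (finrank ℂ P)) ℂ),
      ∀ z : E × P, evalPair (p * q) z = evalPair p z * evalPair q z := fun p q z => by
    simp [evalPair]
  obtain ⟨s, hs, H⟩ := exists_generic_nonzerodivisor (idealOf S) G (by
    intro h hh q hq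
    have := hh q hq
    rw [hmul, ← hG] at this
    exact (mul_eq_zero.1 this).resolve_left (hgS q hq))
  refine ⟨_, eval_repr_mem_polyFun s, ?_, ?_⟩
  · by_contra! h
    apply hs
    apply MvPolynomial.funext
    intro y
    have := h ((finBasis ℂ P).equivFun.symm y)
    rwa [LinearEquiv.apply_symm_apply] at this
  · intro α hα x hx f hf hfS
    set y := (finBasis ℂ P).equivFun α with hy
    set Iy := (idealOf S).map (specialize (Fin (finrank ℂ E)) y) with hIy
    obtain ⟨h, hh⟩ := exists_eval_eq hf
    have h1 : specialize _ y G * h ∈ vanishingIdeal ℂ (zeroLocus ℂ Iy) := by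
      rw [mem_vanishingIdeal_iff]
      intro z hz
      obtain ⟨x', rfl⟩ := (finBasis ℂ E).equivFun.surjective z
      rw [mem_zeroLocus_specialize] at hz
      rw [aeval_eq_eval, map_mul, ← hh]
      by_cases hgx : g (x', α) = 0
      · rw [hG] at hgx
        have : eval ((finBasis ℂ E).equivFun x') (specialize _ y G) = 0 := hgx
        rw [this, zero_mul]
      · rw [hfS x' (hS _ hz hgx), mul_zero]
    rw [vanishingIdeal_zeroLocus_eq_radical] at h1
    obtain ⟨n, hn⟩ := h1
    have h2 : h ^ n ∈ Iy := by
      rw [mul_pow] at hn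
      have : ∀ k, specialize _ y G ^ k * h ^ n ∈ Iy → h ^ n ∈ Iy := by
        intro k
        induction k with
        | zero => simp
        | succ k ih =>
          intro hk
          apply ih
          apply H y hα
          rwa [← mul_assoc, ← pow_succ']
      exact this n hn
    have h3 := (mem_zeroLocus_iff.1 (mem_zeroLocus_specialize.2 hx)) _ h2
    rw [aeval_eq_eval, map_pow, ← hh] at h3
    exact eq_zero_of_pow_eq_zero h3

/-- If the projection of `S ⊆ E × P` to `P` is Zariski dense, then the closure of `S` has a point
over a generic parameter. -/
theorem exists_generic_nonempty (S : Set (E × P))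
    (hS : ∀ s ∈ polyFun P, (∀ q ∈ S, s q.2 = 0) → ∀ α, s α = 0) :
    ∃ s ∈ polyFun P, (∃ α, s α ≠ 0) ∧ ∀ α, s α ≠ 0 → ∃ x, InPolyClosure S (x, α) := by
  obtain ⟨s, hs, H⟩ := exists_generic_ne_top (idealOf S) (by
    intro a ha
    apply MvPolynomial.funext
    intro y
    have := hS _ (eval_repr_mem_polyFun a) (fun q hq => by simpa [evalPair] using ha q hq)
      ((finBasis ℂ P).equivFun.symm y)
    rwa [LinearEquiv.apply_symm_apply] at this)
  refine ⟨_, eval_repr_mem_polyFun s, ?_, ?_⟩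
  · by_contra! h
    apply hs
    apply MvPolynomial.funext
    intro y
    have := h ((finBasis ℂ P).equivFun.symm y)
    rwa [LinearEquiv.apply_symm_apply] at this
  · intro α hα
    by_contra! hne
    apply H _ hα
    rw [← Ideal.radical_eq_top, ← vanishingIdeal_zeroLocus_eq_radical (K := ℂ)]
    have : zeroLocus ℂ ((idealOf S).map (specialize _ ((finBasis ℂ P).equivFun α))) = ∅ := by
      rw [Set.eq_empty_iff_forall_notMem]
      intro z hz
      obtain ⟨x', rfl⟩ := (finBasis ℂ E).equivFun.surjective z
      exact hne x' (mem_zeroLocus_specialize.1 hz)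
    rw [this, vanishingIdeal_empty]

end Generic

/-! ### Trilinear calculus and isotropic subspaces -/

section Tri

variable {V : Type*} [AddCommGroup V] [Module ℂ V]

/-- An alternating 3-form as a trilinear map. -/
def tri (α : V [⋀^Fin 3]→ₗ[ℂ] ℂ) : V →ₗ[ℂ] V →ₗ[ℂ] V →ₗ[ℂ] ℂ :=
  LinearMap.mk₂ ℂ (fun x y =>
    { toFun := fun z => ((α.curryLeft x).curryLeft y).curryLeft z ![]
      map_add' := fun _ _ => by rw [map_add]; rfl
      map_smul' := fun _ _ => by rw [map_smul]; rfl })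
    (fun x x' y => by ext z; simp only [map_add]; rfl)
    (fun c x y => by ext z; simp only [map_smul]; rfl)
    (fun x y y' => by ext z; simp only [map_add]; rfl)
    (fun c x y => by ext z; simp only [map_smul]; rfl)

theorem tri_apply (α : V [⋀^Fin 3]→ₗ[ℂ] ℂ) (x y z : V) : tri α x y z = α ![x, y, z] := rfl

theorem apply_eq_tri (α : V [⋀^Fin 3]→ₗ[ℂ] ℂ) (v : Fin 3 → V) : α v = tri α (v 0) (v 1) (v 2) := by
  rw [tri_apply]
  congr 1
  ext i; fin_cases i <;> rfl

theorem tri_swap (α : V [⋀^Fin 3]→ₗ[ℂ] ℂ) (x y z : V) : tri α y x z = -tri α x y z := by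
  rw [tri_apply, tri_apply, ← α.map_swap ![x, y, z] (show (0 : Fin 3) ≠ 1 by decide)]
  congr 1
  ext i; fin_cases i <;> rfl

theorem tri_swap' (α : V [⋀^Fin 3]→ₗ[ℂ] ℂ) (x y z : V) : tri α x z y = -tri α x y z := by
  rw [tri_apply, tri_apply, ← α.map_swap ![x, y, z] (show (1 : Fin 3) ≠ 2 by decide)]
  congr 1
  ext i; fin_cases i <;> rfl

theorem tri_rotate (α : V [⋀^Fin 3]→ₗ[ℂ] ℂ) (x y z : V) : tri α y z x = tri α x y z := by
  rw [tri_swap' α y x z, tri_swap α x y z, neg_neg]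

@[simp] theorem tri_self_left (α : V [⋀^Fin 3]→ₗ[ℂ] ℂ) (x y : V) : tri α x x y = 0 :=
  self_eq_neg.1 (tri_swap α x x y)

@[simp] theorem tri_self_right (α : V [⋀^Fin 3]→ₗ[ℂ] ℂ) (x y : V) : tri α x y y = 0 :=
  self_eq_neg.1 (tri_swap' α x y y)

@[simp] theorem tri_self_outer (α : V [⋀^Fin 3]→ₗ[ℂ] ℂ) (x y : V) : tri α x y x = 0 := by
  rw [tri_swap', tri_self_left, neg_zero]

theorem tri_add (α β : V [⋀^Fin 3]→ₗ[ℂ] ℂ) (x y z : V) :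
    tri (α + β) x y z = tri α x y z + tri β x y z := rfl

theorem tri_smul (c : ℂ) (α : V [⋀^Fin 3]→ₗ[ℂ] ℂ) (x y z : V) :
    tri (c • α) x y z = c * tri α x y z := rfl

theorem tri_compLinearMap (α : V [⋀^Fin 3]→ₗ[ℂ] ℂ) (f : V →ₗ[ℂ] V) (x y z : V) :
    tri (α.compLinearMap f) x y z = tri α (f x) (f y) (f z) := by
  rw [tri_apply, tri_apply, AlternatingMap.compLinearMap_apply]
  congr 1
  ext i; fin_cases i <;> rfl

theorem tri_mem_polyFun [FiniteDimensional ℂ V] {E : Type*} [AddCommGroup E] [Module ℂ E]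
    {a : E → V [⋀^Fin 3]→ₗ[ℂ] ℂ} {x y z : E → V} (ha : IsPolyMap a) (hx : IsPolyMap x)
    (hy : IsPolyMap y) (hz : IsPolyMap z) : (fun e => tri (a e) (x e) (y e) (z e)) ∈ polyFun E := by
  simp only [tri_apply]
  refine alternating_apply_mem_polyFun ha fun i => ?_
  fin_cases i
  exacts [hx, hy, hz]

/-- The 3-form `α` vanishes identically on the subspace `W`. -/
def IsIsotropic (α : V [⋀^Fin 3]→ₗ[ℂ] ℂ) (W : Submodule ℂ V) : Prop :=
  ∀ x ∈ W, ∀ y ∈ W, ∀ z ∈ W, tri α x y z = 0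

theorem mem_fano_iff {α : V [⋀^Fin 3]→ₗ[ℂ] ℂ} {W : Gr V 6} : W ∈ fano α ↔ IsIsotropic α W.1 := by
  constructor
  · intro h x hx y hy z hz
    exact h ![x, y, z] fun i => by fin_cases i <;> assumption
  · intro h v hv
    rw [apply_eq_tri]
    exact h _ (hv 0) _ (hv 1) _ (hv 2)

theorem IsIsotropic.mono {α : V [⋀^Fin 3]→ₗ[ℂ] ℂ} {W W' : Submodule ℂ V} (h : IsIsotropic α W)
    (hle : W' ≤ W) : IsIsotropic α W' :=
  fun x hx y hy z hz => h x (hle hx) y (hle hy) z (hle hz)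

theorem isIsotropic_span_iff {α : V [⋀^Fin 3]→ₗ[ℂ] ℂ} {ι : Type*} {u : ι → V} :
    IsIsotropic α (Submodule.span ℂ (Set.range u)) ↔ ∀ i j l, tri α (u i) (u j) (u l) = 0 := by
  constructor
  · intro h i j l
    exact h _ (Submodule.subset_span ⟨i, rfl⟩) _ (Submodule.subset_span ⟨j, rfl⟩) _
      (Submodule.subset_span ⟨l, rfl⟩)
  · intro h x hx y hy z hz
    have h1 : ∀ i j, tri α (u i) (u j) z = 0 := fun i j => by
      have : Submodule.span ℂ (Set.range u) ≤ LinearMap.ker (tri α (u i) (u j)) := by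
        rw [Submodule.span_le]; rintro _ ⟨l, rfl⟩; exact h i j l
      exact this hz
    have h2 : ∀ i, tri α (u i) y z = 0 := fun i => by
      have : Submodule.span ℂ (Set.range u) ≤ LinearMap.ker ((tri α (u i)).flip z) := by
        rw [Submodule.span_le]; rintro _ ⟨l, rfl⟩; exact h1 i l
      exact this hy
    have : Submodule.span ℂ (Set.range u) ≤ LinearMap.ker (((tri α).flip y).flip z) := by
      rw [Submodule.span_le]; rintro _ ⟨l, rfl⟩; exact h2 l
    exact this hx

theorem isIsotropic_sup {α : V [⋀^Fin 3]→ₗ[ℂ] ℂ} {A B : Submodule ℂ V} (hA : IsIsotropic α A)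
    (hB : IsIsotropic α B) (hAB : ∀ x ∈ A, ∀ y ∈ A, ∀ z ∈ B, tri α x y z = 0)
    (hBA : ∀ x ∈ B, ∀ y ∈ B, ∀ z ∈ A, tri α x y z = 0) : IsIsotropic α (A ⊔ B) := by
  intro x hx y hy z hz
  obtain ⟨a, ha, b, hb, rfl⟩ := Submodule.mem_sup.1 hx
  obtain ⟨a', ha', b', hb', rfl⟩ := Submodule.mem_sup.1 hy
  obtain ⟨a'', ha'', b'', hb'', rfl⟩ := Submodule.mem_sup.1 hz
  simp only [map_add, LinearMap.add_apply]
  rw [hA a ha a' ha' a'' ha'', hB b hb b' hb' b'' hb'', hAB a ha a' ha' b'' hb'',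
    hBA b hb b' hb' a'' ha'', tri_swap' α a a'' b', hAB a ha a'' ha'' b' hb',
    ← tri_rotate α b a' a'', hAB a' ha' a'' ha'' b hb, ← tri_rotate α a b' b'',
    tri_rotate α a b' b'', ← tri_rotate α a b' b'', hBA b' hb' b'' hb'' a ha,
    tri_swap' α b b'' a', hBA b hb b'' hb'' a' ha']
  simp

end Tri

/-! ### The linear system attached to an adapted frame -/

section Link

variable {V : Type*} [AddCommGroup V] [Module ℂ V]

/-- The 6-tuple of vectors composed of two triples. -/
def join (y z : Fin 3 → V) : Fin 6 → V := Sum.elim y z ∘ (finSumFinEquiv (m := 3) (n := 3)).symm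

omit [AddCommGroup V] [Module ℂ V] in
theorem range_join (y z : Fin 3 → V) : Set.range (join y z) = Set.range y ∪ Set.range z := by
  rw [join, Set.range_comp, EquivLike.range_eq_univ, Set.image_univ, Set.Sum.elim_range]

theorem span_join (y z : Fin 3 → V) : Submodule.span ℂ (Set.range (join y z)) =
    Submodule.span ℂ (Set.range y) ⊔ Submodule.span ℂ (Set.range z) := by
  rw [range_join, Submodule.span_union]

theorem linearIndependent_join {y z : Fin 3 → V} :
    LinearIndependent ℂ (join y z) ↔ LinearIndependent ℂ (Sum.elim y z) :=
  linearIndependent_equiv _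

theorem isPolyMap_join {E : Type*} [AddCommGroup E] [Module ℂ E] {y z : E → Fin 3 → V}
    (hy : IsPolyMap y) (hz : IsPolyMap z) : IsPolyMap (fun e => join (y e) (z e)) := by
  refine isPolyMap_pi fun i => ?_
  obtain ⟨j, rfl⟩ := (finSumFinEquiv (m := 3) (n := 3)).surjective i
  rcases j with j | j
  · simpa [join] using hy.apply j
  · simpa [join] using hz.apply j

/-- The matrix of the linear map sending `φ : ⟨a⟩ → ⟨k⟩` to the form
`(x ∧ y) ⊗ z ↦ α(x, φ y, z) + α(φ x, y, z)` on `Λ²⟨a⟩ ⊗ ⟨b⟩`; the index `p` of a row stands for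
`a (p + 1) ∧ a (p + 2)`. -/
def linkMatrix (α : V [⋀^Fin 3]→ₗ[ℂ] ℂ) (k a b : Fin 3 → V) :
    Matrix (Fin 3 × Fin 3) (Fin 3 × Fin 3) ℂ :=
  Matrix.of fun r c =>
    (if c.1 = r.1 + 2 then tri α (a (r.1 + 1)) (k c.2) (b r.2) else 0) +
    (if c.1 = r.1 + 1 then tri α (k c.2) (a (r.1 + 2)) (b r.2) else 0)

/-- The right-hand side of the linear system for `φ` expressing that `α` vanishes on
`Λ²⟨a + φ a⟩ ⊗ ⟨b⟩`. -/
def linkRhs (α : V [⋀^Fin 3]→ₗ[ℂ] ℂ) (a b : Fin 3 → V) (r : Fin 3 × Fin 3) : ℂ :=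
  -tri α (a (r.1 + 1)) (a (r.1 + 2)) (b r.2)

theorem linkMatrix_mulVec (α : V [⋀^Fin 3]→ₗ[ℂ] ℂ) (k a b : Fin 3 → V) (φ : Fin 3 × Fin 3 → ℂ)
    (p z : Fin 3) : (linkMatrix α k a b).mulVec φ (p, z) =
      tri α (a (p + 1)) (∑ l, φ (p + 2, l) • k l) (b z) +
      tri α (∑ l, φ (p + 1, l) • k l) (a (p + 2)) (b z) := by
  simp only [Matrix.mulVec, dotProduct, linkMatrix, Matrix.of_apply, add_mul, ite_mul, zero_mul,
    Finset.sum_add_distrib, Fintype.sum_prod_type, map_sum, map_smul, LinearMap.sum_apply,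
    LinearMap.smul_apply, smul_eq_mul]
  congr 1
  · rw [Finset.sum_comm]
    simp [mul_comm]
  · rw [Finset.sum_comm]
    simp [mul_comm]

/-- The solution of the linear system, given by Cramer's rule and scaled by the determinant. -/
def linkSolution (α : V [⋀^Fin 3]→ₗ[ℂ] ℂ) (k a b : Fin 3 → V) (i : Fin 3) : V :=
  (linkMatrix α k a b).det • a i +
    ∑ l, ((linkMatrix α k a b).adjugate.mulVec (linkRhs α a b)) (i, l) • k l

theorem linkSolution_eq {α : V [⋀^Fin 3]→ₗ[ℂ] ℂ} {k a b : Fin 3 → V} {φ : Fin 3 × Fin 3 → ℂ}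
    (h : (linkMatrix α k a b).mulVec φ = linkRhs α a b) (i : Fin 3) :
    linkSolution α k a b i = (linkMatrix α k a b).det • (a i + ∑ l, φ (i, l) • k l) := by
  rw [linkSolution, ← h, Matrix.mulVec_mulVec, Matrix.adjugate_mul, Matrix.smul_mulVec,
    Matrix.one_mulVec, smul_add, Finset.smul_sum]
  simp only [Pi.smul_apply, smul_eq_mul, mul_smul]

theorem exists_linkMatrix_mulVec_eq {α : V [⋀^Fin 3]→ₗ[ℂ] ℂ} {k a b : Fin 3 → V}
    (h : (linkMatrix α k a b).det ≠ 0) :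
    ∃ φ, (linkMatrix α k a b).mulVec φ = linkRhs α a b :=
  ⟨(linkMatrix α k a b)⁻¹.mulVec (linkRhs α a b), by
    rw [Matrix.mulVec_mulVec, Matrix.mul_nonsing_inv _ (isUnit_iff_ne_zero.2 h), Matrix.one_mulVec]⟩

section Poly

variable [FiniteDimensional ℂ V] {E : Type*} [AddCommGroup E] [Module ℂ E]
    {A : E → V [⋀^Fin 3]→ₗ[ℂ] ℂ}
  {k a b : E → Fin 3 → V}

theorem linkMatrix_mem_polyFun (hA : IsPolyMap A) (hk : IsPolyMap k) (ha : IsPolyMap a)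
    (hb : IsPolyMap b) (r c) : (fun e => linkMatrix (A e) (k e) (a e) (b e) r c) ∈ polyFun E := by
  simp only [linkMatrix, Matrix.of_apply]
  exact polyFun_add
    (polyFun_ite (tri_mem_polyFun hA (ha.apply _) (hk.apply _) (hb.apply _)) (const_mem_polyFun 0))
    (polyFun_ite (tri_mem_polyFun hA (hk.apply _) (ha.apply _) (hb.apply _)) (const_mem_polyFun 0))

theorem isPolyMap_linkSolution (hA : IsPolyMap A) (hk : IsPolyMap k) (ha : IsPolyMap a)
    (hb : IsPolyMap b) : IsPolyMap (fun e => linkSolution (A e) (k e) (a e) (b e)) := by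
  refine isPolyMap_pi fun i => ?_
  have hM := linkMatrix_mem_polyFun hA hk ha hb
  refine (IsPolyMap.smul (polyFun_det hM) (ha.apply i)).add (IsPolyMap.sum _ fun l _ =>
    IsPolyMap.smul ?_ (hk.apply l))
  simp only [Matrix.mulVec, dotProduct]
  refine polyFun_sum _ fun j _ => polyFun_mul (polyFun_adjugate hM _ _) ?_
  exact polyFun_neg (tri_mem_polyFun hA (ha.apply _) (ha.apply _) (hb.apply _))

end Poly

/-- The product of the two determinants governing the existence and uniqueness of the third
vertex of the triangle. -/
def disc (α : V [⋀^Fin 3]→ₗ[ℂ] ℂ) (x : Fin 3 → Fin 3 → V) : ℂ :=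
  (linkMatrix α (x 0) (x 1) (x 2)).det * (linkMatrix α (x 0) (x 2) (x 1)).det

theorem disc_mem_polyFun [FiniteDimensional ℂ V] {E : Type*} [AddCommGroup E] [Module ℂ E]
    {A : E → V [⋀^Fin 3]→ₗ[ℂ] ℂ} {x : E → Fin 3 → Fin 3 → V} (hA : IsPolyMap A)
    (hx : IsPolyMap x) : (fun e => disc (A e) (x e)) ∈ polyFun E :=
  polyFun_mul
    (polyFun_det (linkMatrix_mem_polyFun hA (hx.apply 0) (hx.apply 1) (hx.apply 2)))
    (polyFun_det (linkMatrix_mem_polyFun hA (hx.apply 0) (hx.apply 2) (hx.apply 1)))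

/-- The span of the `i`-th and `j`-th triples of `x`. -/
def side (x : Fin 3 → Fin 3 → V) (i j : Fin 3) : Submodule ℂ V :=
  Submodule.span ℂ (Set.range (x i)) ⊔ Submodule.span ℂ (Set.range (x j))

theorem span_range_join (x : Fin 3 → Fin 3 → V) (i j : Fin 3) :
    Submodule.span ℂ (Set.range (join (x i) (x j))) = side x i j := span_join _ _

theorem mem_side_left (x : Fin 3 → Fin 3 → V) (i j c : Fin 3) : x i c ∈ side x i j :=
  Submodule.mem_sup_left (Submodule.subset_span ⟨c, rfl⟩)

theorem mem_side_right (x : Fin 3 → Fin 3 → V) (i j c : Fin 3) : x j c ∈ side x i j :=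
  Submodule.mem_sup_right (Submodule.subset_span ⟨c, rfl⟩)

/-- The tuple `x = (k, a, b)` is adapted to `α`: `α` vanishes on `⟨k, a⟩` and on `⟨k, b⟩`, and the
two linear systems are nondegenerate. -/
structure IsAdapted (α : V [⋀^Fin 3]→ₗ[ℂ] ℂ) (x : Fin 3 → Fin 3 → V) : Prop where
  iso₁ : IsIsotropic α (side x 0 1)
  iso₂ : IsIsotropic α (side x 0 2)
  disc_ne : disc α x ≠ 0

/-- All nine vectors of `x`. -/
def flat (x : Fin 3 → Fin 3 → V) (c : Fin 3 × Fin 3) : V := x c.1 c.2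

theorem linkMatrix_vecMul (α : V [⋀^Fin 3]→ₗ[ℂ] ℂ) (k a b : Fin 3 → V) (ν : Fin 3 → ℂ) (p : Fin 3)
    (c : Fin 3 × Fin 3) :
    Matrix.vecMul (fun r : Fin 3 × Fin 3 => if r.1 = p then ν r.2 else 0) (linkMatrix α k a b) c =
    (if c.1 = p + 2 then tri α (a (p + 1)) (k c.2) (∑ z, ν z • b z) else 0) +
    (if c.1 = p + 1 then tri α (k c.2) (a (p + 2)) (∑ z, ν z • b z) else 0) := by
  simp only [Matrix.vecMul, dotProduct, linkMatrix, Matrix.of_apply, Fintype.sum_prod_type, ite_mul,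
    zero_mul, map_sum, map_smul, smul_eq_mul]
  rw [Finset.sum_comm]
  simp only [Finset.sum_ite_eq', Finset.mem_univ, if_true, mul_add, Finset.sum_add_distrib]
  congr 1 <;> split_ifs <;> simp

/-- If the linear system is nondegenerate, no nonzero combination of the `b`'s lies in an
isotropic subspace containing the `k`'s and the `a`'s. -/
theorem eq_zero_of_sum_mem {α : V [⋀^Fin 3]→ₗ[ℂ] ℂ} {k a b : Fin 3 → V}
    (h : (linkMatrix α k a b).det ≠ 0) {W : Submodule ℂ V} (hW : IsIsotropic α W)
    (hk : ∀ i, k i ∈ W) (ha : ∀ i, a i ∈ W) {ν : Fin 3 → ℂ} (hν : ∑ z, ν z • b z ∈ W) : ν = 0 := by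
  have := Matrix.eq_zero_of_vecMul_eq_zero h
    (v := fun r : Fin 3 × Fin 3 => if r.1 = 0 then ν r.2 else 0) (by
      ext c
      rw [linkMatrix_vecMul, hW _ (ha _) _ (hk _) _ hν, hW _ (hk _) _ (ha _) _ hν]
      simp)
  ext z
  simpa using congrFun this (0, z)

theorem IsAdapted.det_ne {α : V [⋀^Fin 3]→ₗ[ℂ] ℂ} {x : Fin 3 → Fin 3 → V} (h : IsAdapted α x) :
    (linkMatrix α (x 0) (x 1) (x 2)).det ≠ 0 := left_ne_zero_of_mul h.disc_ne

theorem IsAdapted.det_ne' {α : V [⋀^Fin 3]→ₗ[ℂ] ℂ} {x : Fin 3 → Fin 3 → V} (h : IsAdapted α x) :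
    (linkMatrix α (x 0) (x 2) (x 1)).det ≠ 0 := right_ne_zero_of_mul h.disc_ne

/-- The nine vectors of an adapted tuple are linearly independent. -/
theorem IsAdapted.linearIndependent {α : V [⋀^Fin 3]→ₗ[ℂ] ℂ} {x : Fin 3 → Fin 3 → V}
    (h : IsAdapted α x) : LinearIndependent ℂ (flat x) := by
  rw [Fintype.linearIndependent_iff]
  intro g hg
  rw [Fintype.sum_prod_type, Fin.sum_univ_three] at hg
  simp only [flat] at hg
  have hmem : ∀ (i j c : Fin 3), ∑ l, g (c, l) • x i l ∈ side x i j := fun i j c =>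
    sum_mem fun l _ => Submodule.smul_mem _ _ (mem_side_left x i j l)
  have hmem' : ∀ (i j c : Fin 3), ∑ l, g (c, l) • x j l ∈ side x i j := fun i j c =>
    sum_mem fun l _ => Submodule.smul_mem _ _ (mem_side_right x i j l)
  have h2 : (fun l => g (2, l)) = 0 := by
    refine eq_zero_of_sum_mem h.det_ne h.iso₁ (mem_side_left x 0 1) (mem_side_right x 0 1) ?_
    rw [← neg_mem_iff, ← eq_neg_of_add_eq_zero_left hg]
    exact add_mem (hmem 0 1 0) (hmem' 0 1 1)
  have h1 : (fun l => g (1, l)) = 0 := by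
    refine eq_zero_of_sum_mem h.det_ne' h.iso₂ (mem_side_left x 0 2) (mem_side_right x 0 2) ?_
    rw [add_right_comm] at hg
    rw [← neg_mem_iff, ← eq_neg_of_add_eq_zero_left hg]
    exact add_mem (hmem 0 2 0) (hmem' 0 2 2)
  have h1' : ∀ l, g (1, l) = 0 := fun l => congrFun h1 l
  have h2' : ∀ l, g (2, l) = 0 := fun l => congrFun h2 l
  simp only [h1', h2', zero_smul, Finset.sum_const_zero, add_zero] at hg
  have h0 := Matrix.eq_zero_of_mulVec_eq_zero h.det_ne
    (v := fun c : Fin 3 × Fin 3 => if c.1 = 0 then g (0, c.2) else 0) (by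
      ext ⟨p, z⟩
      rw [linkMatrix_mulVec]
      have : ∀ q : Fin 3, ∑ l, (if (q, l).1 = 0 then g (0, (q, l).2) else 0) • x 0 l = 0 := by
        intro q
        by_cases hq : q = 0
        · simpa [hq] using hg
        · simp [hq]
      rw [this, this]
      simp)
  rintro ⟨i, l⟩
  fin_cases i
  · simpa using congrFun h0 (0, l)
  · exact h1' l
  · exact h2' l

end Link

/-! ### The third vertex of a triangle -/

section ThirdVertex

variable {V : Type*} [AddCommGroup V] [Module ℂ V]

theorem exists_dual_family {ι : Type*} [Finite ι] [DecidableEq ι] {v : ι → V}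
    (h : LinearIndependent ℂ v) : ∃ f : V →ₗ[ℂ] (ι → ℂ), ∀ i, f (v i) = Pi.single i 1 := by
  obtain ⟨g, hg⟩ := LinearMap.exists_leftInverse_of_injective
    (Finsupp.linearCombination ℂ v) (LinearMap.ker_eq_bot.2 h)
  refine ⟨(Finsupp.lcoeFun (R := ℂ)).comp g, fun i => ?_⟩
  have := LinearMap.congr_fun hg (Finsupp.single i 1)
  simp only [LinearMap.comp_apply, Finsupp.linearCombination_single, one_smul,
    LinearMap.id_apply] at this
  ext j
  simp [this, Finsupp.single_apply, Pi.single_apply, eq_comm]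

theorem le_finrank_of_linearIndependent [FiniteDimensional ℂ V] {n : ℕ} {v : Fin n → V}
    (h : LinearIndependent ℂ v) {W : Submodule ℂ V} (hv : ∀ i, v i ∈ W) : n ≤ finrank ℂ W := by
  have h1 := finrank_span_eq_card h
  rw [Fintype.card_fin] at h1
  rw [← h1]
  exact Submodule.finrank_mono (Submodule.span_le.2 (by rintro _ ⟨i, rfl⟩; exact hv i))

/-- A frame of the third vertex of the triangle with sides `⟨k, a⟩` and `⟨k, b⟩`. -/
def thirdFrame (α : V [⋀^Fin 3]→ₗ[ℂ] ℂ) (x : Fin 3 → Fin 3 → V) : Fin 6 → V :=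
  join (linkSolution α (x 0) (x 1) (x 2)) (linkSolution α (x 0) (x 2) (x 1))

/-- The third vertex of the triangle, as the span of its frame. -/
def thirdVertex (α : V [⋀^Fin 3]→ₗ[ℂ] ℂ) (x : Fin 3 → Fin 3 → V) : Submodule ℂ V :=
  Submodule.span ℂ (Set.range (thirdFrame α x))

variable {α : V [⋀^Fin 3]→ₗ[ℂ] ℂ} {x : Fin 3 → Fin 3 → V}

theorem linkSolution_mem_side (i j l : Fin 3) (c : Fin 3) :
    linkSolution α (x i) (x j) (x l) c ∈ side x i j :=
  add_mem (Submodule.smul_mem _ _ (mem_side_right x i j c))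
    (sum_mem fun l _ => Submodule.smul_mem _ _ (mem_side_left x i j l))

/-- A skew function of two indices in `Fin 3` is determined by its values on consecutive
indices. -/
theorem skew_eq_zero {D : Fin 3 → Fin 3 → ℂ} (hD : ∀ i j, D j i = -D i j)
    (h : ∀ p, D (p + 1) (p + 2) = 0) (i j : Fin 3) : D i j = 0 := by
  have h0 : D 1 2 = 0 := h 0
  have h1 : D 2 0 = 0 := h 1
  have h2 : D 0 1 = 0 := h 2
  have hd : ∀ i, D i i = 0 := fun i => self_eq_neg.1 (hD i i)
  fin_cases i <;> fin_cases j <;> simp [h0, h1, h2, hd, hD 0 1, hD 1 2, hD 2 0]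

/-- The solutions of the linear system satisfy the equations they are made for. -/
theorem tri_linkSolution {k a b : Fin 3 → V} {W : Submodule ℂ V}
    (hdet : (linkMatrix α k a b).det ≠ 0) (hW : IsIsotropic α W) (hk : ∀ i, k i ∈ W)
    (hb : ∀ i, b i ∈ W) (i j z : Fin 3) :
    tri α (linkSolution α k a b i) (linkSolution α k a b j) (b z) = 0 := by
  obtain ⟨φ, hφ⟩ := exists_linkMatrix_mulVec_eq hdet
  refine skew_eq_zero (D := fun i j => tri α (linkSolution α k a b i) (linkSolution α k a b j)
      (b z))
    (fun i j => tri_swap _ _ _ _) (fun p => ?_) i j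
  have h1 := congrFun hφ (p, z)
  rw [linkMatrix_mulVec, linkRhs] at h1
  have h2 : tri α (∑ l, φ (p + 1, l) • k l) (∑ l, φ (p + 2, l) • k l) (b z) = 0 :=
    hW _ (sum_mem fun l _ => W.smul_mem _ (hk l)) _ (sum_mem fun l _ => W.smul_mem _ (hk l)) _
        (hb z)
  rw [linkSolution_eq hφ, linkSolution_eq hφ]
  simp only [map_add, map_smul, LinearMap.add_apply, LinearMap.smul_apply, smul_eq_mul] at h1 h2 ⊢
  rw [h2]
  linear_combination (linkMatrix α k a b).det ^ 2 * h1

namespace IsAdapted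

theorem swap (h : IsAdapted α x) : IsAdapted α ![x 0, x 2, x 1] :=
  ⟨h.iso₂, h.iso₁, by rw [disc, mul_comm]; exact h.disc_ne⟩

/-- `α` vanishes on `Λ²⟨a'⟩ ⊗ ⟨b'⟩`, where `a'` and `b'` are the two halves of the frame of the
third vertex. -/
theorem tri_third (h : IsAdapted α x) (i j z : Fin 3) :
    tri α (linkSolution α (x 0) (x 1) (x 2) i) (linkSolution α (x 0) (x 1) (x 2) j)
      (linkSolution α (x 0) (x 2) (x 1) z) = 0 := by
  rw [linkSolution.eq_def α (x 0) (x 2) (x 1), map_add, map_smul,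
    tri_linkSolution h.det_ne h.iso₂ (mem_side_left x 0 2) (mem_side_right x 0 2), smul_zero,
        zero_add]
  exact h.iso₁ _ (linkSolution_mem_side 0 1 2 i) _ (linkSolution_mem_side 0 1 2 j) _
    (sum_mem fun l _ => Submodule.smul_mem _ _ (mem_side_left x 0 1 l))

theorem isIsotropic_thirdVertex (h : IsAdapted α x) : IsIsotropic α (thirdVertex α x) := by
  rw [thirdVertex, thirdFrame, span_join]
  have hspan : ∀ u v : Fin 3 → V, (∀ i j z, tri α (u i) (u j) (v z) = 0) →
      ∀ x ∈ Submodule.span ℂ (Set.range u), ∀ y ∈ Submodule.span ℂ (Set.range u),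
      ∀ z ∈ Submodule.span ℂ (Set.range v), tri α x y z = 0 := by
    intro u v huv x hx y hy z hz
    obtain ⟨c, rfl⟩ := (Submodule.mem_span_range_iff_exists_fun ℂ).1 hx
    obtain ⟨d, rfl⟩ := (Submodule.mem_span_range_iff_exists_fun ℂ).1 hy
    obtain ⟨e, rfl⟩ := (Submodule.mem_span_range_iff_exists_fun ℂ).1 hz
    simp [huv]
  refine isIsotropic_sup (h.iso₁.mono ?_) (h.iso₂.mono ?_) (hspan _ _ h.tri_third)
    (hspan _ _ h.swap.tri_third)
  · rw [Submodule.span_le]; rintro _ ⟨i, rfl⟩; exact linkSolution_mem_side 0 1 2 i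
  · rw [Submodule.span_le]; rintro _ ⟨i, rfl⟩; exact linkSolution_mem_side 0 2 1 i

variable (h : IsAdapted α x)
include h

theorem exists_dual : ∃ f : V →ₗ[ℂ] (Fin 3 × Fin 3 → ℂ),
    ∀ i j c, f (x i j) c = if c = (i, j) then 1 else 0 := by
  obtain ⟨f, hf⟩ := exists_dual_family h.linearIndependent
  exact ⟨f, fun i j c => by rw [show x i j = flat x (i, j) from rfl, hf, Pi.single_apply]⟩

theorem linearIndependent_thirdFrame : LinearIndependent ℂ (thirdFrame α x) := by
  obtain ⟨f, hf⟩ := h.exists_dual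
  rw [thirdFrame, linearIndependent_join, Fintype.linearIndependent_iff]
  intro g hg
  rw [Fintype.sum_sum_type] at hg
  have h1 := fun i => congrFun (congrArg f hg) (1, i)
  have h2 := fun i => congrFun (congrArg f hg) (2, i)
  simp [linkSolution, hf, h.det_ne, h.det_ne', Finset.sum_apply] at h1 h2
  rintro (i | i)
  exacts [h1 i, h2 i]

theorem side_inf_thirdVertex : side x 0 1 ⊓ side x 0 2 ⊓ thirdVertex α x = ⊥ := by
  obtain ⟨f, hf⟩ := h.exists_dual
  rw [eq_bot_iff]
  rintro v ⟨⟨h1, h2⟩, h3⟩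
  have hz : ∀ i j : Fin 3, i ≠ j → j ≠ 0 → ∀ v ∈ side x 0 i, ∀ c, f v (j, c) = 0 := by
    intro i j hij hj v hv c
    have : side x 0 i ≤ LinearMap.ker ((LinearMap.proj (j, c)).comp f) := by
      rw [side, ← Submodule.span_union, Submodule.span_le]
      rintro _ (⟨l, rfl⟩ | ⟨l, rfl⟩)
      · simp [hf, hj]
      · simp [hf, hij.symm]
    exact this hv
  have ha := hz 2 1 (by decide) (by decide) v h2
  have hb := hz 1 2 (by decide) (by decide) v h1
  obtain ⟨g, hg⟩ := (Submodule.mem_span_range_iff_exists_fun ℂ).1 h3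
  rw [thirdFrame, ← (finSumFinEquiv (m := 3) (n := 3)).sum_comp, Fintype.sum_sum_type] at hg
  simp only [join, Function.comp_apply, Equiv.symm_apply_apply, Sum.elim_inl, Sum.elim_inr] at hg
  rw [← hg] at ha hb
  simp [linkSolution, hf, h.det_ne, h.det_ne', Finset.sum_apply] at ha hb
  rw [← hg]
  simp [ha, hb]

theorem linearIndependent_row (i : Fin 3) : LinearIndependent ℂ (x i) :=
  h.linearIndependent.comp (fun j => (i, j)) fun _ _ hj => (Prod.ext_iff.1 hj).2

theorem linearIndependent_side {i j : Fin 3} (hij : i ≠ j) :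
    LinearIndependent ℂ (join (x i) (x j)) := by
  rw [linearIndependent_join]
  have := h.linearIndependent.comp (Sum.elim (fun l => (i, l)) fun l => (j, l)) (by
    rintro (a | a) (b | b) hab <;> simp_all)
  convert this using 1
  ext (l | l) <;> rfl

theorem finrank_side {i j : Fin 3} (hij : i ≠ j) : finrank ℂ (side x i j) = 6 := by
  rw [← span_range_join, finrank_span_eq_card (h.linearIndependent_side hij)]; rfl

theorem finrank_thirdVertex : finrank ℂ (thirdVertex α x) = 6 := by
  rw [thirdVertex, finrank_span_eq_card h.linearIndependent_thirdFrame]; rfl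

variable [FiniteDimensional ℂ V]

theorem le_finrank_inf : 3 ≤ finrank ℂ (side x 0 1 ⊓ side x 0 2 : Submodule ℂ V) :=
  le_finrank_of_linearIndependent (h.linearIndependent_row 0) fun i =>
    ⟨mem_side_left x 0 1 i, mem_side_left x 0 2 i⟩

theorem le_finrank_inf₁ : 3 ≤ finrank ℂ (side x 0 1 ⊓ thirdVertex α x : Submodule ℂ V) := by
  have h1 := linearIndependent_join.1 h.linearIndependent_thirdFrame
  refine le_finrank_of_linearIndependent (h1.comp Sum.inl Sum.inl_injective) fun i =>
    ⟨linkSolution_mem_side 0 1 2 i, Submodule.subset_span ?_⟩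
  rw [thirdFrame, range_join]
  exact Or.inl ⟨i, rfl⟩

theorem le_finrank_inf₂ : 3 ≤ finrank ℂ (side x 0 2 ⊓ thirdVertex α x : Submodule ℂ V) := by
  have h1 := linearIndependent_join.1 h.linearIndependent_thirdFrame
  refine le_finrank_of_linearIndependent (h1.comp Sum.inr Sum.inr_injective) fun i =>
    ⟨linkSolution_mem_side 0 2 1 i, Submodule.subset_span ?_⟩
  rw [thirdFrame, range_join]
  exact Or.inr ⟨i, rfl⟩

omit h in
/-- If `W` meets `⟨k, a⟩` in dimension at least three and away from `⟨k⟩`, it contains vectors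
`a i + φ (a i)` for some `φ : ⟨a⟩ → ⟨k⟩`. -/
theorem exists_add_mem {k a : Fin 3 → V} {W : Submodule ℂ V} (hk : LinearIndependent ℂ k)
    (hka : LinearIndependent ℂ (join k a))
    (hdim : 3 ≤ finrank ℂ (Submodule.span ℂ (Set.range (join k a)) ⊓ W : Submodule ℂ V))
    (hdisj : Submodule.span ℂ (Set.range k) ⊓ W = ⊥) :
    ∃ φ : Fin 3 × Fin 3 → ℂ, ∀ i, a i + ∑ l, φ (i, l) • k l ∈ W := by
  set S := Submodule.span ℂ (Set.range (join k a)) with hS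
  set K := Submodule.span ℂ (Set.range k) with hK
  have hKS : K ≤ S := by rw [hS, span_join]; exact le_sup_left
  have hS6 : finrank ℂ S = 6 := finrank_span_eq_card hka
  have hK3 : finrank ℂ K = 3 := finrank_span_eq_card hk
  have h1 := Submodule.finrank_sup_add_finrank_inf_eq K (S ⊓ W)
  have h2 : K ⊓ (S ⊓ W) = ⊥ := by
    rw [eq_bot_iff, ← hdisj]; exact inf_le_inf_left _ inf_le_right
  rw [h2, finrank_bot] at h1
  have h3 : K ⊔ S ⊓ W = S :=
    Submodule.eq_of_le_of_finrank_le (sup_le hKS inf_le_left) (by omega)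
  have h4 : ∀ i, ∃ c : Fin 3 → ℂ, a i + ∑ l, c l • k l ∈ W := by
    intro i
    have : a i ∈ K ⊔ S ⊓ W := by
      rw [h3, hS, span_join]
      exact Submodule.mem_sup_right (Submodule.subset_span ⟨i, rfl⟩)
    obtain ⟨y, hy, w, hw, hyw⟩ := Submodule.mem_sup.1 this
    obtain ⟨c, hc⟩ := (Submodule.mem_span_range_iff_exists_fun ℂ).1 hy
    refine ⟨-c, ?_⟩
    have : a i + ∑ l, (-c) l • k l = w := by
      simp only [Pi.neg_apply, neg_smul, Finset.sum_neg_distrib, hc, ← hyw]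
      abel
    rw [this]; exact hw.2
  choose c hc using h4
  exact ⟨fun p => c p.1 p.2, hc⟩

omit h [FiniteDimensional ℂ V] in
/-- If `⟨k, a⟩`, `⟨k, b⟩` and `W` are isotropic and `W` contains the vectors `a + φ a`, `b + ψ b`,
then `φ` solves the linear system: the terms in `ψ` and those quadratic in `φ` are values of `α` on
one of the first two subspaces. -/
theorem linkSolution_mem {k a b : Fin 3 → V} {W W₁ W₂ : Submodule ℂ V}
    (hW : IsIsotropic α W) (h₁ : IsIsotropic α W₁) (h₂ : IsIsotropic α W₂) (hk₁ : ∀ i, k i ∈ W₁)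
    (ha : ∀ i, a i ∈ W₁) (hk₂ : ∀ i, k i ∈ W₂)
    (hb : ∀ i, b i ∈ W₂) {φ ψ : Fin 3 × Fin 3 → ℂ} (hφ : ∀ i, a i + ∑ l, φ (i, l) • k l ∈ W)
    (hψ : ∀ i, b i + ∑ l, ψ (i, l) • k l ∈ W) (i : Fin 3) : linkSolution α k a b i ∈ W := by
  have hφ' : (linkMatrix α k a b).mulVec φ = linkRhs α a b := by
    ext ⟨p, z⟩
    rw [linkMatrix_mulVec, linkRhs]
    have hk₁' : ∀ (φ : Fin 3 × Fin 3 → ℂ) q, ∑ l, φ (q, l) • k l ∈ W₁ := fun φ q =>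
      sum_mem fun l _ => W₁.smul_mem _ (hk₁ l)
    have hk₂' : ∀ (φ : Fin 3 × Fin 3 → ℂ) q, ∑ l, φ (q, l) • k l ∈ W₂ := fun φ q =>
      sum_mem fun l _ => W₂.smul_mem _ (hk₂ l)
    have e1 := hW _ (hφ (p + 1)) _ (hφ (p + 2)) _ (hψ z)
    have e2 := h₁ _ (add_mem (ha (p + 1)) (hk₁' φ (p + 1))) _
      (add_mem (ha (p + 2)) (hk₁' φ (p + 2))) _ (hk₁' ψ z)
    have e3 := h₂ _ (hk₂' φ (p + 1)) _ (hk₂' φ (p + 2)) _ (hb z)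
    rw [map_add, e2, add_zero] at e1
    simp only [map_add, LinearMap.add_apply] at e1
    rw [e3] at e1
    linear_combination e1
  rw [linkSolution_eq hφ']
  exact W.smul_mem _ (hφ i)

/-- The third vertex is unique. -/
theorem eq_thirdVertex {W : Submodule ℂ V} (hW6 : finrank ℂ W = 6) (hW : IsIsotropic α W)
    (h₁ : 3 ≤ finrank ℂ (side x 0 1 ⊓ W : Submodule ℂ V))
    (h₂ : 3 ≤ finrank ℂ (side x 0 2 ⊓ W : Submodule ℂ V))
    (h₀ : side x 0 1 ⊓ side x 0 2 ⊓ W = ⊥) : W = thirdVertex α x := by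
  have hdisj : Submodule.span ℂ (Set.range (x 0)) ⊓ W = ⊥ := by
    rw [eq_bot_iff, ← h₀]
    exact inf_le_inf_right _ (le_inf le_sup_left le_sup_left)
  obtain ⟨φ, hφ⟩ := exists_add_mem (h.linearIndependent_row 0)
    (h.linearIndependent_side (i := 0) (j := 1) (by decide))
    (by rwa [span_range_join]) hdisj
  obtain ⟨ψ, hψ⟩ := exists_add_mem (h.linearIndependent_row 0)
    (h.linearIndependent_side (i := 0) (j := 2) (by decide))
    (by rwa [span_range_join]) hdisj
  symm
  refine Submodule.eq_of_le_of_finrank_eq ?_ (h.finrank_thirdVertex.trans hW6.symm)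
  rw [thirdVertex, thirdFrame, range_join, Submodule.span_le]
  rintro _ (⟨i, rfl⟩ | ⟨i, rfl⟩)
  · exact linkSolution_mem hW h.iso₁ h.iso₂ (mem_side_left x 0 1) (mem_side_right x 0 1)
      (mem_side_left x 0 2) (mem_side_right x 0 2) hφ hψ i
  · exact linkSolution_mem hW h.iso₂ h.iso₁ (mem_side_left x 0 2) (mem_side_right x 0 2)
      (mem_side_left x 0 1) (mem_side_right x 0 1) hψ hφ i

end IsAdapted

end ThirdVertex

/-! ### Degenerations of adapted tuples -/

section Wedge

variable {V : Type*} [AddCommGroup V] [Module ℂ V]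

/-- The exterior product of three linear forms. -/
noncomputable def wedge (f g h : V →ₗ[ℂ] ℂ) : V [⋀^Fin 3]→ₗ[ℂ] ℂ :=
  (Matrix.detRowAlternating (n := Fin 3) (R := ℂ)).compLinearMap (LinearMap.pi ![f, g, h])

theorem tri_wedge (f g h : V →ₗ[ℂ] ℂ) (x y z : V) : tri (wedge f g h) x y z =
    f x * g y * h z - f x * h y * g z - g x * f y * h z + g x * h y * f z
      + h x * f y * g z - h x * g y * f z := by
  rw [tri_apply, wedge, AlternatingMap.compLinearMap_apply]
  change Matrix.det (Matrix.of fun i => (LinearMap.pi ![f, g, h]) (![x, y, z] i)) = _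
  rw [Matrix.det_fin_three]
  simp

theorem tri_sum {ι : Type*} (s : Finset ι) (β : ι → V [⋀^Fin 3]→ₗ[ℂ] ℂ) (x y z : V) :
    tri (∑ i ∈ s, β i) x y z = ∑ i ∈ s, tri (β i) x y z := by
  classical
  induction s using Finset.induction_on with
  | empty => rfl
  | insert i s hi ih => rw [Finset.sum_insert hi, Finset.sum_insert hi, tri_add, ih]

/-- The Levi-Civita symbol. -/
noncomputable def leviCivita (i j l : Fin 3) : ℂ :=
  ((j : ℕ) - (i : ℕ) : ℂ) * ((l : ℕ) - (i : ℕ) : ℂ) * ((l : ℕ) - (j : ℕ) : ℂ) / 2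

/-- The linear system is nondegenerate for the determinant form on three copies of `ℂ³`: it is
then equivalent to `φ ↦ tr φ - φᵀ`. -/
theorem linkMatrix_det_ne_zero {α : V [⋀^Fin 3]→ₗ[ℂ] ℂ} {k a b : Fin 3 → V} {c : ℂ} (hc : c ≠ 0)
    (h : ∀ i j l, tri α (k i) (a j) (b l) = c * leviCivita i j l) :
    (linkMatrix α k a b).det ≠ 0 := by
  intro h0
  obtain ⟨v, hv, hv0⟩ := Matrix.exists_mulVec_eq_zero_iff.2 h0
  apply hv
  have key : ∀ p z, ∑ l, (v (p + 1, l) * leviCivita l (p + 2) z -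
      v (p + 2, l) * leviCivita l (p + 1) z) = 0 := by
    intro p z
    have h1 := congrFun hv0 (p, z)
    rw [linkMatrix_mulVec] at h1
    simp only [map_sum, map_smul, LinearMap.sum_apply, LinearMap.smul_apply, h, smul_eq_mul,
      tri_swap α _ (a _), Pi.zero_apply] at h1
    apply mul_left_cancel₀ hc
    rw [mul_zero, ← h1, Finset.mul_sum, ← Finset.sum_add_distrib]
    exact Finset.sum_congr rfl fun l _ => by ring
  have k00 := key 0 0
  have k01 := key 0 1
  have k02 := key 0 2
  have k10 := key 1 0
  have k11 := key 1 1
  have k12 := key 1 2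
  have k20 := key 2 0
  have k21 := key 2 1
  have k22 := key 2 2
  simp only [Fin.sum_univ_three, leviCivita, Fin.isValue, show (0 : Fin 3) + 1 = 1 from rfl,
    show (0 : Fin 3) + 2 = 2 from rfl, show (1 : Fin 3) + 1 = 2 from rfl,
    show (1 : Fin 3) + 2 = 0 from rfl, show (2 : Fin 3) + 1 = 0 from rfl,
    show (2 : Fin 3) + 2 = 1 from rfl, Fin.val_zero, Fin.val_one, Fin.val_two, Nat.cast_zero,
    Nat.cast_one, Nat.cast_ofNat] at k00 k01 k02 k10 k11 k12 k20 k21 k22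
  norm_num at k00 k01 k02 k10 k11 k12 k20 k21 k22
  ext ⟨i, l⟩
  fin_cases i <;> fin_cases l <;> simp only [Fin.isValue, Fin.zero_eta, Fin.mk_one, Fin.reduceFinMk,
    Pi.zero_apply] <;> grind

/-- The determinant form attached to three triples of coordinates. -/
noncomputable def detForm (f : V →ₗ[ℂ] (Fin 3 × Fin 3 → ℂ)) : V [⋀^Fin 3]→ₗ[ℂ] ℂ :=
  ∑ i, ∑ j, ∑ l, leviCivita i j l • wedge ((LinearMap.proj (0, i)).comp f)
    ((LinearMap.proj (1, j)).comp f) ((LinearMap.proj (2, l)).comp f)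

theorem tri_detForm (f : V →ₗ[ℂ] (Fin 3 × Fin 3 → ℂ)) (x y z : V) : tri (detForm f) x y z =
    ∑ i, ∑ j, ∑ l, leviCivita i j l * tri (wedge ((LinearMap.proj (0, i)).comp f)
    ((LinearMap.proj (1, j)).comp f) ((LinearMap.proj (2, l)).comp f)) x y z := by
  simp only [detForm, tri_sum, tri_smul]

variable {x : Fin 3 → Fin 3 → V} {f : V →ₗ[ℂ] (Fin 3 × Fin 3 → ℂ)}

theorem tri_detForm_frame (hf : ∀ i j c, f (x i j) c = if c = (i, j) then 1 else 0)
    (i j l : Fin 3) : tri (detForm f) (x 0 i) (x 1 j) (x 2 l) = leviCivita i j l := by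
  simp [tri_detForm, tri_wedge, hf]

/-- The determinant form vanishes on the span of two of the three triples. -/
theorem isIsotropic_detForm (hf : ∀ i j c, f (x i j) c = if c = (i, j) then 1 else 0)
    {i j : Fin 3} : IsIsotropic (detForm f) (side x i j) := by
  rw [← span_range_join, isIsotropic_span_iff]
  have key : ∀ r : Fin 3, r ≠ i → r ≠ j → ∀ c n, f (join (x i) (x j) n) (r, c) = 0 := by
    intro r hi hj c n
    obtain ⟨n, rfl⟩ := (finSumFinEquiv (m := 3) (n := 3)).surjective n
    rcases n with n | n <;> simp [join, hf, hi, hj]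
  have hr : ∃ r : Fin 3, r ≠ i ∧ r ≠ j := by clear key; revert i j; decide
  obtain ⟨r, hi, hj⟩ := hr
  have := key r hi hj
  intro n m s
  simp only [tri_detForm, tri_wedge, LinearMap.comp_apply, LinearMap.proj_apply]
  fin_cases r <;> simp_all

theorem isAdapted_detForm (hf : ∀ i j c, f (x i j) c = if c = (i, j) then 1 else 0) :
    IsAdapted (detForm f) x := by
  refine ⟨isIsotropic_detForm hf, isIsotropic_detForm hf, mul_ne_zero ?_ ?_⟩
  · exact linkMatrix_det_ne_zero one_ne_zero fun i j l => by rw [tri_detForm_frame hf, one_mul]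
  · refine linkMatrix_det_ne_zero one_ne_zero fun i j l => ?_
    rw [tri_swap', tri_detForm_frame hf]
    simp only [leviCivita]; ring

end Wedge

section Degeneration

variable {V : Type*} [AddCommGroup V] [Module ℂ V]

variable (V) in
/-- The family of adapted tuples over the space of 3-forms. -/
def adaptedPairs : Set ((Fin 3 → Fin 3 → V) × (V [⋀^Fin 3]→ₗ[ℂ] ℂ)) := {q | IsAdapted q.2 q.1}

variable (V) in
/-- The family of adapted tuples `(k, a, b)` for which `α` vanishes on `⟨a, b⟩` as well. -/
def adaptedTriangles : Set ((Fin 3 → Fin 3 → V) × (V [⋀^Fin 3]→ₗ[ℂ] ℂ)) :=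
  {q | IsAdapted q.2 q.1 ∧ IsIsotropic q.2 (side q.1 1 2)}

theorem exists_coord {x : Fin 3 → Fin 3 → V} (hx : LinearIndependent ℂ (flat x)) :
    ∃ f : V →ₗ[ℂ] (Fin 3 × Fin 3 → ℂ), ∀ i j c, f (x i j) c = if c = (i, j) then 1 else 0 := by
  obtain ⟨f, hf⟩ := exists_dual_family hx
  exact ⟨f, fun i j c => by rw [show x i j = flat x (i, j) from rfl, hf, Pi.single_apply]⟩

theorem IsIsotropic.add_smul {α β : V [⋀^Fin 3]→ₗ[ℂ] ℂ} {W : Submodule ℂ V} (hα : IsIsotropic α W)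
    (hβ : IsIsotropic β W) (c : ℂ) : IsIsotropic (α + c • β) W := fun x hx y hy z hz => by
  rw [tri_add, tri_smul, hα x hx y hy z hz, hβ x hx y hy z hz, mul_zero, add_zero]

theorem IsIsotropic.sub {α β : V [⋀^Fin 3]→ₗ[ℂ] ℂ} {W : Submodule ℂ V} (hα : IsIsotropic α W)
    (hβ : IsIsotropic β W) : IsIsotropic (β - α) W := by
  have := hβ.add_smul hα (-1)
  rwa [neg_one_smul, ← sub_eq_add_neg] at this

variable [FiniteDimensional ℂ V]

theorem finite_not_adapted {x : Fin 3 → Fin 3 → V} {f : V →ₗ[ℂ] (Fin 3 × Fin 3 → ℂ)}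
    (hf : ∀ i j c, f (x i j) c = if c = (i, j) then 1 else 0) (α : V [⋀^Fin 3]→ₗ[ℂ] ℂ) :
    {t : ℂ | disc (detForm f + t • (α - detForm f)) x = 0}.Finite :=
  polyFun_finite_zeros (disc_mem_polyFun (isPolyMap_line _ _) (isPolyMap_const _)) (t₀ := 0) (by
    simpa using (isAdapted_detForm hf).disc_ne)

/-- Pairs of isotropic subspaces meeting in dimension exactly three are limits of adapted ones:
deform `α` towards the determinant form. -/
theorem inPolyClosure_of_linearIndependent {x : Fin 3 → Fin 3 → V} {α : V [⋀^Fin 3]→ₗ[ℂ] ℂ}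
    (hx : LinearIndependent ℂ (flat x)) (h₁ : IsIsotropic α (side x 0 1))
    (h₂ : IsIsotropic α (side x 0 2)) : InPolyClosure (adaptedPairs V) (x, α) := by
  obtain ⟨f, hf⟩ := exists_coord hx
  have := InPolyClosure.of_curve (S := adaptedPairs V)
    (γ := fun t : ℂ => (x, detForm f + t • (α - detForm f)))
    ((isPolyMap_const _).prodMk (isPolyMap_line _ _)) ((finite_not_adapted hf α).subset ?_) 1
  · simpa using this
  · intro t ht
    by_contra hne
    refine ht (InPolyClosure.subset ⟨?_, ?_, hne⟩)
    · exact (isIsotropic_detForm hf).add_smul ((isIsotropic_detForm hf).sub h₁) t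
    · exact (isIsotropic_detForm hf).add_smul ((isIsotropic_detForm hf).sub h₂) t

/-- Triangles are limits of adapted ones. -/
theorem inPolyClosure_triangles {x : Fin 3 → Fin 3 → V} {α : V [⋀^Fin 3]→ₗ[ℂ] ℂ}
    (hx : LinearIndependent ℂ (flat x)) (h₁ : IsIsotropic α (side x 0 1))
    (h₂ : IsIsotropic α (side x 0 2)) (h₃ : IsIsotropic α (side x 1 2)) :
    InPolyClosure (adaptedTriangles V) (x, α) := by
  obtain ⟨f, hf⟩ := exists_coord hx
  have := InPolyClosure.of_curve (S := adaptedTriangles V)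
    (γ := fun t : ℂ => (x, detForm f + t • (α - detForm f)))
    ((isPolyMap_const _).prodMk (isPolyMap_line _ _)) ((finite_not_adapted hf α).subset ?_) 1
  · simpa using this
  · intro t ht
    by_contra hne
    refine ht (InPolyClosure.subset ⟨⟨?_, ?_, hne⟩, ?_⟩)
    · exact (isIsotropic_detForm hf).add_smul ((isIsotropic_detForm hf).sub h₁) t
    · exact (isIsotropic_detForm hf).add_smul ((isIsotropic_detForm hf).sub h₂) t
    · exact (isIsotropic_detForm hf).add_smul ((isIsotropic_detForm hf).sub h₃) t

omit [FiniteDimensional ℂ V] in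
theorem isIsotropic_sup_singleton {α : V [⋀^Fin 3]→ₗ[ℂ] ℂ} {A : Submodule ℂ V} {v : V}
    (hA : IsIsotropic α A) (h : ∀ y ∈ A, ∀ z ∈ A, tri α v y z = 0) :
    IsIsotropic α (A ⊔ Submodule.span ℂ {v}) := by
  refine isIsotropic_sup hA ?_ ?_ ?_
  · intro x hx y hy z _
    obtain ⟨c, rfl⟩ := Submodule.mem_span_singleton.1 hx
    obtain ⟨d, rfl⟩ := Submodule.mem_span_singleton.1 hy
    simp
  · intro x hx y hy z hz
    obtain ⟨c, rfl⟩ := Submodule.mem_span_singleton.1 hz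
    rw [map_smul, tri_rotate, h x hx y hy, smul_zero]
  · intro x hx y hy z _
    obtain ⟨c, rfl⟩ := Submodule.mem_span_singleton.1 hx
    obtain ⟨d, rfl⟩ := Submodule.mem_span_singleton.1 hy
    simp

omit [FiniteDimensional ℂ V] in
/-- Replacing the second triple `a` by `c • a + d • b` with all `c` nonzero keeps the nine vectors
independent. -/
theorem linearIndependent_flat_shear {x : Fin 3 → Fin 3 → V} (hx : LinearIndependent ℂ (flat x))
    {c d : Fin 3 → ℂ} (hc : ∀ i, c i ≠ 0) :
    LinearIndependent ℂ (flat ![x 0, fun i => c i • x 1 i + d i • x 2 i, x 2]) := by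
  obtain ⟨f, hf⟩ := exists_coord hx
  rw [Fintype.linearIndependent_iff]
  intro g hg
  rw [Fintype.sum_prod_type, Fin.sum_univ_three] at hg
  simp only [flat, Matrix.cons_val_zero, Matrix.cons_val_one, Matrix.cons_val_two,
    Matrix.tail_cons, Matrix.head_cons] at hg
  have h0 := fun i => congrFun (congrArg f hg) (0, i)
  have h1 := fun i => congrFun (congrArg f hg) (1, i)
  have h2 := fun i => congrFun (congrArg f hg) (2, i)
  simp [hf, Finset.sum_apply, hc] at h0 h1 h2
  simp [h1] at h2
  rintro ⟨i, l⟩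
  fin_cases i
  exacts [h0 l, h1 l, h2 l]

end Degeneration

section Shear

variable {V : Type*} [AddCommGroup V] [Module ℂ V]

/-- The tuple `(k, c • a + d • b, b)`. -/
def shear (x : Fin 3 → Fin 3 → V) (c d : Fin 3 → ℂ) : Fin 3 → Fin 3 → V :=
  ![x 0, fun i => c i • x 1 i + d i • x 2 i, x 2]

variable [FiniteDimensional ℂ V] {x : Fin 3 → Fin 3 → V} {α : V [⋀^Fin 3]→ₗ[ℂ] ℂ}

/-- If a degenerate pair is moved along a curve of isotropic pairs meeting generically in
dimension three, it is a limit of adapted pairs. -/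
theorem inPolyClosure_shear (hx : LinearIndependent ℂ (flat x)) {c : ℂ → Fin 3 → ℂ}
    {d : Fin 3 → ℂ} {A : ℂ → V [⋀^Fin 3]→ₗ[ℂ] ℂ} (hc : ∀ i, (fun t => c t i) ∈ polyFun ℂ)
    (hc0 : ∀ i, ∃ t, c t i ≠ 0) (hA : IsPolyMap A)
    (h₁ : ∀ t, IsIsotropic (A t) (side (shear x (c t) d) 0 1))
    (h₂ : ∀ t, IsIsotropic (A t) (side x 0 2)) :
    InPolyClosure (adaptedPairs V) (shear x (c 0) d, A 0) := by
  refine InPolyClosure.of_curve (γ := fun t : ℂ => (shear x (c t) d, A t)) ?_ ?_ 0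
  · refine IsPolyMap.prodMk (isPolyMap_pi fun i => ?_) hA
    fin_cases i
    · exact isPolyMap_const (x 0)
    · exact isPolyMap_pi fun i => ((isPolyMap_const (x 1 i)).smul (hc i)).add
        (isPolyMap_const (d i • x 2 i))
    · exact isPolyMap_const (x 2)
  · refine (Set.finite_iUnion fun i => polyFun_finite_zeros (hc i) (hc0 i).choose_spec).subset ?_
    intro t ht
    rw [Set.mem_iUnion]
    by_contra! hne
    exact ht (inPolyClosure_of_linearIndependent (linearIndependent_flat_shear hx hne) (h₁ t)
        (h₂ t))

/-- A pair of isotropic subspaces `⟨k, m, a₁, a₂⟩` and `⟨k, m, b₁, b₂⟩` meeting in dimension four is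
a limit of adapted pairs, provided `α(q, ·, ·)` vanishes on `⟨k⟩` for some `q` outside their sum.
The tuple `x` is `(k, (q, a₁, a₂), (m, b₁, b₂))`, and `m` is moved to `m + t q` in the first
subspace. -/
theorem inPolyClosure_of_inf_four (hx : LinearIndependent ℂ (flat x))
    (h₁ : IsIsotropic α (side (shear x ![0, 1, 1] ![1, 0, 0]) 0 1))
    (h₂ : IsIsotropic α (side x 0 2)) (hq : ∀ i j, tri α (x 1 0) (x 0 i) (x 0 j) = 0) :
    InPolyClosure (adaptedPairs V) (shear x ![0, 1, 1] ![1, 0, 0], α) := by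
  obtain ⟨f, hf⟩ := exists_coord hx
  -- the projection to `Y = ⟨k, a₁, a₂⟩` along the other vectors, and the coordinate along `m`
  let F : Fin 3 × Fin 3 → V →ₗ[ℂ] ℂ := fun c => (LinearMap.proj c).comp f
  let P : V →ₗ[ℂ] V := ∑ i, (F (0, i)).smulRight (x 0 i) + (F (1, 1)).smulRight (x 1 1) +
    (F (1, 2)).smulRight (x 1 2)
  let l : V →ₗ[ℂ] ℂ := F (2, 0)
  have hFx : ∀ c i j, F c (x i j) = if c = (i, j) then 1 else 0 := fun c i j => hf i j c
  have hP : ∀ i j, P (x i j) = (∑ n, F (0, n) (x i j) • x 0 n) + F (1, 1) (x i j) • x 1 1 +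
      F (1, 2) (x i j) • x 1 2 := fun i j => by simp [P]
  set K := Submodule.span ℂ (Set.range (x 0)) with hK
  set Y := K ⊔ Submodule.span ℂ {x 1 1, x 1 2} with hY
  have hYW : Y ≤ side (shear x ![0, 1, 1] ![1, 0, 0]) 0 1 := by
    refine sup_le le_sup_left ?_
    rw [Submodule.span_le]
    rintro _ (rfl | rfl)
    · convert mem_side_right (shear x ![0, 1, 1] ![1, 0, 0]) 0 1 1 using 1
      simp [shear]
    · convert mem_side_right (shear x ![0, 1, 1] ![1, 0, 0]) 0 1 2 using 1
      simp [shear]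
  have hm : x 2 0 ∈ side (shear x ![0, 1, 1] ![1, 0, 0]) 0 1 := by
    convert mem_side_right (shear x ![0, 1, 1] ![1, 0, 0]) 0 1 0 using 1
    simp [shear]
  have hPY : ∀ y ∈ Y, P y = y := by
    have : Y ≤ LinearMap.eqLocus P LinearMap.id := by
      rw [hY, hK, ← Submodule.span_union, Submodule.span_le]
      rintro _ (⟨i, rfl⟩ | (rfl | rfl)) <;> simp [hP, hFx]
    exact fun y hy => this hy
  have hlY : ∀ y ∈ Y, l y = 0 := by
    have : Y ≤ LinearMap.ker l := by
      rw [hY, hK, ← Submodule.span_union, Submodule.span_le]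
      rintro _ (⟨i, rfl⟩ | (rfl | rfl)) <;> simp [l, hFx]
    exact fun y hy => this hy
  -- `Z = ⟨k, b₁, b₂⟩`
  set Z := K ⊔ Submodule.span ℂ {x 2 1, x 2 2} with hZ
  have hZW : Z ≤ side x 0 2 := by
    refine sup_le le_sup_left ?_
    rw [Submodule.span_le]
    rintro _ (rfl | rfl) <;> exact mem_side_right _ _ _ _
  have hPZ : ∀ z ∈ Z, P z ∈ K := by
    have : Z ≤ K.comap P := by
      rw [hZ, hK, ← Submodule.span_union, Submodule.span_le]
      rintro _ (⟨i, rfl⟩ | (rfl | rfl))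
      · simpa [hP, hFx] using Submodule.subset_span (Set.mem_range_self i)
      · simp [hP, hFx]
      · simp [hP, hFx]
    exact fun y hy => this hy
  have hlZ : ∀ z ∈ Z, l z = 0 := by
    have : Z ≤ LinearMap.ker l := by
      rw [hZ, hK, ← Submodule.span_union, Submodule.span_le]
      rintro _ (⟨i, rfl⟩ | (rfl | rfl)) <;> simp [l, hFx]
    exact fun y hy => this hy
  have hqK : ∀ y ∈ K, ∀ z ∈ K, tri α (x 1 0) y z = 0 := by
    intro y hy z hz
    obtain ⟨c, rfl⟩ := (Submodule.mem_span_range_iff_exists_fun ℂ).1 hy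
    obtain ⟨d, rfl⟩ := (Submodule.mem_span_range_iff_exists_fun ℂ).1 hz
    simp [hq]
  -- the correction `-m* ∧ P^*(α(q, ·, ·))` compensates the first-order effect of the motion
  let β := α.compLinearMap P - α.compLinearMap (P + l.smulRight (x 1 0))
  have hβ : ∀ u v w, tri β u v w = tri α (P u) (P v) (P w) -
      tri α (P u + l u • x 1 0) (P v + l v • x 1 0) (P w + l w • x 1 0) := fun u v w => by
    rw [show β = α.compLinearMap P + (-1 : ℂ) • α.compLinearMap (P + l.smulRight (x 1 0)) by
      simp [β, sub_eq_add_neg], tri_add, tri_smul, tri_compLinearMap, tri_compLinearMap]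
    simp [sub_eq_add_neg]
  have hPm : P (x 2 0) = 0 := by simp [hP, hFx]
  have hPq : P (x 1 0) = 0 := by simp [hP, hFx]
  have hlm : l (x 2 0) = 1 := by simp [l, hFx]
  have hlq : l (x 1 0) = 0 := by simp [l, hFx]
  have key := inPolyClosure_shear (c := fun t => ![t, 1, 1]) (d := ![1, 0, 0])
    (A := fun t => α + t • β) hx ?_ ?_ (isPolyMap_line _ _) ?_ ?_
  · simpa using key
  · intro i
    fin_cases i
    exacts [linear_mem_polyFun LinearMap.id, const_mem_polyFun 1, const_mem_polyFun 1]
  · exact fun i => ⟨1, by fin_cases i <;> simp⟩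
  · intro t
    have hle : side (shear x ![t, 1, 1] ![1, 0, 0]) 0 1 ≤
        Y ⊔ Submodule.span ℂ {t • x 1 0 + x 2 0} := by
      refine sup_le (le_sup_left.trans le_sup_left) ?_
      rw [Submodule.span_le]
      rintro _ ⟨i, rfl⟩
      fin_cases i
      · refine Submodule.mem_sup_right (Submodule.mem_span_singleton.2 ⟨1, by simp [shear]⟩)
      · refine Submodule.mem_sup_left (Submodule.mem_sup_right (Submodule.subset_span ?_))
        simp [shear]
      · refine Submodule.mem_sup_left (Submodule.mem_sup_right (Submodule.subset_span ?_))
        simp [shear]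
    refine (isIsotropic_sup_singleton ?_ ?_).mono hle
    · refine (h₁.mono hYW).add_smul (fun u hu v hv w hw => ?_) t
      rw [hβ, hlY u hu, hlY v hv, hlY w hw]
      simp
    · intro y hy z hz
      rw [tri_add, tri_smul, hβ, hlY y hy, hlY z hz, hPY y hy, hPY z hz]
      have := h₁ _ hm y (hYW hy) z (hYW hz)
      simp [hPm, hPq, hlm, hlq, this]
  · intro t
    have hle : side x 0 2 ≤ Z ⊔ Submodule.span ℂ {x 2 0} := by
      refine sup_le (le_sup_left.trans le_sup_left) ?_
      rw [Submodule.span_le]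
      rintro _ ⟨i, rfl⟩
      fin_cases i
      · exact Submodule.mem_sup_right (Submodule.mem_span_singleton_self _)
      · exact Submodule.mem_sup_left (Submodule.mem_sup_right (Submodule.subset_span (by simp)))
      · exact Submodule.mem_sup_left (Submodule.mem_sup_right (Submodule.subset_span (by simp)))
    refine (isIsotropic_sup_singleton ?_ ?_).mono hle
    · refine (h₂.mono hZW).add_smul (fun u hu v hv w hw => ?_) t
      rw [hβ, hlZ u hu, hlZ v hv, hlZ w hw]
      simp
    · intro y hy z hz
      rw [tri_add, tri_smul, hβ, hlZ y hy, hlZ z hz, h₂ _ (mem_side_right x 0 2 0) y (hZW hy) z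
          (hZW hz)]
      simp [hPm, hlm, hqK _ (hPZ y hy) _ (hPZ z hz)]

set_option maxHeartbeats 800000 in
/-- A pair of isotropic subspaces `⟨k, m₁, m₂, a⟩` and `⟨k, m₁, m₂, b⟩` meeting in dimension five is
a limit of adapted pairs, provided there are `q₁`, `q₂`, independent modulo their sum, such that
`α(qᵢ, ·, ·)` vanishes on `⟨k⟩` and `α(q₁, m₂, ·) + e α(m₁, q₂, ·)` vanishes on `⟨k⟩` for some
constant `e`. The tuple `x` is `(k, (q₁, q₂, a), (m₁, m₂, b))`, and `m₁`, `m₂` are moved to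
`m₁ + t q₁`, `m₂ + s q₂`, with `s = e t + t²`, in the first subspace; the square keeps `s` from
vanishing identically when `e = 0`. -/
theorem inPolyClosure_of_inf_five (hx : LinearIndependent ℂ (flat x))
    (h₁ : IsIsotropic α (side (shear x ![0, 0, 1] ![1, 1, 0]) 0 1))
    (h₂ : IsIsotropic α (side x 0 2)) (hq₁ : ∀ i j, tri α (x 1 0) (x 0 i) (x 0 j) = 0)
    (hq₂ : ∀ i j, tri α (x 1 1) (x 0 i) (x 0 j) = 0) {e : ℂ}
    (he : ∀ i, tri α (x 1 0) (x 2 1) (x 0 i) + e * tri α (x 2 0) (x 1 1) (x 0 i) = 0) :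
    InPolyClosure (adaptedPairs V) (shear x ![0, 0, 1] ![1, 1, 0], α) := by
  obtain ⟨f, hf⟩ := exists_coord hx
  let F : Fin 3 × Fin 3 → V →ₗ[ℂ] ℂ := fun c => (LinearMap.proj c).comp f
  have hFx : ∀ c i j, F c (x i j) = if c = (i, j) then 1 else 0 := fun c i j => hf i j c
  let P : V →ₗ[ℂ] V := ∑ i, (F (0, i)).smulRight (x 0 i)
  have hP : ∀ i j, P (x i j) = ∑ n, F (0, n) (x i j) • x 0 n := fun i j => by simp [P]
  have hP0 : ∀ i, P (x 0 i) = x 0 i := fun i => by simp [hP, hFx]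
  have hP1 : ∀ i, P (x 1 i) = 0 := fun i => by simp [hP, hFx]
  have hP2 : ∀ i, P (x 2 i) = 0 := fun i => by simp [hP, hFx]
  -- the linear forms `α(q₁, ·, a)`, `α(q₂, ·, a)`, `α(m₁, q₂, ·)`, `α(q₁, q₂, ·)` on `⟨k⟩`
  let κ₁ : V →ₗ[ℂ] ℂ := ((tri α (x 1 0)).flip (x 1 2)).comp P
  let κ₂ : V →ₗ[ℂ] ℂ := ((tri α (x 1 1)).flip (x 1 2)).comp P
  let κ₃ : V →ₗ[ℂ] ℂ := (tri α (x 2 0) (x 1 1)).comp P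
  let κ₄ : V →ₗ[ℂ] ℂ := (tri α (x 1 0) (x 1 1)).comp P
  have hκ₁ : ∀ v, κ₁ v = tri α (x 1 0) (P v) (x 1 2) := fun v => rfl
  have hκ₂ : ∀ v, κ₂ v = tri α (x 1 1) (P v) (x 1 2) := fun v => rfl
  have hκ₃ : ∀ v, κ₃ v = tri α (x 2 0) (x 1 1) (P v) := fun v => rfl
  have hκ₄ : ∀ v, κ₄ v = tri α (x 1 0) (x 1 1) (P v) := fun v => rfl
  let s : ℂ → ℂ := fun t => e * t + t ^ 2
  let D : ℂ → V := fun t => t • x 1 0 + x 2 0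
  let E : ℂ → V := fun t => s t • x 1 1 + x 2 1
  let γ : ℂ → ℂ := fun t => tri α (D t) (E t) (x 1 2)
  let A : ℂ → V [⋀^Fin 3]→ₗ[ℂ] ℂ := fun t => α + (-t) • wedge (F (2, 0)) κ₁ (F (1, 2)) +
    (-s t) • wedge (F (2, 1)) κ₂ (F (1, 2)) + (-t) • wedge (F (1, 0)) (F (2, 1)) κ₃ +
    (-s t) • wedge (F (1, 0)) (F (2, 1)) κ₄ + (-γ t) • wedge (F (2, 0)) (F (2, 1)) (F (1, 2))
  have hA : ∀ t u v w, tri (A t) u v w = tri α u v w +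
      (-t) * tri (wedge (F (2, 0)) κ₁ (F (1, 2))) u v w
      + (-s t) * tri (wedge (F (2, 1)) κ₂ (F (1, 2))) u v w
      + (-t) * tri (wedge (F (1, 0)) (F (2, 1)) κ₃) u v w
      + (-s t) * tri (wedge (F (1, 0)) (F (2, 1)) κ₄) u v w
      + (-γ t) * tri (wedge (F (2, 0)) (F (2, 1)) (F (1, 2))) u v w := fun t u v w => by
    simp only [A, tri_add, tri_smul]
  have hid : (fun t : ℂ => t) ∈ polyFun ℂ := linear_mem_polyFun LinearMap.id
  have hs : s ∈ polyFun ℂ := polyFun_add (polyFun_mul (const_mem_polyFun e) hid) (polyFun_pow hid 2)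
  have hD : IsPolyMap D := ((isPolyMap_const _).smul hid).add (isPolyMap_const _)
  have hE : IsPolyMap E := ((isPolyMap_const _).smul hs).add (isPolyMap_const _)
  have hγ : γ ∈ polyFun ℂ := tri_mem_polyFun (isPolyMap_const α) hD hE (isPolyMap_const _)
  have hs0 : s 0 = 0 := by simp [s]
  have hm : ∀ i ∈ ({0, 1} : Set (Fin 3)), x 2 i ∈ side (shear x ![0, 0, 1] ![1, 1, 0]) 0 1 := by
    rintro i (rfl | rfl)
    · convert mem_side_right (shear x ![0, 0, 1] ![1, 1, 0]) 0 1 0 using 1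
      simp [shear]
    · convert mem_side_right (shear x ![0, 0, 1] ![1, 1, 0]) 0 1 1 using 1
      simp [shear]
  have ha : x 1 2 ∈ side (shear x ![0, 0, 1] ![1, 1, 0]) 0 1 := by
    convert mem_side_right (shear x ![0, 0, 1] ![1, 1, 0]) 0 1 2 using 1
    simp [shear]
  have hγ0 : γ 0 = 0 := by
    simpa [γ, D, E, hs0] using h₁ _ (hm 0 (by simp)) _ (hm 1 (by simp)) _ ha
  have hA0 : A 0 = α := by simp [A, hs0, hγ0]
  have hApoly : IsPolyMap A := (((((isPolyMap_const α).add
      ((isPolyMap_const _).smul (polyFun_neg hid))).add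
    ((isPolyMap_const _).smul (polyFun_neg hs))).add
    ((isPolyMap_const _).smul (polyFun_neg hid))).add
    ((isPolyMap_const _).smul (polyFun_neg hs))).add
    ((isPolyMap_const _).smul (polyFun_neg hγ))
  have hγt : ∀ t, γ t = tri α (D t) (E t) (x 1 2) := fun t => rfl
  clear_value A γ κ₁ κ₂ κ₃ κ₄
  set K := Submodule.span ℂ (Set.range (x 0)) with hK
  set Y := K ⊔ Submodule.span ℂ {x 1 2} with hY
  have hYW : Y ≤ side (shear x ![0, 0, 1] ![1, 1, 0]) 0 1 :=
    sup_le le_sup_left ((Submodule.span_singleton_le_iff_mem _ _).2 ha)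
  have hFY : ∀ c : Fin 3 × Fin 3, c.1 ≠ 0 → c ≠ (1, 2) → ∀ y ∈ Y, F c y = 0 := by
    intro c hc hc'
    have : Y ≤ LinearMap.ker (F c) := by
      rw [hY, hK, ← Submodule.span_union, Submodule.span_le]
      rintro _ (⟨i, rfl⟩ | rfl)
      · simpa [hFx] using fun h => hc (by rw [h])
      · simpa [hFx] using hc'
    exact fun y hy => this hy
  have hFY0 := hFY (1, 0) (by decide) (by decide)
  have hFY1 := hFY (2, 0) (by decide) (by decide)
  have hFY2 := hFY (2, 1) (by decide) (by decide)
  have hYdec : ∀ y ∈ Y, ∃ c : Fin 3 → ℂ, y = P y + F (1, 2) y • x 1 2 ∧ P y = ∑ i, c i • x 0 i := by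
    intro y hy
    refine ⟨fun i => F (0, i) y, ?_, by simp [P]⟩
    have : Y ≤ LinearMap.eqLocus LinearMap.id (P + (F (1, 2)).smulRight (x 1 2)) := by
      rw [hY, hK, ← Submodule.span_union, Submodule.span_le]
      rintro _ (⟨i, rfl⟩ | rfl) <;> simp [hP0, hP1, hFx]
    exact this hy
  clear_value P F
  -- `α(qᵢ, ·, ·)` on `⟨k, a⟩` is the exterior product of `κᵢ` and the coordinate along `a`
  have hqY : ∀ q : V, (∀ i j, tri α q (x 0 i) (x 0 j) = 0) → ∀ y ∈ Y, ∀ z ∈ Y,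
      tri α q y z = tri α q (P y) (x 1 2) * F (1, 2) z - F (1, 2) y * tri α q (P z) (x 1 2) := by
    intro q hq y hy z hz
    obtain ⟨c, hc, hc'⟩ := hYdec y hy
    obtain ⟨d, hd, hd'⟩ := hYdec z hz
    have h0 : tri α q (P y) (P z) = 0 := by rw [hc', hd']; simp [hq]
    conv_lhs => rw [hc, hd]
    simp only [map_add, map_smul, LinearMap.add_apply, LinearMap.smul_apply, smul_eq_mul, h0,
      tri_self_right]
    rw [tri_swap' α q (P z) (x 1 2)]
    ring
  have hheK : ∀ y ∈ Y, tri α (x 1 0) (x 2 1) (P y) + e * tri α (x 2 0) (x 1 1) (P y) = 0 := by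
    intro y hy
    obtain ⟨c, -, hc'⟩ := hYdec y hy
    rw [hc']
    simp only [map_sum, map_smul, smul_eq_mul, Finset.mul_sum, ← Finset.sum_add_distrib]
    refine Finset.sum_eq_zero fun i _ => ?_
    linear_combination c i * he i
  have key := inPolyClosure_shear (c := fun t => ![t, s t, 1]) (d := ![1, 1, 0]) (A := A) hx
    ?_ ?_ ?_ ?_ ?_
  · simpa [hs0, hA0] using key
  · intro i
    fin_cases i
    exacts [hid, hs, const_mem_polyFun 1]
  · intro i
    fin_cases i
    · exact ⟨1, one_ne_zero⟩
    · change ∃ t, s t ≠ 0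
      by_contra! h0
      have h1 := h0 1
      have h2 := h0 2
      simp only [s] at h1 h2
      exact two_ne_zero (α := ℂ) (by linear_combination h2 - 2 * h1)
    · exact ⟨1, one_ne_zero⟩
  · exact hApoly
  · intro t
    have hle : side (shear x ![t, s t, 1] ![1, 1, 0]) 0 1 ≤
        Y ⊔ Submodule.span ℂ {D t} ⊔ Submodule.span ℂ {E t} := by
      refine sup_le (le_sup_left.trans (le_sup_left.trans le_sup_left)) ?_
      rw [Submodule.span_le]
      rintro _ ⟨i, rfl⟩
      fin_cases i
      · refine Submodule.mem_sup_left (Submodule.mem_sup_right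
          (Submodule.mem_span_singleton.2 ⟨1, by simp [shear, D]⟩))
      · refine Submodule.mem_sup_right (Submodule.mem_span_singleton.2 ⟨1, by simp [shear, E]⟩)
      · refine Submodule.mem_sup_left (Submodule.mem_sup_left (Submodule.mem_sup_right
          (Submodule.mem_span_singleton.2 ⟨1, by simp [shear]⟩)))
    have hD₁ : F (2, 0) (D t) = 1 := by simp [D, hFx]
    have hD₂ : F (2, 1) (D t) = 0 := by simp [D, hFx]
    have hD₃ : F (1, 0) (D t) = t := by simp [D, hFx]
    have hD₄ : F (1, 2) (D t) = 0 := by simp [D, hFx]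
    have hE₁ : F (2, 0) (E t) = 0 := by simp [E, hFx]
    have hE₂ : F (2, 1) (E t) = 1 := by simp [E, hFx]
    have hE₃ : F (1, 0) (E t) = 0 := by simp [E, hFx]
    have hE₄ : F (1, 2) (E t) = 0 := by simp [E, hFx]
    have hPD : P (D t) = 0 := by simp [D, hP1, hP2]
    have hPE : P (E t) = 0 := by simp [E, hP1, hP2]
    generalize F (2, 0) = m₁, F (2, 1) = m₂, F (1, 0) = q', F (1, 2) = a' at *
    have hDY : ∀ y ∈ Y, ∀ z ∈ Y, tri (A t) (D t) y z = 0 := by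
      intro y hy z hz
      have e1 := hqY (x 1 0) hq₁ y hy z hz
      have e2 := h₁ _ (hm 0 (by simp)) _ (hYW hy) _ (hYW hz)
      rw [hA]
      simp only [tri_wedge, hFY0 _ hy, hFY0 _ hz, hFY1 _ hy, hFY1 _ hz, hFY2 _ hy, hFY2 _ hz, hκ₁,
        hκ₂, hκ₃, hκ₄, hPD, hD₁, hD₂, hD₃, hD₄, map_zero, LinearMap.zero_apply]
      simp only [D, map_add, map_smul, LinearMap.add_apply, LinearMap.smul_apply, smul_eq_mul, e1,
          e2]
      ring
    have hEY : ∀ y ∈ Y, ∀ z ∈ Y, tri (A t) (E t) y z = 0 := by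
      intro y hy z hz
      have e1 := hqY (x 1 1) hq₂ y hy z hz
      have e2 := h₁ _ (hm 1 (by simp)) _ (hYW hy) _ (hYW hz)
      rw [hA]
      simp only [tri_wedge, hFY0 _ hy, hFY0 _ hz, hFY1 _ hy, hFY1 _ hz, hFY2 _ hy, hFY2 _ hz, hκ₁,
        hκ₂, hκ₃, hκ₄, hPE, hE₁, hE₂, hE₃, hE₄, map_zero, LinearMap.zero_apply]
      simp only [E, map_add, map_smul, LinearMap.add_apply, LinearMap.smul_apply, smul_eq_mul, e1,
          e2]
      ring
    have hDEY : ∀ y ∈ Y, tri (A t) (E t) (D t) y = 0 := by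
      intro y hy
      obtain ⟨c, hc, -⟩ := hYdec y hy
      have e1 := hheK y hy
      have e2 : tri α (D t) (E t) y =
          t * (t * κ₃ y + s t * κ₄ y) + a' y * γ t := by
        conv_lhs => rw [hc]
        have e3 : tri α (D t) (E t) (P y) = t * (t * κ₃ y + s t * κ₄ y) := by
          have e4 : tri α (x 2 0) (x 2 1) (P y) = 0 :=
            h₂ _ (mem_side_right x 0 2 0) _ (mem_side_right x 0 2 1) _ (by
              obtain ⟨c, -, hc'⟩ := hYdec y hy
              rw [hc']
              exact sum_mem fun i _ => Submodule.smul_mem _ _ (mem_side_left x 0 2 i))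
          simp only [D, E, hκ₃, hκ₄, s, map_add, map_smul, LinearMap.add_apply,
            LinearMap.smul_apply, smul_eq_mul, e4]
          linear_combination t * e1
        rw [map_add, map_smul, e3, smul_eq_mul, hγt]
      rw [tri_swap, hA, e2]
      simp only [tri_wedge, hFY0 _ hy, hFY1 _ hy, hFY2 _ hy, hκ₁,
        hκ₂, hκ₃, hκ₄, hPD, hPE, hD₁, hD₂, hD₃, hD₄, hE₁, hE₂, hE₃, hE₄, map_zero,
        LinearMap.zero_apply]
      ring
    refine (isIsotropic_sup_singleton (isIsotropic_sup_singleton ?_ hDY) ?_).mono hle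
    · intro u hu v hv w hw
      rw [hA, h₁ u (hYW hu) v (hYW hv) w (hYW hw)]
      simp [tri_wedge, hFY0 _ hu, hFY0 _ hv, hFY0 _ hw, hFY1 _ hu, hFY1 _ hv, hFY1 _ hw,
        hFY2 _ hu, hFY2 _ hv, hFY2 _ hw]
    · intro u hu v hv
      obtain ⟨y, hy, u', hu', rfl⟩ := Submodule.mem_sup.1 hu
      obtain ⟨z, hz, v', hv', rfl⟩ := Submodule.mem_sup.1 hv
      obtain ⟨c, rfl⟩ := Submodule.mem_span_singleton.1 hu'
      obtain ⟨d, rfl⟩ := Submodule.mem_span_singleton.1 hv'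
      simp only [map_add, map_smul, LinearMap.add_apply, LinearMap.smul_apply, hEY y hy z hz,
        hDEY z hz, tri_swap' (A t) (E t) (D t) y, hDEY y hy, tri_self_right, smul_eq_mul]
      simp
  · intro t u hu v hv w hw
    have hF2 : ∀ c : Fin 3 × Fin 3, c.1 = 1 → ∀ y ∈ side x 0 2, F c y = 0 := by
      intro c hc
      have : side x 0 2 ≤ LinearMap.ker (F c) := by
        rw [side, ← Submodule.span_union, Submodule.span_le]
        rintro _ (⟨i, rfl⟩ | ⟨i, rfl⟩)
        · simpa [hFx] using fun h => by simp [h] at hc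
        · simpa [hFx] using fun h => by simp [h] at hc
      exact fun y hy => this hy
    have h3 := hF2 (1, 2) rfl
    have h4 := hF2 (1, 0) rfl
    rw [hA, h₂ u hu v hv w hw]
    simp [tri_wedge, h3 u hu, h3 v hv, h3 w hw, h4 u hu, h4 v hv, h4 w hw]

end Shear

/-! ### Pencils and nets of skew forms -/

section Pencil

variable {V : Type*} [AddCommGroup V] [Module ℂ V]

/-- A subspace `K` of `W` is completed to `W` by `dim W - dim K` vectors. -/
theorem exists_sup_span_eq [FiniteDimensional ℂ V] {K W : Submodule ℂ V} (h : K ≤ W) (n : ℕ)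
    (hn : finrank ℂ K + n = finrank ℂ W) :
    ∃ a : Fin n → V, (∀ i, a i ∈ W) ∧ K ⊔ Submodule.span ℂ (Set.range a) = W := by
  obtain ⟨D, hD⟩ := Submodule.exists_isCompl (K.comap W.subtype)
  have h1 := Submodule.finrank_add_eq_of_isCompl hD
  rw [(Submodule.comapSubtypeEquivOfLe h).finrank_eq] at h1
  have h2 : finrank ℂ D = n := by omega
  let b := finBasisOfFinrankEq ℂ D h2
  refine ⟨fun i => ((b i : W) : V), fun i => (b i : W).2, ?_⟩
  have h3 : Submodule.span ℂ (Set.range fun i => ((b i : W) : V)) = D.map W.subtype := by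
    have : (Set.range fun i => ((b i : W) : V)) = W.subtype '' (D.subtype '' Set.range b) := by
      rw [← Set.range_comp, ← Set.range_comp]; rfl
    rw [this, Submodule.span_image, Submodule.span_image, b.span_eq, Submodule.map_top,
      Submodule.range_subtype]
  have h4 : (K.comap W.subtype).map W.subtype = K := by
    rw [Submodule.map_comap_subtype, inf_eq_right.2 h]
  rw [h3]
  conv_lhs => rw [← h4]
  rw [← Submodule.map_sup, hD.sup_eq_top, Submodule.map_top, Submodule.range_subtype]

theorem exists_notMem_of_finrank_lt [FiniteDimensional ℂ V] {K W : Submodule ℂ V}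
    (h : finrank ℂ K < finrank ℂ W) : ∃ w ∈ W, w ∉ K := by
  by_contra! hne
  exact absurd (Submodule.finrank_mono (show W ≤ K from hne)) (not_le.2 h)

theorem linearIndependent_cons_of_notMem {n : ℕ} {v : Fin n → V} (hv : LinearIndependent ℂ v)
    {y : V} (hy : y ∉ Submodule.span ℂ (Set.range v)) :
    LinearIndependent ℂ (Fin.cons y v : Fin (n + 1) → V) :=
  linearIndependent_finCons.2 ⟨hv, hy⟩

variable {U : Type*} [AddCommGroup U] [Module ℂ U] [FiniteDimensional ℂ U]

/-- A degenerate skew form on a 4-dimensional space has a 3-dimensional isotropic subspace. -/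
theorem exists_isotropic_of_degenerate (hU : finrank ℂ U = 4) {ω : U →ₗ[ℂ] U →ₗ[ℂ] ℂ}
    (hω : ∀ x, ω x x = 0) {x : U} (hx : x ≠ 0) (hωx : ω x = 0) :
    ∃ k : Fin 3 → U, LinearIndependent ℂ k ∧ ∀ i j, ω (k i) (k j) = 0 := by
  have hskew : ∀ x y, ω x y = -ω y x := fun x y => by
    have := hω (x + y)
    simp only [map_add, LinearMap.add_apply, hω] at this
    linear_combination this
  have h1 : finrank ℂ (Submodule.span ℂ {x}) = 1 := finrank_span_singleton hx
  obtain ⟨y, -, hy⟩ := exists_notMem_of_finrank_lt (V := U) (K := Submodule.span ℂ {x}) (W := ⊤)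
    (by rw [h1, finrank_top, hU]; norm_num)
  have hxy : LinearIndependent ℂ ![y, x] := by
    have := linearIndependent_cons_of_notMem (v := ![x]) (y := y)
      (linearIndependent_unique_iff.2 (by simpa using hx)) (by simpa using hy)
    exact this
  have h2 : finrank ℂ (Submodule.span ℂ (Set.range ![y, x])) = 2 := by
    rw [finrank_span_eq_card hxy]; rfl
  have h3 : 3 ≤ finrank ℂ (LinearMap.ker (ω y)) := by
    have := (ω y).finrank_range_add_finrank_ker
    have h4 : finrank ℂ (LinearMap.range (ω y)) ≤ 1 :=
      (Submodule.finrank_le _).trans (finrank_self ℂ).le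
    omega
  obtain ⟨w, hw, hw'⟩ := exists_notMem_of_finrank_lt (V := U)
    (K := Submodule.span ℂ (Set.range ![y, x])) (W := LinearMap.ker (ω y)) (by omega)
  have hw0 : ω y w = 0 := hw
  refine ⟨![w, y, x], linearIndependent_cons_of_notMem hxy hw', fun i j => ?_⟩
  fin_cases i <;> fin_cases j <;>
    simp [hω, hωx, hw0, hskew w y, hskew y x, hskew w x]

/-- A pencil of skew forms on a 4-dimensional space has a member with a 3-dimensional isotropic
subspace. -/
theorem exists_isotropic_of_pencil (hU : finrank ℂ U = 4) {ω₁ ω₂ : U →ₗ[ℂ] U →ₗ[ℂ] ℂ}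
    (h₁ : ∀ x, ω₁ x x = 0) (h₂ : ∀ x, ω₂ x x = 0) :
    ∃ c₁ c₂ : ℂ, (c₁ ≠ 0 ∨ c₂ ≠ 0) ∧ ∃ k : Fin 3 → U, LinearIndependent ℂ k ∧
      ∀ i j, c₁ * ω₁ (k i) (k j) + c₂ * ω₂ (k i) (k j) = 0 := by
  by_cases hinj : Function.Injective ω₂
  · have : Nontrivial U := nontrivial_of_finrank_pos (R := ℂ) (by omega)
    let T := LinearEquiv.ofInjectiveOfFinrankEq ω₂ hinj (Subspace.dual_finrank_eq (K := ℂ)).symm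
    obtain ⟨μ, hμ⟩ := Module.End.exists_eigenvalue (T.symm.toLinearMap.comp ω₁)
    obtain ⟨v, hv⟩ := hμ.exists_hasEigenvector
    have hv1 : T.symm (ω₁ v) = μ • v := hv.apply_eq_smul
    have hv2 : ω₁ v = μ • ω₂ v := by
      rw [LinearEquiv.symm_apply_eq, map_smul] at hv1
      exact hv1
    obtain ⟨k, hk, hk'⟩ := exists_isotropic_of_degenerate hU (ω := ω₁ + (-μ) • ω₂)
      (fun x => by simp [h₁, h₂]) hv.2 (by simp [hv2])
    exact ⟨1, -μ, Or.inl one_ne_zero, k, hk, fun i j => by simpa using hk' i j⟩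
  · rw [← LinearMap.ker_eq_bot, Submodule.eq_bot_iff] at hinj
    push Not at hinj
    obtain ⟨x, hx, hx0⟩ := hinj
    obtain ⟨k, hk, hk'⟩ := exists_isotropic_of_degenerate hU h₂ hx0 hx
    exact ⟨0, 1, Or.inr one_ne_zero, k, hk, fun i j => by simpa using hk' i j⟩

/-- In a 2-dimensional system of skew forms `α(q, ·, ·)` on a 4-dimensional subspace `C`, one has
a 3-dimensional isotropic subspace. -/
theorem exists_tri_eq_zero_of_finrank_four [FiniteDimensional ℂ V] (α : V [⋀^Fin 3]→ₗ[ℂ] ℂ)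
    {C : Submodule ℂ V} (hC : finrank ℂ C = 4) (q₁ q₂ : V) :
    ∃ c₁ c₂ : ℂ, (c₁ ≠ 0 ∨ c₂ ≠ 0) ∧ ∃ k : Fin 3 → V, LinearIndependent ℂ k ∧ (∀ i, k i ∈ C) ∧
      ∀ i j, tri α (c₁ • q₁ + c₂ • q₂) (k i) (k j) = 0 := by
  obtain ⟨c₁, c₂, hc, k, hk, hk'⟩ := exists_isotropic_of_pencil hC
    (ω₁ := (tri α q₁).domRestrict₁₂ C C) (ω₂ := (tri α q₂).domRestrict₁₂ C C)
    (fun x => tri_self_right α q₁ x) (fun x => tri_self_right α q₂ x)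
  refine ⟨c₁, c₂, hc, fun i => k i, ?_, fun i => (k i).2, fun i j => ?_⟩
  · exact hk.map' C.subtype (Submodule.ker_subtype C)
  · have := hk' i j
    simp only [LinearMap.domRestrict₁₂_apply] at this
    simpa using this

/-- The alternating form `l ∧ α(q, ·, ·)` on a subspace `C`. -/
def wedgeContract (α : V [⋀^Fin 3]→ₗ[ℂ] ℂ) (C : Submodule ℂ V) (q : V) :
    Dual ℂ C →ₗ[ℂ] (C [⋀^Fin 3]→ₗ[ℂ] ℂ) where
  toFun l := α.compLinearMap (C.subtype + l.smulRight q) - α.compLinearMap C.subtype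
  map_add' l l' := by
    ext v
    simp only [AlternatingMap.sub_apply, AlternatingMap.add_apply,
      AlternatingMap.compLinearMap_apply, apply_eq_tri, LinearMap.add_apply,
      LinearMap.smulRight_apply, map_add, map_smul, LinearMap.smul_apply, smul_eq_mul,
      tri_self_left, tri_self_right, tri_self_outer]
    ring
  map_smul' c l := by
    ext v
    simp only [AlternatingMap.sub_apply, AlternatingMap.smul_apply,
      AlternatingMap.compLinearMap_apply, apply_eq_tri, LinearMap.add_apply,
      LinearMap.smulRight_apply, map_add, map_smul, LinearMap.smul_apply, smul_eq_mul,
      tri_self_left, tri_self_right, tri_self_outer, RingHom.id_apply]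
    ring

theorem wedgeContract_apply (α : V [⋀^Fin 3]→ₗ[ℂ] ℂ) (C : Submodule ℂ V) (q : V) (l : Dual ℂ C)
    (v : Fin 3 → C) : wedgeContract α C q l v = l (v 0) * tri α q (v 1) (v 2)
      + l (v 1) * tri α (v 0) q (v 2) + l (v 2) * tri α (v 0) (v 1) q := by
  simp only [wedgeContract, LinearMap.coe_mk, AddHom.coe_mk, AlternatingMap.sub_apply,
      AlternatingMap.compLinearMap_apply, apply_eq_tri, LinearMap.add_apply,
      LinearMap.smulRight_apply, map_add, map_smul, LinearMap.smul_apply, smul_eq_mul,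
      tri_self_left, tri_self_right, tri_self_outer, Submodule.subtype_apply]
  ring

theorem finrank_alternating_five (hU : finrank ℂ U = 5) :
    finrank ℂ (U [⋀^Fin 3]→ₗ[ℂ] ℂ) = 10 := by
  rw [(exteriorPower.alternatingMapLinearEquiv (R := ℂ) (M := U) (N := ℂ) (n := 3)).finrank_eq,
    Subspace.dual_finrank_eq, exteriorPower.finrank_eq, hU]
  rfl

/-- In a net of skew forms `α(q, ·, ·)` on a 5-dimensional subspace `C`, there are two independent
members `r₁`, `r₂` and linear forms `l₁`, `l₂` on `C`, not both zero, with
`l₁ ∧ α(r₁, ·, ·) + l₂ ∧ α(r₂, ·, ·) = 0`. -/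
theorem exists_wedgeContract_add_eq_zero [FiniteDimensional ℂ V] (α : V [⋀^Fin 3]→ₗ[ℂ] ℂ)
    {C : Submodule ℂ V} (hC : finrank ℂ C = 5) {q : Fin 3 → V} (hq : LinearIndependent ℂ q) :
    ∃ r₁ r₂ : V, r₁ ∈ Submodule.span ℂ (Set.range q) ∧ r₂ ∈ Submodule.span ℂ (Set.range q) ∧
      LinearIndependent ℂ ![r₁, r₂] ∧ ∃ l₁ l₂ : Dual ℂ C, (l₁ ≠ 0 ∨ l₂ ≠ 0) ∧
        wedgeContract α C r₁ l₁ + wedgeContract α C r₂ l₂ = 0 := by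
  have hmem : ∀ i, q i ∈ Submodule.span ℂ (Set.range q) := fun i => Submodule.subset_span ⟨i, rfl⟩
  let A := (wedgeContract α C (q 1)).coprod (wedgeContract α C (q 2))
  by_cases hinj : Function.Injective A
  · have hdim : finrank ℂ (Dual ℂ C × Dual ℂ C) = finrank ℂ (C [⋀^Fin 3]→ₗ[ℂ] ℂ) := by
      rw [finrank_prod, Subspace.dual_finrank_eq, hC, finrank_alternating_five hC]
    let T := LinearEquiv.ofInjectiveOfFinrankEq A hinj hdim
    have : Nontrivial (Dual ℂ C) :=
      nontrivial_of_finrank_pos (R := ℂ) (by rw [Subspace.dual_finrank_eq]; omega)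
    obtain ⟨μ, hμ⟩ := Module.End.exists_eigenvalue ((LinearMap.fst ℂ _ _).comp
      (T.symm.toLinearMap.comp (wedgeContract α C (q 0))))
    obtain ⟨l, hl⟩ := hμ.exists_hasEigenvector
    have hl1 : (T.symm (wedgeContract α C (q 0) l)).1 = μ • l := hl.apply_eq_smul
    set l' := (T.symm (wedgeContract α C (q 0) l)).2 with hl'
    have hl2 : wedgeContract α C (q 0) l = A (μ • l, l') := by
      rw [← hl1, hl', Prod.mk.eta]
      exact (T.apply_symm_apply _).symm
    refine ⟨q 0 - μ • q 1, q 2, sub_mem (hmem 0) (Submodule.smul_mem _ _ (hmem 1)), hmem 2, ?_, l,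
      -l', Or.inl hl.2, ?_⟩
    · rw [LinearIndependent.pair_iff]
      intro s t hst
      have h1 := Fintype.linearIndependent_iff.1 hq ![s, -(s * μ), t] (by
        rw [Fin.sum_univ_three, ← hst]
        simp only [Matrix.cons_val_zero, Matrix.cons_val_one, Matrix.cons_val_two, Matrix.tail_cons,
          Matrix.head_cons]
        module)
      exact ⟨h1 0, h1 2⟩
    · have hlin : wedgeContract α C (q 0 - μ • q 1) l =
          wedgeContract α C (q 0) l - μ • wedgeContract α C (q 1) l := by
        ext v
        simp only [AlternatingMap.sub_apply, AlternatingMap.smul_apply, wedgeContract_apply,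
          map_sub, map_smul, LinearMap.sub_apply, LinearMap.smul_apply, smul_eq_mul]
        ring
      rw [hlin, hl2, LinearMap.coprod_apply, map_smul, map_neg]
      abel
  · rw [← LinearMap.ker_eq_bot, Submodule.eq_bot_iff] at hinj
    push Not at hinj
    obtain ⟨⟨l₁, l₂⟩, hl, hl0⟩ := hinj
    refine ⟨q 1, q 2, hmem 1, hmem 2, ?_, l₁, l₂, ?_, hl⟩
    · have := hq.comp ![1, 2] (by decide)
      convert this using 1
      ext i; fin_cases i <;> rfl
    · by_contra! h
      exact hl0 (by rw [h.1, h.2]; rfl)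

end Pencil

/-! ### Every incident pair is a limit of adapted pairs -/

section Lift

variable {V : Type*} [AddCommGroup V] [Module ℂ V]

theorem span_range_three (u : Fin 3 → V) : Submodule.span ℂ (Set.range u) =
    Submodule.span ℂ {u 0} ⊔ Submodule.span ℂ {u 1} ⊔ Submodule.span ℂ {u 2} := by
  rw [← Submodule.span_union, ← Submodule.span_union]
  congr 1
  ext v
  simp [Fin.exists_fin_succ, eq_comm]
  tauto

theorem span_range_two (u : Fin 2 → V) : Submodule.span ℂ (Set.range u) =
    Submodule.span ℂ {u 0} ⊔ Submodule.span ℂ {u 1} := by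
  rw [← Submodule.span_union]
  congr 1
  ext v
  simp [Fin.exists_fin_succ, eq_comm]
  tauto

theorem span_range_one (u : Fin 1 → V) : Submodule.span ℂ (Set.range u) =
    Submodule.span ℂ {u 0} := by
  congr 1
  ext v
  simp [eq_comm]

variable [FiniteDimensional ℂ V]

theorem linearIndependent_flat {x : Fin 3 → Fin 3 → V} {S : Submodule ℂ V} (hS : 9 ≤ finrank ℂ S)
    (h : S ≤ Submodule.span ℂ (Set.range (x 0)) ⊔ Submodule.span ℂ (Set.range (x 1)) ⊔
      Submodule.span ℂ (Set.range (x 2))) : LinearIndependent ℂ (flat x) := by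
  rw [linearIndependent_iff_card_le_finrank_span, Fintype.card_prod, Fintype.card_fin]
  refine hS.trans (Submodule.finrank_mono (h.trans ?_))
  refine sup_le (sup_le ?_ ?_) ?_ <;>
  · rw [Submodule.span_le]
    rintro _ ⟨i, rfl⟩
    exact Submodule.subset_span ⟨(_, i), rfl⟩

theorem nine_le_finrank_sup {H : Submodule ℂ V} {q : V} (hH : finrank ℂ H = 8) (hq : q ∉ H) :
    9 ≤ finrank ℂ (H ⊔ Submodule.span ℂ {q} : Submodule ℂ V) := by
  have : H < H ⊔ Submodule.span ℂ {q} := by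
    refine lt_of_le_not_ge le_sup_left fun h => hq (h ?_)
    exact Submodule.mem_sup_right (Submodule.mem_span_singleton_self q)
  have := Submodule.finrank_lt_finrank_of_lt this
  omega

theorem linearIndependent_of_sup_span_eq {H W : Submodule ℂ V} {n : ℕ} {s : Fin n → V}
    (hn : finrank ℂ W = finrank ℂ H + n) (hs : H ⊔ Submodule.span ℂ (Set.range s) = W) :
    LinearIndependent ℂ s ∧ H ⊓ Submodule.span ℂ (Set.range s) = ⊥ := by
  have hsum := Submodule.finrank_sup_add_finrank_inf_eq H (Submodule.span ℂ (Set.range s))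
  rw [hs] at hsum
  have hle : finrank ℂ (Submodule.span ℂ (Set.range s)) ≤ n := by
    have := finrank_range_le_card (R := ℂ) s
    rwa [Fintype.card_fin] at this
  refine ⟨?_, Submodule.finrank_eq_zero.1 (by omega)⟩
  rw [linearIndependent_iff_card_eq_finrank_span, Fintype.card_fin]
  change n = finrank ℂ (Submodule.span ℂ (Set.range s))
  omega

theorem sup_rearrange_four {L : Type*} [SemilatticeSup L] (k m a a' b b' q : L) :
    k ⊔ m ⊔ (a ⊔ a') ⊔ (k ⊔ m ⊔ (b ⊔ b')) ⊔ q = k ⊔ (q ⊔ a ⊔ a') ⊔ (m ⊔ b ⊔ b') := by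
  ac_rfl

theorem sup_rearrange_five {L : Type*} [SemilatticeSup L] (k m m' a b r r' : L) :
    k ⊔ m ⊔ m' ⊔ a ⊔ (k ⊔ m ⊔ m' ⊔ b) ⊔ r ⊔ r' = k ⊔ (r ⊔ r' ⊔ a) ⊔ (m ⊔ m' ⊔ b) := by
  ac_rfl

variable {α : V [⋀^Fin 3]→ₗ[ℂ] ℂ} {W₁ W₂ : Submodule ℂ V}

theorem exists_lift_of_finrank_three (h₁ : finrank ℂ W₁ = 6) (h₂ : finrank ℂ W₂ = 6)
    (hα₁ : IsIsotropic α W₁) (hα₂ : IsIsotropic α W₂)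
    (hC : finrank ℂ (W₁ ⊓ W₂ : Submodule ℂ V) = 3) :
    ∃ x, side x 0 1 = W₁ ∧ side x 0 2 = W₂ ∧ InPolyClosure (adaptedPairs V) (x, α) := by
  obtain ⟨k, -, hk⟩ := exists_sup_span_eq (K := ⊥) (W := W₁ ⊓ W₂) bot_le 3 (by simp [hC])
  obtain ⟨a, -, ha⟩ := exists_sup_span_eq (K := W₁ ⊓ W₂) (W := W₁) inf_le_left 3 (by omega)
  obtain ⟨b, -, hb⟩ := exists_sup_span_eq (K := W₁ ⊓ W₂) (W := W₂) inf_le_right 3 (by omega)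
  rw [bot_sup_eq] at hk
  have hs₁ : side ![k, a, b] 0 1 = W₁ := by rw [← ha, ← hk]; rfl
  have hs₂ : side ![k, a, b] 0 2 = W₂ := by rw [← hb, ← hk]; rfl
  refine ⟨_, hs₁, hs₂, inPolyClosure_of_linearIndependent
    (linearIndependent_flat (S := W₁ ⊔ W₂) ?_ ?_) (by rwa [hs₁]) (by rwa [hs₂])⟩
  · have := Submodule.finrank_sup_add_finrank_inf_eq W₁ W₂
    omega
  · rw [← hs₁, ← hs₂]
    exact sup_le le_sup_left (sup_le (le_sup_left.trans le_sup_left) le_sup_right)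

/-- Two vectors independent modulo `W₁ + W₂` give a pencil of forms `α(q, ·, ·)` on the
4-dimensional intersection; a member with a 3-dimensional isotropic subspace `⟨k⟩` allows the
deformation. -/
theorem exists_lift_of_finrank_four (hV : finrank ℂ V = 10) (h₁ : finrank ℂ W₁ = 6)
    (h₂ : finrank ℂ W₂ = 6) (hα₁ : IsIsotropic α W₁) (hα₂ : IsIsotropic α W₂)
    (hC : finrank ℂ (W₁ ⊓ W₂ : Submodule ℂ V) = 4) :
    ∃ x, side x 0 1 = W₁ ∧ side x 0 2 = W₂ ∧ InPolyClosure (adaptedPairs V) (x, α) := by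
  have hH : finrank ℂ (W₁ ⊔ W₂ : Submodule ℂ V) = 8 := by
    have := Submodule.finrank_sup_add_finrank_inf_eq W₁ W₂
    omega
  obtain ⟨s, -, hs⟩ := exists_sup_span_eq (K := W₁ ⊔ W₂) (W := ⊤) le_top 2 (by simp [hH, hV])
  obtain ⟨c₁, c₂, hc, k, hk, hkC, hkq⟩ := exists_tri_eq_zero_of_finrank_four α hC (s 0) (s 1)
  set q := c₁ • s 0 + c₂ • s 1 with hq
  have hqH : q ∉ W₁ ⊔ W₂ := by
    intro hqH
    obtain ⟨hsLI, hd⟩ := linearIndependent_of_sup_span_eq (by rw [finrank_top, hV, hH]) hs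
    have hq0 : q = 0 := by
      have : q ∈ (W₁ ⊔ W₂) ⊓ Submodule.span ℂ (Set.range s) :=
        ⟨hqH, add_mem (Submodule.smul_mem _ _ (Submodule.subset_span ⟨0, rfl⟩))
          (Submodule.smul_mem _ _ (Submodule.subset_span ⟨1, rfl⟩))⟩
      rwa [hd, Submodule.mem_bot] at this
    have h1 := Fintype.linearIndependent_iff.1 hsLI ![c₁, c₂] (by
      rw [Fin.sum_univ_two]; exact hq0)
    rcases hc with hc | hc
    exacts [hc (h1 0), hc (h1 1)]
  have hK3 : finrank ℂ (Submodule.span ℂ (Set.range k)) = 3 := by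
    rw [finrank_span_eq_card hk]; rfl
  obtain ⟨m, -, hm⟩ := exists_sup_span_eq (K := Submodule.span ℂ (Set.range k)) (W := W₁ ⊓ W₂)
    (by rw [Submodule.span_le]; rintro _ ⟨i, rfl⟩; exact hkC i) 1 (by omega)
  obtain ⟨a, -, ha⟩ := exists_sup_span_eq (K := W₁ ⊓ W₂) (W := W₁) inf_le_left 2 (by omega)
  obtain ⟨b, -, hb⟩ := exists_sup_span_eq (K := W₁ ⊓ W₂) (W := W₂) inf_le_right 2 (by omega)
  rw [span_range_one] at hm
  rw [span_range_two] at ha hb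
  have hW₁ : W₁ = Submodule.span ℂ (Set.range k) ⊔ Submodule.span ℂ {m 0} ⊔
      (Submodule.span ℂ {a 0} ⊔ Submodule.span ℂ {a 1}) := by rw [hm, ha]
  have hW₂ : W₂ = Submodule.span ℂ (Set.range k) ⊔ Submodule.span ℂ {m 0} ⊔
      (Submodule.span ℂ {b 0} ⊔ Submodule.span ℂ {b 1}) := by rw [hm, hb]
  set x : Fin 3 → Fin 3 → V := ![k, ![q, a 0, a 1], ![m 0, b 0, b 1]] with hx
  have hs₁ : side (shear x ![0, 1, 1] ![1, 0, 0]) 0 1 = W₁ := by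
    rw [side, span_range_three (shear x _ _ 1), ← ha, ← hm]
    simp [shear, x, sup_assoc]
  have hs₂ : side x 0 2 = W₂ := by
    rw [side, span_range_three (x 2), ← hb, ← hm]
    simp [x, sup_assoc]
  refine ⟨_, hs₁, hs₂, inPolyClosure_of_inf_four
    (linearIndependent_flat (nine_le_finrank_sup hH hqH) ?_) (by rwa [hs₁]) (by rwa [hs₂]) hkq⟩
  rw [span_range_three (x 1), span_range_three (x 2)]
  rw [hW₁, hW₂]
  exact (sup_rearrange_four _ _ _ _ _ _ _).le

/-- The degeneration to intersections of dimension five, in coordinate-free form. -/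
theorem exists_lift_of_net (h₁ : finrank ℂ W₁ = 6) (h₂ : finrank ℂ W₂ = 6)
    (hα₁ : IsIsotropic α W₁) (hα₂ : IsIsotropic α W₂)
    (hC : finrank ℂ (W₁ ⊓ W₂ : Submodule ℂ V) = 5) {r₁ r₂ : V}
    (hr : 9 ≤ finrank ℂ (W₁ ⊔ W₂ ⊔ Submodule.span ℂ {r₁} ⊔ Submodule.span ℂ {r₂} : Submodule ℂ V))
    {k : Fin 3 → V} {m₁ m₂ : V} (hkm : Submodule.span ℂ (Set.range k) ⊔ Submodule.span ℂ {m₁} ⊔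
      Submodule.span ℂ {m₂} = W₁ ⊓ W₂)
    (hq₁ : ∀ i j, tri α r₁ (k i) (k j) = 0) (hq₂ : ∀ i j, tri α r₂ (k i) (k j) = 0) {e : ℂ}
    (he : ∀ i, tri α r₁ m₂ (k i) + e * tri α m₁ r₂ (k i) = 0) :
    ∃ x, side x 0 1 = W₁ ∧ side x 0 2 = W₂ ∧ InPolyClosure (adaptedPairs V) (x, α) := by
  obtain ⟨a, -, ha⟩ := exists_sup_span_eq (K := W₁ ⊓ W₂) (W := W₁) inf_le_left 1 (by omega)
  obtain ⟨b, -, hb⟩ := exists_sup_span_eq (K := W₁ ⊓ W₂) (W := W₂) inf_le_right 1 (by omega)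
  rw [span_range_one] at ha hb
  have hW₁ : W₁ = Submodule.span ℂ (Set.range k) ⊔ Submodule.span ℂ {m₁} ⊔
      Submodule.span ℂ {m₂} ⊔ Submodule.span ℂ {a 0} := by rw [hkm, ha]
  have hW₂ : W₂ = Submodule.span ℂ (Set.range k) ⊔ Submodule.span ℂ {m₁} ⊔
      Submodule.span ℂ {m₂} ⊔ Submodule.span ℂ {b 0} := by rw [hkm, hb]
  set x : Fin 3 → Fin 3 → V := ![k, ![r₁, r₂, a 0], ![m₁, m₂, b 0]] with hx
  have hs₁ : side (shear x ![0, 0, 1] ![1, 1, 0]) 0 1 = W₁ := by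
    rw [side, span_range_three (shear x _ _ 1), ← ha, ← hkm]
    simp [shear, x, sup_assoc]
  have hs₂ : side x 0 2 = W₂ := by
    rw [side, span_range_three (x 2), ← hb, ← hkm]
    simp [x, sup_assoc]
  refine ⟨_, hs₁, hs₂, inPolyClosure_of_inf_five
    (linearIndependent_flat hr ?_) (by rwa [hs₁]) (by rwa [hs₂]) hq₁ hq₂ he⟩
  rw [span_range_three (x 1), span_range_three (x 2)]
  rw [hW₁, hW₂]
  exact (sup_rearrange_five _ _ _ _ _ _ _).le

/-- The vectors outside `W₁ + W₂` give a net of skew forms on the 5-dimensional intersection `C`. A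
relation `l₁ ∧ α(r₁, ·, ·) + l₂ ∧ α(r₂, ·, ·) = 0` says that `α` is preserved to first order on `C`
by moving `c` along `l₁ c • r₁ + l₂ c • r₂`; evaluating it on a basis adapted to `l₁` and `l₂` gives
the conditions needed for the deformation. -/
theorem exists_lift_of_finrank_five (hV : finrank ℂ V = 10) (h₁ : finrank ℂ W₁ = 6)
    (h₂ : finrank ℂ W₂ = 6) (hα₁ : IsIsotropic α W₁) (hα₂ : IsIsotropic α W₂)
    (hC : finrank ℂ (W₁ ⊓ W₂ : Submodule ℂ V) = 5) :
    ∃ x, side x 0 1 = W₁ ∧ side x 0 2 = W₂ ∧ InPolyClosure (adaptedPairs V) (x, α) := by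
  have hH : finrank ℂ (W₁ ⊔ W₂ : Submodule ℂ V) = 7 := by
    have := Submodule.finrank_sup_add_finrank_inf_eq W₁ W₂
    omega
  obtain ⟨s, -, hs⟩ := exists_sup_span_eq (K := W₁ ⊔ W₂) (W := ⊤) le_top 3 (by simp [hH, hV])
  obtain ⟨hsLI, hHQ⟩ := linearIndependent_of_sup_span_eq (by rw [finrank_top, hV, hH]) hs
  have hQ3' := finrank_span_eq_card hsLI
  rw [Fintype.card_fin] at hQ3'
  set Q := Submodule.span ℂ (Set.range s) with hQ
  -- independent vectors of `Q` are independent modulo `W₁ ⊔ W₂`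
  have hnine : ∀ r₁ r₂ : V, r₁ ∈ Q → r₂ ∈ Q → LinearIndependent ℂ ![r₁, r₂] → 9 ≤ finrank ℂ
      (W₁ ⊔ W₂ ⊔ Submodule.span ℂ {r₁} ⊔ Submodule.span ℂ {r₂} : Submodule ℂ V) := by
    intro r₁ r₂ hr₁ hr₂ hr
    have e1 : finrank ℂ (Submodule.span ℂ {r₁} ⊔ Submodule.span ℂ {r₂} : Submodule ℂ V) = 2 := by
      have := finrank_span_eq_card hr
      rwa [span_range_two, Fintype.card_fin] at this
    have e2 := Submodule.finrank_sup_add_finrank_inf_eq (W₁ ⊔ W₂)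
      (Submodule.span ℂ {r₁} ⊔ Submodule.span ℂ {r₂})
    have e3 : (W₁ ⊔ W₂) ⊓ (Submodule.span ℂ {r₁} ⊔ Submodule.span ℂ {r₂}) = ⊥ := by
      rw [eq_bot_iff, ← hHQ]
      refine inf_le_inf_left _ (sup_le ?_ ?_) <;> rwa [Submodule.span_singleton_le_iff_mem]
    rw [e3, finrank_bot, ← sup_assoc] at e2
    omega
  set C := W₁ ⊓ W₂ with hCdef
  obtain ⟨r₁, r₂, hr₁, hr₂, hr, l₁, l₂, hl, hlr⟩ := exists_wedgeContract_add_eq_zero α hC hsLI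
  by_cases hLI : LinearIndependent ℂ ![l₁, l₂]
  · -- `k` spans the common kernel of `l₁` and `l₂`, and `m` is dual to them
    obtain ⟨f, hf⟩ := exists_dual_family hLI
    let m : Fin 2 → C := fun j => (evalEquiv ℂ C).symm ((LinearMap.proj j).comp f)
    have hm : ∀ (l : Dual ℂ C) j, l (m j) = f l j := fun l j => by
      have : evalEquiv ℂ C (m j) = (LinearMap.proj j).comp f := LinearEquiv.apply_symm_apply _ _
      exact LinearMap.congr_fun this l
    have h10 : l₁ (m 0) = 1 := by rw [hm, show l₁ = ![l₁, l₂] 0 from rfl, hf]; simp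
    have h11 : l₁ (m 1) = 0 := by rw [hm, show l₁ = ![l₁, l₂] 0 from rfl, hf]; simp
    have h20 : l₂ (m 0) = 0 := by rw [hm, show l₂ = ![l₁, l₂] 1 from rfl, hf]; simp
    have h21 : l₂ (m 1) = 1 := by rw [hm, show l₂ = ![l₁, l₂] 1 from rfl, hf]; simp
    let L : C →ₗ[ℂ] ℂ × ℂ := l₁.prod l₂
    have hLsurj : LinearMap.range L = ⊤ := by
      rw [LinearMap.range_eq_top]
      rintro ⟨u, v⟩
      exact ⟨u • m 0 + v • m 1, by simp [L, h10, h11, h20, h21]⟩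
    have hLker : finrank ℂ (LinearMap.ker L) = 3 := by
      have := L.finrank_range_add_finrank_ker
      rw [hLsurj, finrank_top, finrank_prod, finrank_self, hC] at this
      omega
    let b := finBasisOfFinrankEq ℂ (LinearMap.ker L) hLker
    have hb : ∀ i, l₁ (b i : C) = 0 ∧ l₂ (b i : C) = 0 := fun i => by
      have := (b i).2
      rw [LinearMap.mem_ker] at this
      exact Prod.ext_iff.1 this
    have hev := fun v : Fin 3 → C => congrArg (fun ω => ω v) hlr
    simp only [AlternatingMap.add_apply, wedgeContract_apply, AlternatingMap.zero_apply] at hev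
    have hspan : Submodule.span ℂ (Set.range fun i => ((b i : C) : V)) =
        (LinearMap.ker L).map C.subtype := by
      have : (Set.range fun i => ((b i : C) : V)) =
          C.subtype '' ((LinearMap.ker L).subtype '' Set.range b) := by
        rw [← Set.range_comp, ← Set.range_comp]; rfl
      rw [this, Submodule.span_image, Submodule.span_image, b.span_eq, Submodule.map_top,
        Submodule.range_subtype]
    refine exists_lift_of_net h₁ h₂ hα₁ hα₂ hC (hnine r₁ r₂ hr₁ hr₂ hr)
      (k := fun i => ((b i : C) : V)) (m₁ := m 0) (m₂ := m 1) (e := 1) ?_ ?_ ?_ ?_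
    · rw [hspan]
      refine le_antisymm (sup_le (sup_le (Submodule.map_subtype_le _ _) ?_) ?_) ?_
      · rw [Submodule.span_singleton_le_iff_mem]; exact (m 0).2
      · rw [Submodule.span_singleton_le_iff_mem]; exact (m 1).2
      · intro c hc
        have hdec : c = ((⟨c, hc⟩ - l₁ ⟨c, hc⟩ • m 0 - l₂ ⟨c, hc⟩ • m 1 : C) : V) +
            l₁ ⟨c, hc⟩ • (m 0 : V) + l₂ ⟨c, hc⟩ • (m 1 : V) := by
          push_cast
          abel
        rw [hdec]
        refine add_mem (Submodule.mem_sup_left (add_mem (Submodule.mem_sup_left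
          ⟨⟨c, hc⟩ - l₁ ⟨c, hc⟩ • m 0 - l₂ ⟨c, hc⟩ • m 1, ?_, rfl⟩)
          (Submodule.mem_sup_right ?_)))
          (Submodule.mem_sup_right ?_)
        · simp [L, h10, h11, h20, h21]
        · exact Submodule.smul_mem _ _ (Submodule.mem_span_singleton_self _)
        · exact Submodule.smul_mem _ _ (Submodule.mem_span_singleton_self _)
    · intro i j
      simpa [h10, h20, hb] using hev ![m 0, b i, b j]
    · intro i j
      simpa [h11, h21, hb] using hev ![m 1, b i, b j]
    · intro i
      simpa [h10, h11, h20, h21, hb] using hev ![m 0, m 1, b i]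
  · -- the relation is `l ∧ α(r, ·, ·) = 0`: `α(r, ·, ·)` vanishes on the kernel of `l`, and `k` is
    -- found there from the pencil of the remaining vectors outside `W₁ + W₂`
    have hred : ∃ (l : Dual ℂ C) (r : V), l ≠ 0 ∧ r ∈ Q ∧ r ≠ 0 ∧ wedgeContract α C r l = 0 := by
      rw [LinearIndependent.pair_iff] at hLI hr
      push Not at hLI
      obtain ⟨u, v, huv, huv0⟩ := hLI
      have hcomb : ∀ (l : Dual ℂ C) (c d : ℂ), wedgeContract α C (c • r₁ + d • r₂) l =
          wedgeContract α C r₁ (c • l) + wedgeContract α C r₂ (d • l) := by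
        intro l c d
        ext w
        simp only [AlternatingMap.add_apply, AlternatingMap.smul_apply, wedgeContract_apply,
            map_add,
          map_smul, LinearMap.add_apply, LinearMap.smul_apply, smul_eq_mul]
        ring
      by_cases hu : u = 0
      · have hv : v ≠ 0 := huv0 hu
        have hl₂ : l₂ = 0 := by
          rw [hu, zero_smul, zero_add] at huv
          exact (smul_eq_zero.1 huv).resolve_left hv
        have hl₁ : l₁ ≠ 0 := by
          rcases hl with hl | hl
          exacts [hl, absurd hl₂ hl]
        refine ⟨l₁, r₁, hl₁, hr₁, ?_, by simpa [hl₂] using hlr⟩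
        rintro rfl
        have := hr 1 0 (by simp)
        exact one_ne_zero this.1
      · have hl₁ : l₁ = (-(u⁻¹ * v)) • l₂ := by
          have : u • l₁ = -(v • l₂) := eq_neg_of_add_eq_zero_left huv
          rw [neg_smul, mul_smul, ← smul_neg, ← this, smul_smul, inv_mul_cancel₀ hu, one_smul]
        have hl₂ : l₂ ≠ 0 := by
          rintro rfl
          rw [smul_zero] at hl₁
          rcases hl with hl | hl
          exacts [hl hl₁, hl rfl]
        refine ⟨l₂, (-(u⁻¹ * v)) • r₁ + (1 : ℂ) • r₂, hl₂,
          add_mem (Submodule.smul_mem _ _ hr₁) (Submodule.smul_mem _ _ hr₂), ?_, ?_⟩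
        · intro h0
          exact one_ne_zero (hr _ _ h0).2
        · rw [hcomb, ← hl₁, one_smul, hlr]
    obtain ⟨l, r, hl, hrQ, hr0, hlr⟩ := hred
    have hsurj := LinearMap.range_eq_top.1 ((LinearMap.range_eq_top.2
      (LinearMap.surjective hl)))
    obtain ⟨m₁, hm₁⟩ := hsurj 1
    have hker : finrank ℂ (LinearMap.ker l) = 4 := by
      have := l.finrank_range_add_finrank_ker
      rw [LinearMap.range_eq_top.2 hsurj, finrank_top, finrank_self, hC] at this
      omega
    set K := (LinearMap.ker l).map C.subtype with hK
    have hK4 : finrank ℂ K = 4 := by rw [hK, Submodule.finrank_map_subtype_eq, hker]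
    have hrK : ∀ y ∈ K, ∀ z ∈ K, tri α r y z = 0 := by
      rintro _ ⟨y, hy, rfl⟩ _ ⟨z, hz, rfl⟩
      have := congrArg (fun ω => ω ![m₁, y, z]) hlr
      have hy0 : l y = 0 := hy
      have hz0 : l z = 0 := hz
      simpa [wedgeContract_apply, hm₁, hy0, hz0] using this
    obtain ⟨s', -, hs'⟩ := exists_sup_span_eq (K := Submodule.span ℂ {r}) (W := Q)
      (by rwa [Submodule.span_singleton_le_iff_mem]) 2 (by rw [finrank_span_singleton hr0, hQ3'])
    obtain ⟨c₁, c₂, hc, k, hk, hkK, hkq⟩ := exists_tri_eq_zero_of_finrank_four α hK4 (s' 0) (s' 1)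
    have hLI3 : LinearIndependent ℂ ![r, s' 0, s' 1] := by
      have e : finrank ℂ (Submodule.span ℂ (Set.range ![r, s' 0, s' 1])) = 3 := by
        rw [span_range_three]
        change finrank ℂ (Submodule.span ℂ {r} ⊔ Submodule.span ℂ {s' 0} ⊔
          Submodule.span ℂ {s' 1} : Submodule ℂ V) = 3
        rw [sup_assoc, ← span_range_two, hs', hQ3']
      rw [linearIndependent_iff_card_eq_finrank_span, Fintype.card_fin]
      exact e.symm
    have hK3 : finrank ℂ (Submodule.span ℂ (Set.range k)) = 3 := by
      rw [finrank_span_eq_card hk]; rfl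
    obtain ⟨m₂, hm₂, hkm⟩ := exists_sup_span_eq (K := Submodule.span ℂ (Set.range k)) (W := K)
      (by rw [Submodule.span_le]; rintro _ ⟨i, rfl⟩; exact hkK i) 1 (by omega)
    rw [span_range_one] at hkm
    refine exists_lift_of_net h₁ h₂ hα₁ hα₂ hC (r₁ := r) (r₂ := c₁ • s' 0 + c₂ • s' 1)
      (hnine _ _ hrQ ?_ ?_) (k := k) (m₁ := m₁) (m₂ := m₂ 0) (e := 0) ?_ ?_ hkq ?_
    · rw [← hs']
      exact Submodule.mem_sup_right (add_mem (Submodule.smul_mem _ _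
          (Submodule.subset_span ⟨0, rfl⟩))
        (Submodule.smul_mem _ _ (Submodule.subset_span ⟨1, rfl⟩)))
    · rw [LinearIndependent.pair_iff]
      intro u v huv
      have h1 := Fintype.linearIndependent_iff.1 hLI3 ![u, v * c₁, v * c₂] (by
        rw [Fin.sum_univ_three, ← huv]
        simp only [Matrix.cons_val_zero, Matrix.cons_val_one, Matrix.cons_val_two,
          Matrix.tail_cons, Matrix.head_cons]
        module)
      refine ⟨h1 0, ?_⟩
      rcases hc with hc | hc
      · exact (mul_eq_zero.1 (h1 1)).resolve_right hc
      · exact (mul_eq_zero.1 (h1 2)).resolve_right hc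
    · rw [sup_right_comm, hkm]
      refine le_antisymm (sup_le (Submodule.map_subtype_le _ _) ?_) ?_
      · rw [Submodule.span_singleton_le_iff_mem]; exact m₁.2
      · intro c hc
        have hdec : c = ((⟨c, hc⟩ - l ⟨c, hc⟩ • m₁ : C) : V) + l ⟨c, hc⟩ • (m₁ : V) := by
          push_cast
          abel
        rw [hdec]
        refine add_mem (Submodule.mem_sup_left ⟨⟨c, hc⟩ - l ⟨c, hc⟩ • m₁, ?_, rfl⟩)
          (Submodule.mem_sup_right ?_)
        · simp [hm₁]
        · exact Submodule.smul_mem _ _ (Submodule.mem_span_singleton_self _)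
    · exact fun i j => hrK _ (hkK i) _ (hkK j)
    · intro i
      rw [hrK _ (hm₂ 0) _ (hkK i), zero_mul, add_zero]

/-- Every pair of distinct isotropic 6-dimensional subspaces with intersection of dimension at
least three is a limit of adapted pairs (with varying `α`). -/
theorem exists_lift (hV : finrank ℂ V = 10) (h₁ : finrank ℂ W₁ = 6) (h₂ : finrank ℂ W₂ = 6)
    (hα₁ : IsIsotropic α W₁) (hα₂ : IsIsotropic α W₂) (hne : W₁ ≠ W₂)
    (hC : 3 ≤ finrank ℂ (W₁ ⊓ W₂ : Submodule ℂ V)) :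
    ∃ x, side x 0 1 = W₁ ∧ side x 0 2 = W₂ ∧ InPolyClosure (adaptedPairs V) (x, α) := by
  have hlt : finrank ℂ (W₁ ⊓ W₂ : Submodule ℂ V) < 6 := by
    by_contra! h
    have e₁ := Submodule.eq_of_le_of_finrank_le (inf_le_left : W₁ ⊓ W₂ ≤ W₁) (by omega)
    have e₂ := Submodule.eq_of_le_of_finrank_le (inf_le_right : W₁ ⊓ W₂ ≤ W₂) (by omega)
    exact hne (e₁.symm.trans e₂)
  obtain h | h | h : finrank ℂ (W₁ ⊓ W₂ : Submodule ℂ V) = 3 ∨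
      finrank ℂ (W₁ ⊓ W₂ : Submodule ℂ V) = 4 ∨ finrank ℂ (W₁ ⊓ W₂ : Submodule ℂ V) = 5 := by omega
  · exact exists_lift_of_finrank_three h₁ h₂ hα₁ hα₂ h
  · exact exists_lift_of_finrank_four hV h₁ h₂ hα₁ hα₂ h
  · exact exists_lift_of_finrank_five hV h₁ h₂ hα₁ hα₂ h

end Lift

/-! ### A generic 3-form has adapted pairs -/

section Curves

open MvPolynomial

variable {E : Type*} [AddCommGroup E] [Module ℂ E] [FiniteDimensional ℂ E]

theorem eval_smul_of_isHomogeneous {σ : Type*} {p : MvPolynomial σ ℂ} {n : ℕ}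
    (hp : p.IsHomogeneous n) (t : ℂ) (y : σ → ℂ) : eval (t • y) p = t ^ n * eval y p := by
  rw [eval_eq, eval_eq, Finset.mul_sum]
  refine Finset.sum_congr rfl fun d hd => ?_
  have h1 : ∑ i ∈ d.support, d i = n := by
    have := hp.degree_eq_sum_deg_support hd
    rw [← this]
  simp only [Pi.smul_apply, smul_eq_mul, mul_pow, Finset.prod_mul_distrib,
      Finset.prod_pow_eq_pow_sum,
    h1]
  ring

/-- If a polynomial function vanishes along polynomial curves through a point in all directions,
it is zero: its leading form at the point vanishes in every direction. -/
theorem polyFun_eq_zero_of_curves {f : E → ℂ} (hf : f ∈ polyFun E) (p : E)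
    (h : ∀ η, ∃ δ : ℂ → E, IsPolyMap δ ∧ δ 0 = η ∧ {t : ℂ | f (p + t • δ t) ≠ 0}.Finite) (x : E) :
    f x = 0 := by
  obtain ⟨P, hP⟩ := exists_eval_eq (polyFun_comp hf
    ((isPolyMap_const p).add isPolyMap_id : IsPolyMap fun y : E => p + y))
  suffices P = 0 by simpa [this] using hP (x - p)
  by_contra hP0
  have hex : ∃ m, homogeneousComponent m P ≠ 0 := by
    by_contra! hall
    apply hP0
    rw [← sum_homogeneousComponent P]
    exact Finset.sum_eq_zero fun i _ => hall i
  classical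
  let m := Nat.find hex
  have hm : homogeneousComponent m P ≠ 0 := Nat.find_spec hex
  have hlt : ∀ j < m, homogeneousComponent j P = 0 := fun j hj => not_not.1 (Nat.find_min hex hj)
  let B := (finBasis ℂ E).equivFun
  let g : ℂ → E → ℂ := fun t y => ∑ j ∈ Finset.range (P.totalDegree + 1),
    t ^ (j - m) * eval (B y) (homogeneousComponent j P)
  have hg : ∀ t y, f (p + t • y) = t ^ m * g t y := by
    intro t y
    rw [hP]
    conv_lhs => rw [← sum_homogeneousComponent P]
    rw [map_sum, Finset.mul_sum]
    refine Finset.sum_congr rfl fun j _ => ?_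
    rw [map_smul, eval_smul_of_isHomogeneous (homogeneousComponent_isHomogeneous j P)]
    rcases lt_or_ge j m with hj | hj
    · simp [hlt j hj]
    · rw [← mul_assoc, ← pow_add, Nat.add_sub_cancel' hj]
  have hg0 : ∀ y, g 0 y = eval (B y) (homogeneousComponent m P) := by
    intro y
    have hmem : m ∈ Finset.range (P.totalDegree + 1) := by
      rw [Finset.mem_range]
      by_contra! hlt
      exact hm (homogeneousComponent_eq_zero _ _ (by omega))
    refine (Finset.sum_eq_single_of_mem m hmem fun j _ hj => ?_).trans (by simp)
    rcases lt_or_gt_of_ne hj with hj | hj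
    · simp [hlt j hj]
    · rw [zero_pow (by omega), zero_mul]
  apply hm
  refine MvPolynomial.funext fun y => ?_
  rw [map_zero, ← LinearEquiv.apply_symm_apply B y, ← hg0]
  obtain ⟨δ, hδ, hδ0, hfin⟩ := h (B.symm y)
  rw [← hδ0]
  have hpoly : (fun t => g t (δ t)) ∈ polyFun ℂ := polyFun_sum _ fun j _ =>
    polyFun_mul (polyFun_pow (linear_mem_polyFun LinearMap.id) _)
      (polyFun_comp (eval_repr_mem_polyFun _) hδ)
  refine polyFun_eq_zero_of_infinite hpoly (((hfin.union
      (Set.finite_singleton 0)).infinite_compl).mono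
    fun t ht => ?_) 0
  simp only [Set.mem_compl_iff, Set.mem_union, Set.mem_ofPred_eq, Set.mem_singleton_iff, not_or,
    not_not, hg] at ht
  exact (mul_eq_zero.1 ht.1).resolve_left (pow_ne_zero _ ht.2)

end Curves

section Dominance

variable {V : Type*} [AddCommGroup V] [Module ℂ V]

/-- The derivative at `t = 0` of `α ∘ (1 + t X)`. -/
noncomputable def lieAction (X : V →ₗ[ℂ] V) (α : V [⋀^Fin 3]→ₗ[ℂ] ℂ) : V [⋀^Fin 3]→ₗ[ℂ] ℂ :=
  (2⁻¹ : ℂ) • (α.compLinearMap (LinearMap.id + X) - α.compLinearMap (LinearMap.id - X))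
    - α.compLinearMap X

/-- Half the second derivative at `t = 0` of `α ∘ (1 + t X)`. -/
noncomputable def lieAction₂ (X : V →ₗ[ℂ] V) (α : V [⋀^Fin 3]→ₗ[ℂ] ℂ) : V [⋀^Fin 3]→ₗ[ℂ] ℂ :=
  (2⁻¹ : ℂ) • (α.compLinearMap (LinearMap.id + X) + α.compLinearMap (LinearMap.id - X)) - α

theorem tri_sub (α β : V [⋀^Fin 3]→ₗ[ℂ] ℂ) (x y z : V) :
    tri (α - β) x y z = tri α x y z - tri β x y z := by
  rw [sub_eq_add_neg, ← neg_one_smul ℂ, tri_add, tri_smul]; ring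

theorem tri_lieAction (X : V →ₗ[ℂ] V) (α : V [⋀^Fin 3]→ₗ[ℂ] ℂ) (x y z : V) :
    tri (lieAction X α) x y z = tri α (X x) y z + tri α x (X y) z + tri α x y (X z) := by
  simp only [lieAction, tri_sub, tri_smul, tri_compLinearMap, LinearMap.add_apply,
    LinearMap.sub_apply, LinearMap.id_apply, map_add, map_sub]
  ring

theorem tri_ext {α β : V [⋀^Fin 3]→ₗ[ℂ] ℂ} (h : ∀ x y z, tri α x y z = tri β x y z) : α = β := by
  ext v
  rw [apply_eq_tri, apply_eq_tri, h]

theorem compLinearMap_id_add (X : V →ₗ[ℂ] V) (α : V [⋀^Fin 3]→ₗ[ℂ] ℂ) (t : ℂ) :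
    α.compLinearMap (LinearMap.id + t • X) =
      α + t • lieAction X α + t ^ 2 • lieAction₂ X α + t ^ 3 • α.compLinearMap X := by
  refine tri_ext fun x y z => ?_
  simp only [lieAction, lieAction₂, tri_add, tri_sub, tri_smul, tri_compLinearMap,
    LinearMap.add_apply, LinearMap.sub_apply, LinearMap.id_apply, LinearMap.smul_apply, map_add,
    map_sub, map_smul, smul_eq_mul]
  ring

/-- Adapted tuples are carried along by pullback of forms. -/
theorem IsAdapted.compLinearMap {α : V [⋀^Fin 3]→ₗ[ℂ] ℂ} {x y : Fin 3 → Fin 3 → V}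
    (h : IsAdapted α x) {T : V →ₗ[ℂ] V} (hT : ∀ i j, T (y i j) = x i j) :
    IsAdapted (α.compLinearMap T) y := by
  have hside : ∀ i j, side x i j = (side y i j).map T := fun i j => by
    rw [side, side, Submodule.map_sup, Submodule.map_span, Submodule.map_span, ← Set.range_comp,
      ← Set.range_comp]
    simp only [Function.comp_def, hT]
  have hiso : ∀ i j, IsIsotropic α (side x i j) → IsIsotropic (α.compLinearMap T) (side y i j) := by
    intro i j h u hu v hv w hw
    rw [hside] at h
    rw [tri_compLinearMap]
    exact h _ ⟨u, hu, rfl⟩ _ ⟨v, hv, rfl⟩ _ ⟨w, hw, rfl⟩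
  refine ⟨hiso _ _ h.iso₁, hiso _ _ h.iso₂, ?_⟩
  have := h.disc_ne
  simp only [disc, linkMatrix, tri_compLinearMap, hT] at this ⊢
  exact this

theorem leviCivita_swap (i j l : Fin 3) : leviCivita i l j = -leviCivita i j l := by
  simp only [leviCivita]; ring

/-- The linear system `x ↦ tr x - xᵀ` is solvable. -/
theorem exists_leviCivita_sum_eq {H : Fin 3 → Fin 3 → Fin 3 → ℂ}
    (hH : ∀ i j l, H i l j = -H i j l) :
    ∃ m : Fin 3 → Fin 3 → ℂ, ∀ i j l,
      ∑ p, (m j p * leviCivita i p l + m l p * leviCivita i j p) = H i j l := by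
  refine ⟨fun i j => (if i = j then 2⁻¹ * ∑ r, H r (r + 1) (r + 2) else 0) - H i (j + 1) (j + 2),
      ?_⟩
  have hH0 : ∀ i j, H i j j = 0 := fun i j => self_eq_neg.1 (hH i j j)
  intro i j l
  have e1 : (0 : Fin 3) + 2 = 2 := rfl
  have e2 : (1 : Fin 3) + 2 = 0 := rfl
  have e3 : (2 : Fin 3) + 2 = 1 := rfl
  have e4 : (1 : Fin 3) + 1 = 2 := rfl
  have e5 : (2 : Fin 3) + 1 = 0 := rfl
  have a0 := hH i 0 1
  have a1 := hH i 1 2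
  have a2 := hH i 2 0
  fin_cases i <;> fin_cases j <;> fin_cases l <;>
    simp [Fin.sum_univ_three, leviCivita, hH0, e1, e2, e3, e4, e5] <;> norm_num <;> grind

end Dominance

section Dominance

variable {V : Type*} [AddCommGroup V] [Module ℂ V]

/-- The sum of the 3-form `detForm` in nine coordinates and of `h ∧ ∑ₛ fₛ₁ ∧ fₛ₂` for a tenth
coordinate `h`. -/
noncomputable def baseForm (f : V →ₗ[ℂ] (Fin 3 × Fin 3 → ℂ)) (h : V →ₗ[ℂ] ℂ) :
    V [⋀^Fin 3]→ₗ[ℂ] ℂ :=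
  detForm f + ∑ s, wedge h ((LinearMap.proj (s, 1)).comp f) ((LinearMap.proj (s, 2)).comp f)

variable {x : Fin 3 → Fin 3 → V} {v : V} {f : V →ₗ[ℂ] (Fin 3 × Fin 3 → ℂ)} {h : V →ₗ[ℂ] ℂ}

theorem tri_baseForm (hf : ∀ i j c, f (x i j) c = if c = (i, j) then 1 else 0)
    (hx : ∀ i j, h (x i j) = 0) (r s t i j l : Fin 3) :
    tri (baseForm f h) (x r i) (x s j) (x t l) =
      leviCivita r s t ^ 2 * leviCivita i j l := by
  simp only [baseForm, tri_add, tri_sum, tri_detForm, tri_wedge, LinearMap.comp_apply,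
    LinearMap.proj_apply, hf, hx, Prod.mk.injEq]
  fin_cases r <;> fin_cases s <;> fin_cases t <;>
    simp [leviCivita] <;> norm_num <;> ring

theorem tri_baseForm_last (hf : ∀ i j c, f (x i j) c = if c = (i, j) then 1 else 0)
    (hx : ∀ i j, h (x i j) = 0) (hfv : f v = 0) (hv : h v = 1) (r s i j : Fin 3) :
    tri (baseForm f h) v (x r i) (x s j) = if r = s then leviCivita 0 i j else 0 := by
  simp only [baseForm, tri_add, tri_sum, tri_detForm, tri_wedge, LinearMap.comp_apply,
    LinearMap.proj_apply, hf, hx, hfv, hv, Prod.mk.injEq, Pi.zero_apply]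
  fin_cases r <;> fin_cases s <;> fin_cases i <;> fin_cases j <;>
    simp [leviCivita] <;> norm_num

theorem leviCivita_self_right (i j : Fin 3) : leviCivita i j j = 0 := by simp [leviCivita]

theorem leviCivita_self_outer (i j : Fin 3) : leviCivita i j i = 0 := by simp [leviCivita]

theorem leviCivita_self_left (i j : Fin 3) : leviCivita i i j = 0 := by simp [leviCivita]

theorem leviCivita_sq {r s : Fin 3} (h : r ≠ s) (t : Fin 3) :
    leviCivita r s t ^ 2 = if t = -(r + s) then 1 else 0 := by
  revert h
  have : ∀ a b c : Fin 3, a ≠ b → (c = -(a + b) ↔ c ≠ a ∧ c ≠ b) := by decide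
  intro h
  simp only [this r s t h]
  fin_cases r <;> fin_cases s <;> fin_cases t <;> simp [leviCivita] at h ⊢ <;> norm_num

theorem tri_eq_leviCivita (η : V [⋀^Fin 3]→ₗ[ℂ] ℂ) (u : Fin 3 → V) (i j l : Fin 3) :
    tri η (u i) (u j) (u l) = leviCivita i j l * tri η (u 0) (u 1) (u 2) := by
  have h1 := tri_swap η (u 0) (u 1) (u 2)
  have h2 := tri_swap' η (u 0) (u 1) (u 2)
  have h3 := tri_swap' η (u 1) (u 0) (u 2)
  have h4 := tri_swap η (u 0) (u 2) (u 1)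
  have h5 := tri_swap' η (u 2) (u 0) (u 1)
  fin_cases i <;> fin_cases j <;> fin_cases l <;>
    simp [leviCivita] <;> norm_num <;> grind

/-- Every 3-form is, up to the action of the Lie algebra on the base form, isotropic on the
sides of the frame. -/
theorem exists_isIsotropic_sub_lieAction
    (hf : ∀ i j c, f (x i j) c = if c = (i, j) then 1 else 0)
    (hx : ∀ i j, h (x i j) = 0) (hfv : f v = 0) (hv : h v = 1) (η : V [⋀^Fin 3]→ₗ[ℂ] ℂ) :
    ∃ X : V →ₗ[ℂ] V, ∀ i j, i ≠ j → IsIsotropic (η - lieAction X (baseForm f h)) (side x i j) := by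
  let c : Fin 3 → ℂ := fun s => tri η (x s 0) (x s 1) (x s 2)
  have hm : ∀ s t : Fin 3, ∃ m : Fin 3 → Fin 3 → ℂ, ∀ i j l,
      ∑ p, (m j p * leviCivita i p l + m l p * leviCivita i j p) =
        tri η (x (-(s + t)) i) (x s j) (x s l)
          - (if i = 0 then c (-(s + t)) else 0) * leviCivita 0 j l := fun s t =>
    exists_leviCivita_sum_eq fun i j l => by
      rw [tri_swap', leviCivita_swap 0 j l]; ring
  choose m hm using hm
  let M : Fin 3 → Fin 3 → Fin 3 → Fin 3 → ℂ := fun s j t p => m s t j p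
  let X : V →ₗ[ℂ] V := ∑ s, ∑ j, ((LinearMap.proj (s, j)).comp f).smulRight
    (∑ t, ∑ p, M s j t p • x t p + (if j = 0 then c s else 0) • v)
  have hX : ∀ s j, X (x s j) = ∑ t, ∑ p, M s j t p • x t p + (if j = 0 then c s else 0) • v := by
    intro s j
    simp only [X, LinearMap.sum_apply, LinearMap.smulRight_apply, LinearMap.comp_apply,
      LinearMap.proj_apply, hf, Prod.mk.injEq]
    rw [Finset.sum_eq_single_of_mem s (Finset.mem_univ _) fun s' _ hs' =>
      Finset.sum_eq_zero fun j' _ => by simp [hs'],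
      Finset.sum_eq_single_of_mem j (Finset.mem_univ _) fun j' _ hj' => by simp [hj']]
    simp
  have hv₂ : ∀ r s i j, tri (baseForm f h) (x r i) v (x s j) =
      -if r = s then leviCivita 0 i j else 0 := fun r s i j => by
    rw [tri_swap, tri_baseForm_last hf hx hfv hv]
  have hv₃ : ∀ r s i j, tri (baseForm f h) (x r i) (x s j) v =
      if r = s then leviCivita 0 i j else 0 := fun r s i j => by
    rw [tri_rotate, tri_baseForm_last hf hx hfv hv]
  have hD : ∀ r s t i j l, tri (lieAction X (baseForm f h)) (x r i) (x s j) (x t l) =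
      (∑ w, ∑ p, M r i w p * (leviCivita w s t ^ 2 * leviCivita p j l) +
        (if i = 0 then c r else 0) * (if s = t then leviCivita 0 j l else 0)) +
      (∑ w, ∑ p, M s j w p * (leviCivita r w t ^ 2 * leviCivita i p l) +
        (if j = 0 then c s else 0) * (-if r = t then leviCivita 0 i l else 0)) +
      (∑ w, ∑ p, M t l w p * (leviCivita r s w ^ 2 * leviCivita i j p) +
        (if l = 0 then c t else 0) * (if r = s then leviCivita 0 i j else 0)) := by
    intro r s t i j l
    rw [tri_lieAction, hX, hX, hX]
    simp only [map_add, map_sum, map_smul, LinearMap.add_apply, LinearMap.sum_apply,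
      LinearMap.smul_apply, smul_eq_mul, tri_baseForm hf hx, tri_baseForm_last hf hx hfv hv, hv₂,
      hv₃]
  have hsame : ∀ s, IsIsotropic (η - lieAction X (baseForm f h))
      (Submodule.span ℂ (Set.range (x s))) := by
    intro s
    rw [isIsotropic_span_iff]
    intro i j l
    rw [tri_sub, hD, tri_eq_leviCivita η (x s)]
    simp only [leviCivita_self_right, leviCivita_self_outer, leviCivita_self_left, if_true]
    change leviCivita i j l * c s - _ = 0
    fin_cases i <;> fin_cases j <;> fin_cases l <;> simp [leviCivita] <;> norm_num
  have hmixed : ∀ r s, r ≠ s → ∀ i j l,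
      tri (η - lieAction X (baseForm f h)) (x r i) (x s j) (x s l) = 0 := by
    intro r s hrs i j l
    have hsq : ∀ w, leviCivita r w s ^ 2 = if w = -(r + s) then 1 else 0 := fun w => by
      rw [leviCivita_swap, neg_sq, leviCivita_sq hrs]
    have hr : -(s + -(r + s)) = r :=
      (by decide : ∀ a b : Fin 3, -(b + -(a + b)) = a) r s
    have key := hm s (-(r + s)) i j l
    rw [hr] at key
    rw [tri_sub, hD]
    have hw : ∀ G : Fin 3 → Fin 3 → ℂ, ∑ w, ∑ p, (if w = -(r + s) then G w p else 0) =
        ∑ p, G (-(r + s)) p := fun G => by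
      rw [Finset.sum_comm]; simp
    simp only [leviCivita_self_right, leviCivita_sq hrs, hsq, if_neg hrs, ite_mul, one_mul,
      zero_mul, mul_ite, mul_zero, neg_zero, add_zero, zero_pow two_ne_zero,
      Finset.sum_const_zero, if_true, hw, zero_add]
    rw [Finset.sum_add_distrib] at key
    simp only [M]
    simp only [ite_mul, zero_mul] at key
    linear_combination -key
  have hspan : ∀ r s, r ≠ s → ∀ y ∈ Submodule.span ℂ (Set.range (x s)),
      ∀ z ∈ Submodule.span ℂ (Set.range (x s)), ∀ w ∈ Submodule.span ℂ (Set.range (x r)),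
        tri (η - lieAction X (baseForm f h)) y z w = 0 := by
    intro r s hrs y hy z hz w hw
    rw [tri_rotate]
    set ω := tri (η - lieAction X (baseForm f h))
    have h1 : ∀ i j, ω (x r i) (x s j) z = 0 := fun i j => by
      have : Submodule.span ℂ (Set.range (x s)) ≤ LinearMap.ker (ω (x r i) (x s j)) := by
        rw [Submodule.span_le]; rintro _ ⟨l, rfl⟩; exact hmixed r s hrs i j l
      exact this hz
    have h2 : ∀ i, ω (x r i) y z = 0 := fun i => by
      have : Submodule.span ℂ (Set.range (x s)) ≤ LinearMap.ker ((ω (x r i)).flip z) := by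
        rw [Submodule.span_le]; rintro _ ⟨l, rfl⟩; exact h1 i l
      exact this hy
    have : Submodule.span ℂ (Set.range (x r)) ≤ LinearMap.ker ((ω.flip y).flip z) := by
      rw [Submodule.span_le]; rintro _ ⟨l, rfl⟩; exact h2 l
    exact this hw
  exact ⟨X, fun i j hij => isIsotropic_sup (hsame i) (hsame j) (hspan j i hij.symm)
    (hspan i j hij)⟩

variable [FiniteDimensional ℂ V]

/-- The forms admitting an adapted tuple are dense in the space of 3-forms in ten variables. -/
theorem polyFun_eq_zero_of_adaptedPairs (hV : finrank ℂ V = 10) {s : (V [⋀^Fin 3]→ₗ[ℂ] ℂ) → ℂ}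
    (hs : s ∈ polyFun (V [⋀^Fin 3]→ₗ[ℂ] ℂ)) (h0 : ∀ q ∈ adaptedPairs V, s q.2 = 0)
    (α : V [⋀^Fin 3]→ₗ[ℂ] ℂ) : s α = 0 := by
  have hcard : Fintype.card (Option (Fin 3 × Fin 3)) = finrank ℂ V := by rw [hV]; rfl
  let b := (finBasis ℂ V).reindex ((finCongr (hcard.symm)).trans
    (Fintype.equivFin (Option (Fin 3 × Fin 3))).symm)
  obtain ⟨g, hg⟩ := exists_dual_family b.linearIndependent
  let x : Fin 3 → Fin 3 → V := fun i j => b (some (i, j))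
  let v : V := b none
  let f : V →ₗ[ℂ] (Fin 3 × Fin 3 → ℂ) := (LinearMap.funLeft ℂ ℂ some).comp g
  let h : V →ₗ[ℂ] ℂ := (LinearMap.proj none).comp g
  have hf : ∀ i j c, f (x i j) c = if c = (i, j) then 1 else 0 := fun i j c => by
    simp [f, x, hg, LinearMap.funLeft_apply, Pi.single_apply]
  have hx : ∀ i j, h (x i j) = 0 := fun i j => by simp [h, x, hg]
  have hfv : f v = 0 := by ext c; simp [f, v, hg, LinearMap.funLeft_apply]
  have hv : h v = 1 := by simp [h, v, hg]
  set α₀ := baseForm f h with hα₀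
  have hiso₀ : ∀ i j, i ≠ j → IsIsotropic α₀ (side x i j) := by
    intro i j hij
    rw [← span_range_join, isIsotropic_span_iff]
    have hex : ∀ n, ∃ r l, (r = i ∨ r = j) ∧ join (x i) (x j) n = x r l := by
      intro n
      obtain ⟨n, rfl⟩ := (finSumFinEquiv (m := 3) (n := 3)).surjective n
      rcases n with n | n
      · exact ⟨i, n, Or.inl rfl, by simp [join]⟩
      · exact ⟨j, n, Or.inr rfl, by simp [join]⟩
    intro n m w
    obtain ⟨r, l, hr, e⟩ := hex n
    obtain ⟨r', l', hr', e'⟩ := hex m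
    obtain ⟨r'', l'', hr'', e''⟩ := hex w
    rw [e, e', e'', tri_baseForm hf hx]
    rcases hr with rfl | rfl <;> rcases hr' with rfl | rfl <;> rcases hr'' with rfl | rfl <;>
      simp [leviCivita_self_right, leviCivita_self_outer, leviCivita_self_left]
  have hdisc₀ : disc α₀ x ≠ 0 := by
    refine mul_ne_zero ?_ ?_
    · refine linkMatrix_det_ne_zero one_ne_zero fun i j l => ?_
      rw [tri_baseForm hf hx]; simp [leviCivita]; norm_num
    · refine linkMatrix_det_ne_zero (c := 1) one_ne_zero fun i j l => ?_
      rw [tri_baseForm hf hx]; simp [leviCivita]; norm_num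
  refine polyFun_eq_zero_of_curves hs α₀ (fun η => ?_) α
  obtain ⟨X, hX⟩ := exists_isIsotropic_sub_lieAction hf hx hfv hv η
  set ζ := η - lieAction X α₀ with hζ
  have hT : IsPolyMap fun t : ℂ => t := isPolyMap_id
  have hpow : ∀ n : ℕ, (fun t : ℂ => t ^ n) ∈ polyFun ℂ := fun n =>
    polyFun_pow (linear_mem_polyFun LinearMap.id) n
  refine ⟨fun t => lieAction X α₀ + t ^ 1 • lieAction₂ X α₀ + t ^ 2 • α₀.compLinearMap X +
    (ζ + t ^ 1 • lieAction X ζ + t ^ 2 • lieAction₂ X ζ + t ^ 3 • ζ.compLinearMap X), ?_, ?_, ?_⟩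
  · exact (((isPolyMap_const _).add (IsPolyMap.smul (hpow 1) (isPolyMap_const _))).add
      (IsPolyMap.smul (hpow 2) (isPolyMap_const _))).add
      ((((isPolyMap_const _).add (IsPolyMap.smul (hpow 1) (isPolyMap_const _))).add
      (IsPolyMap.smul (hpow 2) (isPolyMap_const _))).add
      (IsPolyMap.smul (hpow 3) (isPolyMap_const _)))
  · simp [hζ]
  · -- the curve is `(α₀ + t ζ) ∘ (1 + t X)`, adapted to `(1 + t X)⁻¹ x` for almost all `t`
    have hcurve : ∀ t : ℂ, α₀ + t • (lieAction X α₀ + t ^ 1 • lieAction₂ X α₀ +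
        t ^ 2 • α₀.compLinearMap X +
        (ζ + t ^ 1 • lieAction X ζ + t ^ 2 • lieAction₂ X ζ + t ^ 3 • ζ.compLinearMap X)) =
        (α₀ + t • ζ).compLinearMap (LinearMap.id + t • X) := by
      intro t
      rw [show (α₀ + t • ζ).compLinearMap (LinearMap.id + t • X) =
        α₀.compLinearMap (LinearMap.id + t • X) + t • ζ.compLinearMap (LinearMap.id + t • X)
        from rfl, compLinearMap_id_add, compLinearMap_id_add]
      module
    have hfin₁ : {t : ℂ | disc (α₀ + t • ζ) x = 0}.Finite :=
      polyFun_finite_zeros (disc_mem_polyFun (isPolyMap_line _ _) (isPolyMap_const _)) (t₀ := 0)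
        (by simpa using hdisc₀)
    have hfin₂ : {t : ℂ | LinearMap.det (LinearMap.id + t • X) = 0}.Finite := by
      refine polyFun_finite_zeros ?_ (t₀ := 0) (by simp)
      have : ∀ t : ℂ, LinearMap.det (LinearMap.id + t • X) =
          (1 + t • LinearMap.toMatrix b b X).det := fun t => by
        rw [← LinearMap.det_toMatrix b]
        simp
      simp only [this]
      refine polyFun_det fun i j => ?_
      simp only [Matrix.add_apply, Matrix.smul_apply, smul_eq_mul]
      exact polyFun_add (const_mem_polyFun _)
        (polyFun_mul (linear_mem_polyFun LinearMap.id) (const_mem_polyFun _))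
    refine (hfin₁.union hfin₂).subset fun t ht => ?_
    by_contra hne
    simp only [Set.mem_union, Set.mem_ofPred_eq, not_or] at hne
    apply ht
    rw [hcurve]
    let e := LinearMap.equivOfDetNeZero (LinearMap.id + t • X) hne.2
    have had : IsAdapted (α₀ + t • ζ) x :=
      ⟨(hiso₀ 0 1 (by decide)).add_smul (hX 0 1 (by decide)) t,
        (hiso₀ 0 2 (by decide)).add_smul (hX 0 2 (by decide)) t, hne.1⟩
    exact h0 (fun i j => e.symm (x i j), _) (had.compLinearMap fun i j => e.apply_symm_apply _)

end Dominance

/-! ### The Zariski topology on powers of Grassmannians -/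

section Topology

variable {E : Type*} [AddCommGroup E] [Module ℂ E]

theorem isOpen_zariski_ne_zero {f : E → ℂ} (hf : f ∈ polyFun E) :
    (zariskiTopology E).IsOpen {x | f x ≠ 0} :=
  TopologicalSpace.GenerateOpen.basic _ ⟨f, hf, rfl⟩

theorem exists_polyFun_of_isOpen_zariski {O : Set E} (hO : (zariskiTopology E).IsOpen O) {x : E}
    (hx : x ∈ O) : ∃ f ∈ polyFun E, f x ≠ 0 ∧ ∀ y, f y ≠ 0 → y ∈ O := by
  change TopologicalSpace.GenerateOpen _ O at hO
  induction hO with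
  | basic U hU =>
    obtain ⟨f, hf, rfl⟩ := hU
    exact ⟨f, hf, hx, fun y hy => hy⟩
  | univ => exact ⟨_, const_mem_polyFun 1, one_ne_zero, fun _ _ => trivial⟩
  | inter U U' _ _ ih ih' =>
    obtain ⟨f, hf, hfx, hfU⟩ := ih hx.1
    obtain ⟨g, hg, hgx, hgU⟩ := ih' hx.2
    exact ⟨_, polyFun_mul hf hg, mul_ne_zero hfx hgx, fun y hy =>
      ⟨hfU y (left_ne_zero_of_mul hy), hgU y (right_ne_zero_of_mul hy)⟩⟩
  | sUnion 𝒰 _ ih =>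
    obtain ⟨U, hU, hxU⟩ := hx
    obtain ⟨f, hf, hfx, hfU⟩ := ih U hU hxU
    exact ⟨f, hf, hfx, fun y hy => ⟨U, hU, hfU y hy⟩⟩

variable {V : Type*} [AddCommGroup V] [Module ℂ V] {k m : ℕ}

theorem GrPow.exists_polyFun_of_isOpen {O : Set (GrPow V k m)} (hO : IsOpen O) {b : Frames V k m}
    (hb : b.span ∈ O) : ∃ f ∈ polyFun (Fin m → Fin k → V), f b.1 ≠ 0 ∧
      ∀ b' : Frames V k m, f b'.1 ≠ 0 → b'.span ∈ O := by
  have h1 : @IsOpen _ (TopologicalSpace.induced Subtype.val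
      (zariskiTopology (Fin m → Fin k → V))) (Frames.span ⁻¹' O) := isOpen_coinduced.1 hO
  obtain ⟨O', hO', e⟩ := (@isOpen_induced_iff _ _ (zariskiTopology (Fin m → Fin k → V)) _ _).1 h1
  obtain ⟨f, hf, hfb, hfO⟩ := exists_polyFun_of_isOpen_zariski hO' (x := b.1)
    (by change b ∈ Subtype.val ⁻¹' O'; rw [e]; exact hb)
  refine ⟨f, hf, hfb, fun b' hb' => ?_⟩
  have : b' ∈ Subtype.val ⁻¹' O' := hfO _ hb'
  rw [e] at this
  exact this

theorem GrPow.isOpen_of_forall_exists_polyFun {O : Set (GrPow V k m)}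
    (h : ∀ b : Frames V k m, b.span ∈ O → ∃ f ∈ polyFun (Fin m → Fin k → V), f b.1 ≠ 0 ∧
      ∀ b' : Frames V k m, f b'.1 ≠ 0 → b'.span ∈ O) : IsOpen O := by
  refine isOpen_coinduced.2 ((@isOpen_induced_iff _ _ (zariskiTopology (Fin m → Fin k → V)) _ _).2
    ⟨⋃₀ {U | (∃ f ∈ polyFun (Fin m → Fin k → V), U = {x | f x ≠ 0}) ∧
      Subtype.val ⁻¹' U ⊆ Frames.span ⁻¹' O}, ?_, ?_⟩)
  · refine TopologicalSpace.GenerateOpen.sUnion _ fun U hU => ?_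
    exact TopologicalSpace.GenerateOpen.basic _ hU.1
  · ext b
    constructor
    · rintro ⟨U, ⟨-, hU⟩, hb⟩
      exact hU hb
    · intro hb
      obtain ⟨f, hf, hfb, hfO⟩ := h b hb
      exact ⟨_, ⟨⟨f, hf, rfl⟩, fun b' hb' => hfO b' hb'⟩, hfb⟩

/-- Polynomial limits of frames give limits in the power of the Grassmannian. -/
theorem GrPow.mem_closure_of_inPolyClosure {S : Set (GrPow V k m)} {S₀ : Set E} {x : E}
    (hx : InPolyClosure S₀ x) {B : E → Fin m → Fin k → V} (hB : IsPolyMap B)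
    (h : ∀ i, LinearIndependent ℂ (B x i))
    (hS : ∀ y ∈ S₀, ∃ h : ∀ i, LinearIndependent ℂ (B y i), Frames.span ⟨B y, h⟩ ∈ S) :
    Frames.span ⟨B x, h⟩ ∈ closure S := by
  rw [mem_closure_iff]
  intro O hO hxO
  obtain ⟨f, hf, hfx, hfO⟩ := GrPow.exists_polyFun_of_isOpen hO hxO
  by_contra hne
  refine hfx (hx _ (polyFun_comp hf hB) fun y hy => ?_)
  by_contra hfy
  obtain ⟨h', hy'⟩ := hS y hy
  exact hne ⟨_, hfO ⟨B y, h'⟩ hfy, hy'⟩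

theorem GrPow.exists_frames [FiniteDimensional ℂ V] (w : GrPow V k m) :
    ∃ b : Frames V k m, b.span = w := by
  let e := fun i => finBasisOfFinrankEq ℂ (w i).1 (w i).2
  refine ⟨⟨fun i j => (e i j : V), fun i => (e i).linearIndependent.map' (w i).1.subtype
    (Submodule.ker_subtype _)⟩, ?_⟩
  funext i
  refine Subtype.ext ?_
  have : (Set.range fun j => (e i j : V)) = (w i).1.subtype '' Set.range (e i) := by
    rw [← Set.range_comp]; rfl
  change Submodule.span ℂ (Set.range fun j => (e i j : V)) = _
  rw [this, Submodule.span_image, (e i).span_eq, Submodule.map_top, Submodule.range_subtype]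

/-- The condition that the members of a tuple of subspaces together span the whole space is
open. -/
theorem GrPow.isOpen_iSup_eq_top [FiniteDimensional ℂ V] :
    IsOpen {w : GrPow V k m | ⨆ i, (w i).1 = ⊤} := by
  refine GrPow.isOpen_of_forall_exists_polyFun fun b hb => ?_
  have hspan : ∀ b : Frames V k m, ⨆ i, (b.span i).1 =
      Submodule.span ℂ (Set.range fun c : Fin m × Fin k => b.1 c.1 c.2) := by
    intro b
    have : (Set.range fun c : Fin m × Fin k => b.1 c.1 c.2) = ⋃ i, Set.range (b.1 i) := by
      ext v; simp
    rw [this, Submodule.span_iUnion]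
    rfl
  rw [Set.mem_ofPred_eq, hspan] at hb
  let e := finBasis ℂ V
  have hA : ∀ i, ∃ A : Fin m × Fin k → ℂ, ∑ c, A c • b.1 c.1 c.2 = e i := fun i =>
    (Submodule.mem_span_range_iff_exists_fun ℂ).1 (hb ▸ Submodule.mem_top)
  choose A hA using hA
  refine ⟨fun b' => (Matrix.of fun i j => e.coord j (∑ c, A i c • b' c.1 c.2)).det,
    polyFun_det fun i j => ?_, ?_, fun b' hb' => ?_⟩
  · exact IsPolyMap.sum _ (fun c _ => IsPolyMap.smul (const_mem_polyFun _)
      ((isPolyMap_id.apply c.1).apply c.2)) (e.coord j)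
  · have : (Matrix.of fun i j => e.coord j (∑ c, A i c • b.1 c.1 c.2)) = 1 := by
      ext i j
      simp only [Matrix.of_apply, hA, Basis.coord_apply, Basis.repr_self, Matrix.one_apply,
        Finsupp.single_apply]
    simp only [this, Matrix.det_one]
    exact one_ne_zero
  · rw [Set.mem_ofPred_eq, hspan]
    have h1 : LinearIndependent ℂ fun i => ∑ c, A i c • b'.1 c.1 c.2 := by
      have h2 := Matrix.linearIndependent_rows_of_det_ne_zero hb'
      refine LinearIndependent.of_comp e.equivFun.toLinearMap ?_
      exact h2
    have h3 := h1.span_eq_top_of_card_eq_finrank' (by simp)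
    rw [eq_top_iff, ← h3, Submodule.span_le]
    rintro _ ⟨i, rfl⟩
    exact sum_mem fun c _ => Submodule.smul_mem _ _ (Submodule.subset_span ⟨c, rfl⟩)

end Topology

/-! ### Solutions of linear systems that are polynomial in frames -/

section Cramer

variable {E : Type*} [AddCommGroup E] [Module ℂ E] {ι : Type*} [Fintype ι] [DecidableEq ι]

/-- The matrix of a linear map on a tuple of vectors. -/
def frameMatrix (Θ : E →ₗ[ℂ] ι → ℂ) (u : ι → E) : Matrix ι ι ℂ := Matrix.of fun j i => Θ (u i) j

/-- The solution in the span of `u` of `Θ v = y`, with denominators cleared. -/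
noncomputable def cramerVector (Θ : E →ₗ[ℂ] ι → ℂ) (u : ι → E) (y : ι → ℂ) : E :=
  ∑ i, ((frameMatrix Θ u).adjugate.mulVec y) i • u i

variable {Θ : E →ₗ[ℂ] ι → ℂ} {u u' : ι → E}

omit [DecidableEq ι] in
theorem apply_sum_eq_mulVec (c : ι → ℂ) : Θ (∑ i, c i • u i) = (frameMatrix Θ u).mulVec c := by
  ext j
  simp [frameMatrix, Matrix.mulVec, dotProduct, mul_comm]

theorem cramerVector_mem (y : ι → ℂ) :
    cramerVector Θ u y ∈ Submodule.span ℂ (Set.range u) :=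
  sum_mem fun i _ => Submodule.smul_mem _ _ (Submodule.subset_span ⟨i, rfl⟩)

theorem apply_cramerVector (y : ι → ℂ) :
    Θ (cramerVector Θ u y) = (frameMatrix Θ u).det • y := by
  rw [cramerVector, apply_sum_eq_mulVec, Matrix.mulVec_mulVec, Matrix.mul_adjugate,
    Matrix.smul_mulVec, Matrix.one_mulVec]

theorem cramerVector_eq {v : E} (hv : v ∈ Submodule.span ℂ (Set.range u)) :
    cramerVector Θ u (Θ v) = (frameMatrix Θ u).det • v := by
  obtain ⟨c, rfl⟩ := (Submodule.mem_span_range_iff_exists_fun ℂ).1 hv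
  rw [apply_sum_eq_mulVec, cramerVector, Matrix.mulVec_mulVec, Matrix.adjugate_mul,
    Matrix.smul_mulVec, Matrix.one_mulVec, Finset.smul_sum]
  simp [smul_smul]

theorem injOn_of_det_frameMatrix_ne_zero (h : (frameMatrix Θ u).det ≠ 0) {v : E}
    (hv : v ∈ Submodule.span ℂ (Set.range u)) (hv0 : Θ v = 0) : v = 0 := by
  have := cramerVector_eq (Θ := Θ) hv
  rw [hv0] at this
  simp only [cramerVector, Matrix.mulVec_zero, Pi.zero_apply, zero_smul,
    Finset.sum_const_zero] at this
  exact (smul_eq_zero.1 this.symm).resolve_left h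

theorem det_frameMatrix_ne_zero (hu : LinearIndependent ℂ u)
    (h : ∀ v ∈ Submodule.span ℂ (Set.range u), Θ v = 0 → v = 0) : (frameMatrix Θ u).det ≠ 0 := by
  intro h0
  obtain ⟨c, hc, hc0⟩ := Matrix.exists_mulVec_eq_zero_iff.2 h0
  rw [← apply_sum_eq_mulVec] at hc0
  exact hc (funext (Fintype.linearIndependent_iff.1 hu c (h _ (sum_mem fun i _ =>
    Submodule.smul_mem _ _ (Submodule.subset_span ⟨i, rfl⟩)) hc0)))

/-- Up to a scalar, the solution depends only on the span of the frame. -/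
theorem cramerVector_change (hu' : LinearIndependent ℂ u')
    (h : Submodule.span ℂ (Set.range u) = Submodule.span ℂ (Set.range u'))
    (hd : (frameMatrix Θ u).det ≠ 0) : (frameMatrix Θ u').det ≠ 0 ∧ ∀ y,
      cramerVector Θ u' y =
        ((frameMatrix Θ u').det * (frameMatrix Θ u).det⁻¹) • cramerVector Θ u y := by
  refine ⟨det_frameMatrix_ne_zero hu' fun v hv => injOn_of_det_frameMatrix_ne_zero hd (h ▸ hv),
    fun y => ?_⟩
  have h1 : Θ ((frameMatrix Θ u).det⁻¹ • cramerVector Θ u y) = y := by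
    rw [map_smul, apply_cramerVector, smul_smul, inv_mul_cancel₀ hd, one_smul]
  conv_lhs => rw [← h1]
  rw [cramerVector_eq (Submodule.smul_mem _ _ (h ▸ cramerVector_mem y)), smul_smul]

variable {P : Type*} [AddCommGroup P] [Module ℂ P]

theorem polyFun_det_frameMatrix {u : P → ι → E} (hu : IsPolyMap u) :
    (fun p => (frameMatrix Θ (u p)).det) ∈ polyFun P :=
  polyFun_det fun j i => (hu.apply i) ((LinearMap.proj j).comp Θ)

theorem isPolyMap_cramerVector {u : P → ι → E} (hu : IsPolyMap u) (y : ι → ℂ) :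
    IsPolyMap (fun p => cramerVector Θ (u p) y) := by
  refine IsPolyMap.sum _ fun i _ => IsPolyMap.smul ?_ (hu.apply i)
  simp only [Matrix.mulVec, dotProduct]
  exact polyFun_sum _ fun j _ => polyFun_mul
    (polyFun_adjugate (fun j i => (hu.apply i) ((LinearMap.proj j).comp Θ)) _ _)
        (const_mem_polyFun _)

end Cramer

/-! ### Adapted tuples that are polynomial in frames of the two subspaces -/

section FrameChart

variable {V : Type*} [AddCommGroup V] [Module ℂ V]

theorem disc_ne_zero_of_smul {α : V [⋀^Fin 3]→ₗ[ℂ] ℂ} {x y : Fin 3 → Fin 3 → V}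
    (h : disc α x ≠ 0) {c₀ c₁ c₂ : ℂ} (hc₀ : c₀ ≠ 0) (hc₁ : c₁ ≠ 0) (hc₂ : c₂ ≠ 0)
    (h₀ : ∀ l, y 0 l = c₀ • x 0 l) (h₁ : ∀ l, y 1 l = c₁ • x 1 l) (h₂ : ∀ l, y 2 l = c₂ • x 2 l) :
    disc α y ≠ 0 := by
  have key : ∀ (s t u : ℂ) (k a b : Fin 3 → V),
      linkMatrix α (fun l => s • k l) (fun l => t • a l) (fun l => u • b l) =
        (s * t * u) • linkMatrix α k a b := by
    intro s t u k a b
    ext r c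
    simp only [linkMatrix, Matrix.of_apply, map_smul, LinearMap.smul_apply, Matrix.smul_apply,
      smul_eq_mul]
    split_ifs <;> ring
  rw [disc, show y 0 = fun l => c₀ • x 0 l from funext h₀,
    show y 1 = fun l => c₁ • x 1 l from funext h₁, show y 2 = fun l => c₂ • x 2 l from funext h₂,
    key, key, Matrix.det_smul, Matrix.det_smul]
  exact mul_ne_zero
    (mul_ne_zero (pow_ne_zero _ (mul_ne_zero (mul_ne_zero hc₀ hc₁) hc₂)) (left_ne_zero_of_mul h))
    (mul_ne_zero (pow_ne_zero _ (mul_ne_zero (mul_ne_zero hc₀ hc₂) hc₁)) (right_ne_zero_of_mul h))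

theorem coord_eq_zero_of_mem_side {x : Fin 3 → Fin 3 → V} {f : V →ₗ[ℂ] (Fin 3 × Fin 3 → ℂ)}
    (hf : ∀ i j c, f (x i j) c = if c = (i, j) then 1 else 0) {i j r : Fin 3} (hi : r ≠ i)
    (hj : r ≠ j) {v : V} (hv : v ∈ side x i j) (l : Fin 3) : f v (r, l) = 0 := by
  have : side x i j ≤ LinearMap.ker ((LinearMap.proj (r, l)).comp f) := by
    refine sup_le ?_ ?_ <;> rw [Submodule.span_le] <;> rintro _ ⟨n, rfl⟩ <;>
      simp [hf, hi, hj]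
  exact this hv

theorem eq_zero_of_coord_eq_zero {x : Fin 3 → Fin 3 → V} {f : V →ₗ[ℂ] (Fin 3 × Fin 3 → ℂ)}
    (hf : ∀ i j c, f (x i j) c = if c = (i, j) then 1 else 0) {v : V}
    (hv : v ∈ Submodule.span ℂ (Set.range (flat x))) (hv0 : f v = 0) : v = 0 := by
  obtain ⟨c, rfl⟩ := (Submodule.mem_span_range_iff_exists_fun ℂ).1 hv
  have : c = 0 := by
    rw [← hv0]
    ext n
    have hfn : ∀ c, f (flat x c) = Pi.single c 1 := fun c => by
      ext n; rw [flat, hf, Pi.single_apply]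
    simp [hfn, Pi.single_apply]
  simp [this]

theorem side_le_span_flat (x : Fin 3 → Fin 3 → V) (i j : Fin 3) :
    side x i j ≤ Submodule.span ℂ (Set.range (flat x)) := by
  refine sup_le ?_ ?_ <;> rw [Submodule.span_le] <;> rintro _ ⟨n, rfl⟩ <;>
    exact Submodule.subset_span ⟨(_, n), rfl⟩

theorem IsAdapted.inf_side_eq_bot {α : V [⋀^Fin 3]→ₗ[ℂ] ℂ} {x : Fin 3 → Fin 3 → V}
    (h : IsAdapted α x) : side x 0 1 ⊓ side x 0 2 ⊓ side x 1 2 = ⊥ := by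
  obtain ⟨f, hf⟩ := h.exists_dual
  rw [eq_bot_iff]
  rintro v ⟨⟨h1, h2⟩, h3⟩
  refine eq_zero_of_coord_eq_zero hf (side_le_span_flat x _ _ h1) ?_
  ext ⟨r, l⟩
  fin_cases r
  · exact coord_eq_zero_of_mem_side hf (by decide) (by decide) h3 l
  · exact coord_eq_zero_of_mem_side hf (by decide) (by decide) h2 l
  · exact coord_eq_zero_of_mem_side hf (by decide) (by decide) h1 l

/-- The twelve vectors of a pair of frames, as vectors of `V × V`. -/
def pairFamily (b : Fin 2 → Fin 6 → V) : Fin 6 ⊕ Fin 6 → V × V :=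
  Sum.elim (LinearMap.inl ℂ V V ∘ b 0) (LinearMap.inr ℂ V V ∘ b 1)

theorem isPolyMap_pairFamily : IsPolyMap (pairFamily (V := V)) := by
  refine isPolyMap_pi fun c => ?_
  rcases c with i | i
  · exact (isPolyMap_linear (LinearMap.inl ℂ V V)).comp ((isPolyMap_id.apply 0).apply i)
  · exact (isPolyMap_linear (LinearMap.inr ℂ V V)).comp ((isPolyMap_id.apply 1).apply i)

theorem span_pairFamily (b : Fin 2 → Fin 6 → V) :
    Submodule.span ℂ (Set.range (pairFamily b)) =
      (Submodule.span ℂ (Set.range (b 0))).prod (Submodule.span ℂ (Set.range (b 1))) := by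
  rw [pairFamily, Set.Sum.elim_range, Set.range_comp, Set.range_comp,
    LinearMap.span_inl_union_inr]

theorem linearIndependent_pairFamily {b : Fin 2 → Fin 6 → V} (hb : ∀ i, LinearIndependent ℂ (b i)) :
    LinearIndependent ℂ (pairFamily b) :=
  linearIndependent_inl_union_inr' (hb 0) (hb 1)

variable (V) in
/-- Linear functionals that single out three vectors in `W₁ ∩ W₂` and three vectors in each of
`W₁`, `W₂`, for generic subspaces `W₁`, `W₂` of dimension six whose intersection has dimension at
least three. The vectors of the intersection are obtained as solutions of `Θ (v, v) = y l`. -/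
structure FrameChart where
  Θ : V × V →ₗ[ℂ] Fin 6 ⊕ Fin 6 → ℂ
  y : Fin 3 → Fin 6 ⊕ Fin 6 → ℂ
  diag : ∀ v, Θ (v, v) ∈ Submodule.span ℂ (Set.range y)
  Θ₁ : Fin 2 → V →ₗ[ℂ] Fin 6 → ℂ
  y₁ : Fin 3 → Fin 6 → ℂ

namespace FrameChart

variable (C : FrameChart V)

/-- The tuple attached by a chart to a pair of frames. -/
noncomputable def tuple (b : Fin 2 → Fin 6 → V) : Fin 3 → Fin 3 → V :=
  ![fun l => (cramerVector C.Θ (pairFamily b) (C.y l)).1,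
    fun l => cramerVector (C.Θ₁ 0) (b 0) (C.y₁ l),
    fun l => cramerVector (C.Θ₁ 1) (b 1) (C.y₁ l)]

/-- The function whose nonvanishing says that the chart is defined at a pair of frames, with value
satisfying the discriminant condition. -/
noncomputable def denom (α : V [⋀^Fin 3]→ₗ[ℂ] ℂ) (b : Fin 2 → Fin 6 → V) : ℂ :=
  (frameMatrix C.Θ (pairFamily b)).det * (frameMatrix (C.Θ₁ 0) (b 0)).det *
    (frameMatrix (C.Θ₁ 1) (b 1)).det * disc α (C.tuple b)

theorem isPolyMap_tuple : IsPolyMap C.tuple := by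
  refine isPolyMap_pi fun i => isPolyMap_pi fun l => ?_
  fin_cases i
  · exact (isPolyMap_cramerVector isPolyMap_pairFamily (C.y l)).fst
  · exact isPolyMap_cramerVector (isPolyMap_id.apply 0) (C.y₁ l)
  · exact isPolyMap_cramerVector (isPolyMap_id.apply 1) (C.y₁ l)

theorem denom_mem_polyFun [FiniteDimensional ℂ V] (α : V [⋀^Fin 3]→ₗ[ℂ] ℂ) :
    C.denom α ∈ polyFun (Fin 2 → Fin 6 → V) :=
  polyFun_mul (polyFun_mul (polyFun_mul (polyFun_det_frameMatrix isPolyMap_pairFamily)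
    (polyFun_det_frameMatrix (isPolyMap_id.apply 0)))
    (polyFun_det_frameMatrix (isPolyMap_id.apply 1)))
    (disc_mem_polyFun (isPolyMap_const α) C.isPolyMap_tuple)

variable {C} {α : V [⋀^Fin 3]→ₗ[ℂ] ℂ}

theorem denom_ne_zero_iff {b : Fin 2 → Fin 6 → V} : C.denom α b ≠ 0 ↔
    (frameMatrix C.Θ (pairFamily b)).det ≠ 0 ∧ (frameMatrix (C.Θ₁ 0) (b 0)).det ≠ 0 ∧
    (frameMatrix (C.Θ₁ 1) (b 1)).det ≠ 0 ∧ disc α (C.tuple b) ≠ 0 := by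
  rw [denom, mul_ne_zero_iff, mul_ne_zero_iff, mul_ne_zero_iff, and_assoc, and_assoc]

/-- Being in the domain of a chart does not depend on the choice of the frames: changing them only
rescales the vectors of the tuple. -/
theorem denom_ne_zero_of_span_eq {b b' : Frames V 6 2} (h : b.span = b'.span)
    (hb : C.denom α b.1 ≠ 0) : C.denom α b'.1 ≠ 0 := by
  have hs : ∀ i, Submodule.span ℂ (Set.range (b.1 i)) = Submodule.span ℂ (Set.range (b'.1 i)) :=
    fun i => congrArg Subtype.val (congrFun h i)
  rw [denom_ne_zero_iff] at hb ⊢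
  obtain ⟨h1, h2, h3, h4⟩ := hb
  have hpair : Submodule.span ℂ (Set.range (pairFamily b.1)) =
      Submodule.span ℂ (Set.range (pairFamily b'.1)) := by
    rw [span_pairFamily, span_pairFamily, hs 0, hs 1]
  have c1 := cramerVector_change (Θ := C.Θ) (u := pairFamily b.1)
      (linearIndependent_pairFamily b'.2) hpair h1
  have c2 := cramerVector_change (Θ := C.Θ₁ 0) (u := b.1 0) (b'.2 0) (hs 0) h2
  have c3 := cramerVector_change (Θ := C.Θ₁ 1) (u := b.1 1) (b'.2 1) (hs 1) h3
  exact ⟨c1.1, c2.1, c3.1, disc_ne_zero_of_smul h4 (mul_ne_zero c1.1 (inv_ne_zero h1))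
    (mul_ne_zero c2.1 (inv_ne_zero h2)) (mul_ne_zero c3.1 (inv_ne_zero h3))
    (fun l => congrArg Prod.fst (c1.2 (C.y l))) (fun l => c2.2 (C.y₁ l)) (fun l => c3.2 (C.y₁ l))⟩

/-- If `dim (W₁ ∩ W₂) ≥ 3`, the diagonal vectors of `W₁ × W₂` are mapped by `Θ` injectively into the
span of the three vectors `y`, hence onto it; so the solutions of `Θ v = y l` are diagonal. -/
theorem cramerVector_mem_inf [FiniteDimensional ℂ V] {b : Fin 2 → Fin 6 → V}
    (hd : (frameMatrix C.Θ (pairFamily b)).det ≠ 0)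
    (hdim : 3 ≤ finrank ℂ (Submodule.span ℂ (Set.range (b 0)) ⊓
      Submodule.span ℂ (Set.range (b 1)) : Submodule ℂ V)) (l : Fin 3) :
    (cramerVector C.Θ (pairFamily b) (C.y l)).1 ∈ Submodule.span ℂ (Set.range (b 0)) ⊓
      Submodule.span ℂ (Set.range (b 1)) := by
  set K := Submodule.span ℂ (Set.range (b 0)) ⊓ Submodule.span ℂ (Set.range (b 1)) with hK
  let T : K →ₗ[ℂ] (Fin 6 ⊕ Fin 6 → ℂ) :=
    (C.Θ.comp (LinearMap.id.prod LinearMap.id)).comp K.subtype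
  have hmem : ∀ v ∈ K, (v, v) ∈ Submodule.span ℂ (Set.range (pairFamily b)) := by
    intro v hv
    rw [span_pairFamily]
    exact ⟨hv.1, hv.2⟩
  have hinj : Function.Injective T := by
    rw [← LinearMap.ker_eq_bot, Submodule.eq_bot_iff]
    intro v hv
    have := injOn_of_det_frameMatrix_ne_zero hd (hmem v v.2) hv
    exact Subtype.ext (Prod.ext_iff.1 this).1
  have hle : LinearMap.range T ≤ Submodule.span ℂ (Set.range C.y) := by
    rintro _ ⟨v, rfl⟩
    exact C.diag v
  have h3 : finrank ℂ (Submodule.span ℂ (Set.range C.y)) ≤ 3 := by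
    have := finrank_range_le_card (R := ℂ) C.y
    rwa [Fintype.card_fin] at this
  have heq := Submodule.eq_of_le_of_finrank_le hle
    (by rw [LinearMap.finrank_range_of_inj hinj]; exact h3.trans hdim)
  have hy : C.y l ∈ LinearMap.range T := heq ▸ Submodule.subset_span ⟨l, rfl⟩
  obtain ⟨v, hv⟩ := hy
  rw [← hv]
  have := cramerVector_eq (Θ := C.Θ) (hmem v v.2)
  change (cramerVector C.Θ (pairFamily b) (C.Θ (v, v))).1 ∈ K
  rw [this]
  exact K.smul_mem _ v.2

/-- Where the chart is defined, it gives adapted tuples of incident pairs of subspaces. -/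
theorem isAdapted_tuple [FiniteDimensional ℂ V] {b : Frames V 6 2} (hb : C.denom α b.1 ≠ 0)
    (hα : b.span ∈ fanoPow α 2)
    (hdim : 3 ≤ finrank ℂ ((b.span 0).1 ⊓ (b.span 1).1 : Submodule ℂ V)) :
    IsAdapted α (C.tuple b.1) ∧ side (C.tuple b.1) 0 1 = (b.span 0).1 ∧
      side (C.tuple b.1) 0 2 = (b.span 1).1 := by
  obtain ⟨h1, -, -, h4⟩ := denom_ne_zero_iff.1 hb
  have hk := cramerVector_mem_inf h1 hdim
  have hle₁ : side (C.tuple b.1) 0 1 ≤ (b.span 0).1 := by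
    refine sup_le ?_ ?_ <;> rw [Submodule.span_le] <;> rintro _ ⟨l, rfl⟩
    · exact (hk l).1
    · exact cramerVector_mem _
  have hle₂ : side (C.tuple b.1) 0 2 ≤ (b.span 1).1 := by
    refine sup_le ?_ ?_ <;> rw [Submodule.span_le] <;> rintro _ ⟨l, rfl⟩
    · exact (hk l).2
    · exact cramerVector_mem _
  have had : IsAdapted α (C.tuple b.1) :=
    ⟨(mem_fano_iff.1 (hα 0)).mono hle₁, (mem_fano_iff.1 (hα 1)).mono hle₂, h4⟩
  refine ⟨had, Submodule.eq_of_le_of_finrank_le hle₁ ?_, Submodule.eq_of_le_of_finrank_le hle₂ ?_⟩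
  · rw [had.finrank_side (by decide), (b.span 0).2]
  · rw [had.finrank_side (by decide), (b.span 1).2]

/-- Every adapted tuple is, up to scalars, the value of a chart. -/
theorem exists_denom_ne_zero {x : Fin 3 → Fin 3 → V} (h : IsAdapted α x) :
    ∃ C : FrameChart V, ∀ b : Frames V 6 2, (b.span 0).1 = side x 0 1 → (b.span 1).1 = side x 0 2 →
      C.denom α b.1 ≠ 0 := by
  obtain ⟨f, hf⟩ := h.exists_dual
  obtain ⟨g₁, hg₁⟩ := exists_dual_family (h.linearIndependent_side (i := 0) (j := 1) (by decide))
  obtain ⟨g₂, hg₂⟩ := exists_dual_family (h.linearIndependent_side (i := 0) (j := 2) (by decide))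
  let σ : Fin 6 ⊕ Fin 6 ≃ Fin 3 ⊕ Fin 3 × Fin 3 := Fintype.equivOfCardEq (by simp)
  let Θ : V × V →ₗ[ℂ] Fin 6 ⊕ Fin 6 → ℂ := (LinearMap.funLeft ℂ ℂ σ).comp (LinearMap.pi (Sum.elim
    (fun l => ((LinearMap.proj (0, l)).comp f).comp (LinearMap.fst ℂ V V))
    (fun c => ((LinearMap.proj c).comp f).comp (LinearMap.fst ℂ V V - LinearMap.snd ℂ V V))))
  have hΘl : ∀ v w l, Θ (v, w) (σ.symm (Sum.inl l)) = f v (0, l) := fun v w l => by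
    simp [Θ, LinearMap.funLeft_apply]
  have hΘr : ∀ v w c, Θ (v, w) (σ.symm (Sum.inr c)) = f (v - w) c := fun v w c => by
    simp [Θ, LinearMap.funLeft_apply]
  have hΘ : ∀ v, Θ (v, v) = ∑ l, f v (0, l) • Θ (x 0 l, x 0 l) := by
    intro v
    ext c
    obtain ⟨c, rfl⟩ := σ.symm.surjective c
    rw [Finset.sum_apply]
    rcases c with l | c
    · simp only [Pi.smul_apply, hΘl, hf, smul_eq_mul]
      simp
    · simp only [Pi.smul_apply, hΘr, sub_self, map_zero, Pi.zero_apply, smul_zero,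
        Finset.sum_const_zero]
  let C : FrameChart V :=
    { Θ := Θ
      y := fun l => Θ (x 0 l, x 0 l)
      diag := fun v => by
        rw [hΘ]
        exact sum_mem fun l _ => Submodule.smul_mem _ _ (Submodule.subset_span ⟨l, rfl⟩)
      Θ₁ := ![g₁, g₂]
      y₁ := fun l => Pi.single (finSumFinEquiv (Sum.inr l) : Fin (3 + 3)) 1 }
  have hjoin : ∀ j l, join (x 0) (x j) (finSumFinEquiv (Sum.inr l) : Fin (3 + 3)) = x j l := by
    intro j l; simp [join]
  refine ⟨C, fun b hb₁ hb₂ => ?_⟩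
  have hs₁ : Submodule.span ℂ (Set.range (b.1 0)) = side x 0 1 := hb₁
  have hs₂ : Submodule.span ℂ (Set.range (b.1 1)) = side x 0 2 := hb₂
  -- the functionals are injective on the subspaces in question
  have hinj₁ : ∀ (g : V →ₗ[ℂ] Fin 6 → ℂ) (j : Fin 3),
      (∀ n, g (join (x 0) (x j) n) = Pi.single n 1) → ∀ v ∈ side x 0 j, g v = 0 → v = 0 := by
    intro g j hg v hv hv0
    rw [← span_range_join] at hv
    obtain ⟨c, rfl⟩ := (Submodule.mem_span_range_iff_exists_fun ℂ).1 hv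
    have : c = 0 := by
      rw [← hv0]
      ext n
      simp [hg, Pi.single_apply]
    simp [this]
  have hdet : (frameMatrix C.Θ (pairFamily b.1)).det ≠ 0 := by
    refine det_frameMatrix_ne_zero (linearIndependent_pairFamily b.2) ?_
    rintro ⟨v, w⟩ hvw h0
    rw [span_pairFamily, hs₁, hs₂] at hvw
    have h0' : Θ (v, w) = 0 := h0
    have hvw0 : v - w = 0 := eq_zero_of_coord_eq_zero hf
      (sub_mem (side_le_span_flat x 0 1 hvw.1) (side_le_span_flat x 0 2 hvw.2)) (by
      ext c; rw [← hΘr, h0']; rfl)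
    obtain rfl : v = w := sub_eq_zero.1 hvw0
    have hv0 : v = 0 := by
      refine eq_zero_of_coord_eq_zero hf (side_le_span_flat x 0 1 hvw.1) ?_
      ext ⟨r, l⟩
      by_cases hr : r = 0
      · rw [hr, ← hΘl v v, h0']; rfl
      by_cases hr1 : r = 1
      · exact coord_eq_zero_of_mem_side hf hr (by rw [hr1]; decide) hvw.2 l
      · exact coord_eq_zero_of_mem_side hf hr hr1 hvw.1 l
    rw [hv0]; rfl
  have hdet₁ : (frameMatrix (C.Θ₁ 0) (b.1 0)).det ≠ 0 :=
    det_frameMatrix_ne_zero (b.2 0) fun v hv => hinj₁ g₁ 1 hg₁ v (hs₁ ▸ hv)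
  have hdet₂ : (frameMatrix (C.Θ₁ 1) (b.1 1)).det ≠ 0 :=
    det_frameMatrix_ne_zero (b.2 1) fun v hv => hinj₁ g₂ 2 hg₂ v (hs₂ ▸ hv)
  refine mul_ne_zero (mul_ne_zero (mul_ne_zero hdet hdet₁) hdet₂) ?_
  have e0 : ∀ l, cramerVector C.Θ (pairFamily b.1) (C.y l) =
      (frameMatrix C.Θ (pairFamily b.1)).det • (x 0 l, x 0 l) := fun l => by
    refine cramerVector_eq ?_
    rw [span_pairFamily, hs₁, hs₂]
    exact ⟨mem_side_left x 0 1 l, mem_side_left x 0 2 l⟩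
  have e1 : ∀ l, cramerVector (C.Θ₁ 0) (b.1 0) (C.y₁ l) =
      (frameMatrix (C.Θ₁ 0) (b.1 0)).det • x 1 l := fun l => by
    have : C.y₁ l = C.Θ₁ 0 (x 1 l) := by
      rw [← hjoin 1 l]; exact (hg₁ _).symm
    rw [this]
    exact cramerVector_eq (hs₁ ▸ mem_side_right x 0 1 l)
  have e2 : ∀ l, cramerVector (C.Θ₁ 1) (b.1 1) (C.y₁ l) =
      (frameMatrix (C.Θ₁ 1) (b.1 1)).det • x 2 l := fun l => by
    have : C.y₁ l = C.Θ₁ 1 (x 2 l) := by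
      rw [← hjoin 2 l]; exact (hg₂ _).symm
    rw [this]
    exact cramerVector_eq (hs₂ ▸ mem_side_right x 0 2 l)
  exact disc_ne_zero_of_smul h.disc_ne hdet hdet₁ hdet₂ (fun l => congrArg Prod.fst (e0 l)) e1 e2

variable (C α) in
/-- The set of pairs of subspaces at which a chart is defined. -/
def domain : Set (GrPow V 6 2) := {w | ∃ b : Frames V 6 2, b.span = w ∧ C.denom α b.1 ≠ 0}

theorem isOpen_domain [FiniteDimensional ℂ V] : IsOpen (C.domain α) := by
  refine GrPow.isOpen_of_forall_exists_polyFun fun b hb => ?_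
  obtain ⟨b', hb', hne⟩ := hb
  exact ⟨_, C.denom_mem_polyFun α, denom_ne_zero_of_span_eq hb' hne, fun b'' h => ⟨b'', rfl, h⟩⟩

theorem span_mem_domain_iff {b : Frames V 6 2} : b.span ∈ C.domain α ↔ C.denom α b.1 ≠ 0 :=
  ⟨fun ⟨_, hb', hne⟩ => denom_ne_zero_of_span_eq hb' hne, fun h => ⟨b, rfl, h⟩⟩

end FrameChart

end FrameChart

/-! ### Generic 3-forms -/

section Generic

variable {V : Type*} [AddCommGroup V] [Module ℂ V] [FiniteDimensional ℂ V]

theorem disc_pair_mem_polyFun : (fun q : (Fin 3 → Fin 3 → V) × (V [⋀^Fin 3]→ₗ[ℂ] ℂ) =>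
    disc q.2 q.1) ∈ polyFun ((Fin 3 → Fin 3 → V) × (V [⋀^Fin 3]→ₗ[ℂ] ℂ)) :=
  disc_mem_polyFun isPolyMap_id.snd isPolyMap_id.fst

theorem isIsotropic_of_inPolyClosure {S : Set ((Fin 3 → Fin 3 → V) × (V [⋀^Fin 3]→ₗ[ℂ] ℂ))}
    {q : (Fin 3 → Fin 3 → V) × (V [⋀^Fin 3]→ₗ[ℂ] ℂ)} (hq : InPolyClosure S q) {i j : Fin 3}
    (hS : ∀ q ∈ S, IsIsotropic q.2 (side q.1 i j)) : IsIsotropic q.2 (side q.1 i j) := by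
  simp only [← span_range_join, isIsotropic_span_iff] at hS ⊢
  intro m n r
  have hx : IsPolyMap fun q : (Fin 3 → Fin 3 → V) × (V [⋀^Fin 3]→ₗ[ℂ] ℂ) => q.1 :=
    isPolyMap_id.fst
  have hj := isPolyMap_join (hx.apply i) (hx.apply j)
  exact hq _ (tri_mem_polyFun isPolyMap_id.snd (hj.apply m) (hj.apply n)
    (hj.apply r)) fun q hq => hS q hq m n r

/-- For a generic form, the adapted tuples are dense in the fibre of the closure of the family of
adapted tuples. -/
theorem exists_generic_adaptedPairs :
    ∃ s ∈ polyFun (V [⋀^Fin 3]→ₗ[ℂ] ℂ), (∃ α, s α ≠ 0) ∧ ∀ α, s α ≠ 0 → ∀ x,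
      InPolyClosure (adaptedPairs V) (x, α) → InPolyClosure {x' | IsAdapted α x'} x :=
  exists_generic_dense (adaptedPairs V) _ disc_pair_mem_polyFun (fun _ hq => hq.disc_ne)
    fun _ hq hd => ⟨isIsotropic_of_inPolyClosure hq fun _ h => h.iso₁,
      isIsotropic_of_inPolyClosure hq fun _ h => h.iso₂, hd⟩

/-- For a generic form, the adapted triangles are dense in the fibre of the closure of the family
of adapted triangles. -/
theorem exists_generic_adaptedTriangles :
    ∃ s ∈ polyFun (V [⋀^Fin 3]→ₗ[ℂ] ℂ), (∃ α, s α ≠ 0) ∧ ∀ α, s α ≠ 0 → ∀ x,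
      InPolyClosure (adaptedTriangles V) (x, α) →
        InPolyClosure {x' | IsAdapted α x' ∧ IsIsotropic α (side x' 1 2)} x :=
  exists_generic_dense (adaptedTriangles V) _ disc_pair_mem_polyFun (fun _ hq => hq.1.disc_ne)
    fun _ hq hd => ⟨⟨isIsotropic_of_inPolyClosure hq fun _ h => h.1.iso₁,
      isIsotropic_of_inPolyClosure hq fun _ h => h.1.iso₂, hd⟩,
      isIsotropic_of_inPolyClosure hq fun _ h => h.2⟩

theorem InPolyClosure.nonempty {E : Type*} [AddCommGroup E] [Module ℂ E] {S : Set E} {p : E}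
    (h : InPolyClosure S p) : S.Nonempty := by
  by_contra hne
  rw [Set.not_nonempty_iff_eq_empty] at hne
  exact one_ne_zero (h _ (const_mem_polyFun 1) fun q hq => by rw [hne] at hq; exact hq.elim)

/-- A generic form in ten variables has adapted tuples. -/
theorem exists_generic_isAdapted (hV : finrank ℂ V = 10) :
    ∃ s ∈ polyFun (V [⋀^Fin 3]→ₗ[ℂ] ℂ), (∃ α, s α ≠ 0) ∧ ∀ α, s α ≠ 0 →
      ∃ x, InPolyClosure (adaptedPairs V) (x, α) :=
  exists_generic_nonempty (adaptedPairs V) fun _ hs h0 α =>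
    polyFun_eq_zero_of_adaptedPairs hV hs h0 α

end Generic

/-! ### The incidence variety and the open triangle variety -/

section Triangles

variable {V : Type*} [AddCommGroup V] [Module ℂ V]

/-- The pairs of 6-dimensional subspaces which are the sides of an adapted tuple. -/
def adaptedSides (α : V [⋀^Fin 3]→ₗ[ℂ] ℂ) : Set (GrPow V 6 2) :=
  {w | ∃ x, IsAdapted α x ∧ (w 0).1 = side x 0 1 ∧ (w 1).1 = side x 0 2}

variable {α : V [⋀^Fin 3]→ₗ[ℂ] ℂ}

theorem adaptedSides_subset_incidence [FiniteDimensional ℂ V] : adaptedSides α ⊆ incidence α := by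
  rintro w ⟨x, hx, h0, h1⟩
  have hw : w ∈ fanoPow α 2 := fun i => by
    rw [mem_fano_iff]
    fin_cases i
    · exact h0 ▸ hx.iso₁
    · exact h1 ▸ hx.iso₂
  refine ⟨hw, subset_closure ⟨hw, ?_, fun hne => ?_⟩⟩
  · refine ⟨⟨Submodule.span ℂ (Set.range (x 0)), ?_⟩, ?_, ?_⟩
    · rw [finrank_span_eq_card (hx.linearIndependent_row 0)]; rfl
    · change _ ≤ (w 0).1
      rw [h0]; exact le_sup_left
    · change _ ≤ (w 1).1
      rw [h1]; exact le_sup_left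
  · have heq : side x 0 1 = side x 0 2 := by rw [← h0, ← h1, hne]
    have hbot := hx.inf_side_eq_bot
    rw [heq, inf_idem, eq_bot_iff] at hbot
    have : x 2 0 = 0 := hbot ⟨mem_side_right x 0 2 0, mem_side_right x 1 2 0⟩
    exact (hx.linearIndependent_row 2).ne_zero 0 this

variable [FiniteDimensional ℂ V]

/-- In dimension ten, `dim (W₁ ∩ W₂) ≥ 3` means that `W₁ + W₂` is not the whole space, a closed
condition, so it persists on the closure. -/
theorem three_le_finrank_of_mem_incidence (hV : finrank ℂ V = 10) {w : GrPow V 6 2}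
    (hw : w ∈ incidence α) : 3 ≤ finrank ℂ ((w 0).1 ⊓ (w 1).1 : Submodule ℂ V) := by
  have hiSup : ∀ w : GrPow V 6 2, ⨆ i, (w i).1 = (w 0).1 ⊔ (w 1).1 := fun w =>
    le_antisymm (iSup_le fun i => by fin_cases i; exacts [le_sup_left, le_sup_right])
      (sup_le (le_iSup (fun i => (w i).1) 0) (le_iSup (fun i => (w i).1) 1))
  have hdim : ∀ w : GrPow V 6 2, finrank ℂ ((w 0).1 ⊔ (w 1).1 : Submodule ℂ V) +
      finrank ℂ ((w 0).1 ⊓ (w 1).1 : Submodule ℂ V) = 12 := fun w => by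
    rw [Submodule.finrank_sup_add_finrank_inf_eq, (w 0).2, (w 1).2]
  have hclosed : IsClosed {w : GrPow V 6 2 | ⨆ i, (w i).1 = ⊤}ᶜ :=
    GrPow.isOpen_iSup_eq_top.isClosed_compl
  have hmem := closure_minimal ?_ hclosed hw.2
  · have hne : (w 0).1 ⊔ (w 1).1 ≠ ⊤ := fun h => hmem ((hiSup w).trans h)
    have := Submodule.finrank_lt hne
    have := hdim w
    omega
  · rintro w ⟨-, ⟨K, hK₀, hK₁⟩, -⟩ htop
    have htop' : (w 0).1 ⊔ (w 1).1 = ⊤ := (hiSup w).symm.trans htop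
    have h1 := Submodule.finrank_mono (le_inf hK₀ hK₁ : K.1 ≤ (w 0).1 ⊓ (w 1).1)
    have h2 := hdim w
    rw [htop', finrank_top, hV] at h2
    rw [K.2] at h1
    omega

/-- The set of pairs of adapted sides is covered by the domains of the charts. -/
theorem exists_isOpen_adaptedSides (hV : finrank ℂ V = 10) :
    ∃ O : Set (GrPow V 6 2), IsOpen O ∧ adaptedSides α = incidence α ∩ O := by
  refine ⟨⋃ C : FrameChart V, C.domain α, isOpen_iUnion fun C => FrameChart.isOpen_domain, ?_⟩
  refine Set.Subset.antisymm (fun w hw => ⟨adaptedSides_subset_incidence hw, ?_⟩) ?_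
  · obtain ⟨x, hx, h0, h1⟩ := hw
    obtain ⟨C, hC⟩ := FrameChart.exists_denom_ne_zero hx
    obtain ⟨b, rfl⟩ := GrPow.exists_frames w
    exact Set.mem_iUnion.2 ⟨C, b, rfl, hC b h0 h1⟩
  · rintro w ⟨hw, hO⟩
    obtain ⟨C, b, rfl, hb⟩ := Set.mem_iUnion.1 hO
    obtain ⟨had, h1, h2⟩ :=
      FrameChart.isAdapted_tuple hb hw.1 (three_le_finrank_of_mem_incidence hV hw)
    exact ⟨_, had, h1.symm, h2.symm⟩

omit [FiniteDimensional ℂ V] in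
theorem linearIndependent_join_of_side_eq {x : Fin 3 → Fin 3 → V} {i j : Fin 3} {W : Gr V 6}
    (h : side x i j = W.1) : LinearIndependent ℂ (join (x i) (x j)) := by
  rw [linearIndependent_iff_card_eq_finrank_span, Fintype.card_fin]
  have : finrank ℂ (Submodule.span ℂ (Set.range (join (x i) (x j)))) = 6 := by
    rw [span_range_join, h, W.2]
  exact this.symm

/-- For a form satisfying the conclusion of `exists_generic_dense`, the pairs of adapted sides are
dense in the incidence variety. -/
theorem incidence_subset_closure (hV : finrank ℂ V = 10)
    (hα : ∀ x, InPolyClosure (adaptedPairs V) (x, α) → InPolyClosure {x' | IsAdapted α x'} x) :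
    incidence α ⊆ closure (adaptedSides α) := by
  refine Set.inter_subset_right.trans (closure_minimal ?_ isClosed_closure)
  rintro w ⟨hw, ⟨K, hK₀, hK₁⟩, hne⟩
  have hdim := Submodule.finrank_mono (le_inf hK₀ hK₁ : K.1 ≤ (w 0).1 ⊓ (w 1).1)
  rw [K.2] at hdim
  obtain ⟨x, h₁, h₂, hx⟩ := exists_lift hV (w 0).2 (w 1).2 (mem_fano_iff.1 (hw 0))
    (mem_fano_iff.1 (hw 1)) (fun h => hne (Subtype.ext h)) hdim
  let B : (Fin 3 → Fin 3 → V) → Fin 2 → Fin 6 → V := fun x => ![join (x 0) (x 1), join (x 0) (x 2)]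
  have hB : IsPolyMap B := by
    refine isPolyMap_pi fun i => ?_
    fin_cases i
    · exact isPolyMap_join (isPolyMap_id.apply 0) (isPolyMap_id.apply 1)
    · exact isPolyMap_join (isPolyMap_id.apply 0) (isPolyMap_id.apply 2)
  have hLI : ∀ i, LinearIndependent ℂ (B x i) := fun i => by
    fin_cases i
    exacts [linearIndependent_join_of_side_eq h₁, linearIndependent_join_of_side_eq h₂]
  have hspan : Frames.span ⟨B x, hLI⟩ = w := by
    funext i
    refine Subtype.ext ?_
    fin_cases i
    exacts [(span_range_join x 0 1).trans h₁, (span_range_join x 0 2).trans h₂]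
  rw [← hspan]
  refine GrPow.mem_closure_of_inPolyClosure (hα x hx) hB hLI fun x' hx' =>
      ⟨fun i => ?_, x', hx', ?_, ?_⟩
  · fin_cases i
    exacts [hx'.linearIndependent_side (by decide), hx'.linearIndependent_side (by decide)]
  · exact span_range_join x' 0 1
  · exact span_range_join x' 0 2

theorem sup_eq_of_inf_eq_bot {A B W : Submodule ℂ V} (hW : finrank ℂ W = 6) (hA : A ≤ W)
    (hB : B ≤ W) (hA3 : 3 ≤ finrank ℂ A) (hB3 : 3 ≤ finrank ℂ B) (hAB : A ⊓ B = ⊥) :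
    finrank ℂ A = 3 ∧ finrank ℂ B = 3 ∧ A ⊔ B = W := by
  have h1 := Submodule.finrank_sup_add_finrank_inf_eq A B
  rw [hAB, finrank_bot] at h1
  have h2 := Submodule.finrank_mono (sup_le hA hB)
  exact ⟨by omega, by omega, Submodule.eq_of_le_of_finrank_le (sup_le hA hB) (by omega)⟩

/-- A triangle of 6-dimensional subspaces is determined by nine vectors, three for each of the
pairwise intersections. -/
theorem exists_side_eq {w : GrPow V 6 3} (hw : w ∈ openTriangles α) :
    ∃ x : Fin 3 → Fin 3 → V, LinearIndependent ℂ (flat x) ∧ side x 0 1 = (w 0).1 ∧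
      side x 0 2 = (w 1).1 ∧ side x 1 2 = (w 2).1 := by
  obtain ⟨-, hdim, hbot⟩ := hw
  rw [Submodule.finrank_eq_zero] at hbot
  obtain ⟨d01, d02, e0⟩ := sup_eq_of_inf_eq_bot (A := (w 0).1 ⊓ (w 1).1) (B := (w 0).1 ⊓ (w 2).1)
    (w 0).2 inf_le_left inf_le_left (hdim 0 1) (hdim 0 2)
    (by rw [← inf_inf_distrib_left, ← inf_assoc, hbot])
  obtain ⟨-, d12, e1⟩ := sup_eq_of_inf_eq_bot (A := (w 0).1 ⊓ (w 1).1) (B := (w 1).1 ⊓ (w 2).1)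
    (w 1).2 inf_le_right inf_le_left (hdim 0 1) (hdim 1 2)
    (by rw [inf_assoc, ← inf_assoc (w 1).1, inf_idem, ← inf_assoc, hbot])
  obtain ⟨-, -, e2⟩ := sup_eq_of_inf_eq_bot (A := (w 0).1 ⊓ (w 2).1) (B := (w 1).1 ⊓ (w 2).1)
    (w 2).2 inf_le_right inf_le_right (hdim 0 2) (hdim 1 2)
    (by rw [← inf_inf_distrib_right, hbot])
  obtain ⟨k, -, hk⟩ := exists_sup_span_eq (K := ⊥) (W := (w 0).1 ⊓ (w 1).1) bot_le 3 (by simp [d01])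
  obtain ⟨a, -, ha⟩ := exists_sup_span_eq (K := ⊥) (W := (w 0).1 ⊓ (w 2).1) bot_le 3 (by simp [d02])
  obtain ⟨b, -, hb⟩ := exists_sup_span_eq (K := ⊥) (W := (w 1).1 ⊓ (w 2).1) bot_le 3 (by simp [d12])
  rw [bot_sup_eq] at hk ha hb
  have h0 : side ![k, a, b] 0 1 = (w 0).1 := by rw [← e0, ← hk, ← ha]; rfl
  have h1 : side ![k, a, b] 0 2 = (w 1).1 := by rw [← e1, ← hk, ← hb]; rfl
  have h2 : side ![k, a, b] 1 2 = (w 2).1 := by rw [← e2, ← ha, ← hb]; rfl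
  refine ⟨![k, a, b], linearIndependent_flat (S := (w 0).1 ⊔ (w 1).1) ?_ ?_, h0, h1, h2⟩
  · have := Submodule.finrank_sup_add_finrank_inf_eq (w 0).1 (w 1).1
    rw [(w 0).2, (w 1).2] at this
    omega
  · rw [← h0, ← h1]
    exact sup_le le_sup_left (sup_le (le_sup_left.trans le_sup_left) le_sup_right)

theorem π₁₂_mem_incidence {w : GrPow V 6 3} (hw : w ∈ openTriangles α) : π₁₂ w ∈ incidence α := by
  have hfano : π₁₂ w ∈ fanoPow α 2 := fun i => hw.1 _
  refine ⟨hfano, subset_closure ⟨hfano, ?_, fun h => ?_⟩⟩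
  · have hbot := Submodule.finrank_eq_zero.1 hw.2.2
    obtain ⟨d, -⟩ := sup_eq_of_inf_eq_bot (A := (w 0).1 ⊓ (w 1).1) (B := (w 0).1 ⊓ (w 2).1)
      (w 0).2 inf_le_left inf_le_left (hw.2.1 0 1) (hw.2.1 0 2)
      (by rw [← inf_inf_distrib_left, ← inf_assoc, hbot])
    exact ⟨⟨_, d⟩, (inf_le_left : (w 0).1 ⊓ (w 1).1 ≤ (w 0).1),
      (inf_le_right : (w 0).1 ⊓ (w 1).1 ≤ (w 1).1)⟩
  · have h' : w 0 = w 1 := h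
    have h0 := hw.2.2
    have h3 := hw.2.1 0 2
    rw [← h', inf_idem] at h0
    omega

/-- For a form satisfying the conclusion of `exists_generic_dense`, the triangles over pairs of
adapted sides are dense in the variety of triangles. -/
theorem openTriangles_subset_closure
    (hα : ∀ x, InPolyClosure (adaptedTriangles V) (x, α) →
      InPolyClosure {x' | IsAdapted α x' ∧ IsIsotropic α (side x' 1 2)} x) :
    openTriangles α ⊆ closure (openTriangles α ∩ π₁₂ ⁻¹' adaptedSides α) := by
  intro w hw
  obtain ⟨x, hLI, h0, h1, h2⟩ := exists_side_eq hw
  have hx := inPolyClosure_triangles hLI (h0 ▸ mem_fano_iff.1 (hw.1 0))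
    (h1 ▸ mem_fano_iff.1 (hw.1 1)) (h2 ▸ mem_fano_iff.1 (hw.1 2))
  let B : (Fin 3 → Fin 3 → V) → Fin 3 → Fin 6 → V := fun x =>
    ![join (x 0) (x 1), join (x 0) (x 2), join (x 1) (x 2)]
  have hB : IsPolyMap B := by
    refine isPolyMap_pi fun i => ?_
    fin_cases i
    · exact isPolyMap_join (isPolyMap_id.apply 0) (isPolyMap_id.apply 1)
    · exact isPolyMap_join (isPolyMap_id.apply 0) (isPolyMap_id.apply 2)
    · exact isPolyMap_join (isPolyMap_id.apply 1) (isPolyMap_id.apply 2)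
  have hBLI : ∀ i, LinearIndependent ℂ (B x i) := fun i => by
    fin_cases i
    exacts [linearIndependent_join_of_side_eq h0, linearIndependent_join_of_side_eq h1,
      linearIndependent_join_of_side_eq h2]
  have hspan : Frames.span ⟨B x, hBLI⟩ = w := by
    funext i
    refine Subtype.ext ?_
    fin_cases i
    exacts [(span_range_join x 0 1).trans h0, (span_range_join x 0 2).trans h1,
      (span_range_join x 1 2).trans h2]
  rw [← hspan]
  refine GrPow.mem_closure_of_inPolyClosure (hα x hx) hB hBLI fun x' ⟨hx', hiso⟩ => ?_
  have hLI' : ∀ i, LinearIndependent ℂ (B x' i) := fun i => by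
    fin_cases i
    exacts [hx'.linearIndependent_side (by decide), hx'.linearIndependent_side (by decide),
      hx'.linearIndependent_side (by decide)]
  set w' := Frames.span ⟨B x', hLI'⟩ with hw'
  have e0 : (w' 0).1 = side x' 0 1 := span_range_join x' 0 1
  have e1 : (w' 1).1 = side x' 0 2 := span_range_join x' 0 2
  have e2 : (w' 2).1 = side x' 1 2 := span_range_join x' 1 2
  refine ⟨hLI', ⟨⟨fun i => ?_, ?_, ?_⟩, x', hx', e0, e1⟩⟩
  · rw [mem_fano_iff]
    fin_cases i
    · exact e0 ▸ hx'.iso₁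
    · exact e1 ▸ hx'.iso₂
    · exact e2 ▸ hiso
  · have hrow : ∀ (r : Fin 3) (A A' : Submodule ℂ V), (∀ l, x' r l ∈ A) → (∀ l, x' r l ∈ A') →
        3 ≤ finrank ℂ (A ⊓ A' : Submodule ℂ V) := fun r A A' h h' =>
      le_finrank_of_linearIndependent (hx'.linearIndependent_row r) fun l => ⟨h l, h' l⟩
    have m00 : ∀ l, x' 0 l ∈ (w' 0).1 := fun l => e0 ▸ mem_side_left x' 0 1 l
    have m10 : ∀ l, x' 1 l ∈ (w' 0).1 := fun l => e0 ▸ mem_side_right x' 0 1 l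
    have m01 : ∀ l, x' 0 l ∈ (w' 1).1 := fun l => e1 ▸ mem_side_left x' 0 2 l
    have m21 : ∀ l, x' 2 l ∈ (w' 1).1 := fun l => e1 ▸ mem_side_right x' 0 2 l
    have m12 : ∀ l, x' 1 l ∈ (w' 2).1 := fun l => e2 ▸ mem_side_left x' 1 2 l
    have m22 : ∀ l, x' 2 l ∈ (w' 2).1 := fun l => e2 ▸ mem_side_right x' 1 2 l
    intro i j
    fin_cases i <;> fin_cases j
    exacts [hrow 0 _ _ m00 m00, hrow 0 _ _ m00 m01, hrow 1 _ _ m10 m12, hrow 0 _ _ m01 m00,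
      hrow 0 _ _ m01 m01, hrow 2 _ _ m21 m22, hrow 1 _ _ m12 m10, hrow 2 _ _ m22 m21,
      hrow 1 _ _ m12 m12]
  · rw [e0, e1, e2, hx'.inf_side_eq_bot, finrank_bot]

end Triangles

/-! ### The inverse of the projection -/

section Inverse

variable {V : Type*} [AddCommGroup V] [Module ℂ V] [FiniteDimensional ℂ V]
  {α : V [⋀^Fin 3]→ₗ[ℂ] ℂ}

theorem isPolyMap_thirdFrame {E : Type*} [AddCommGroup E] [Module ℂ E]
    {x : E → Fin 3 → Fin 3 → V} (hx : IsPolyMap x) : IsPolyMap (fun e => thirdFrame α (x e)) :=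
  isPolyMap_join
    (isPolyMap_linkSolution (isPolyMap_const α) (hx.apply 0) (hx.apply 1) (hx.apply 2))
    (isPolyMap_linkSolution (isPolyMap_const α) (hx.apply 0) (hx.apply 2) (hx.apply 1))

open Classical in
/-- The third vertex of the triangle on a pair of adapted sides; outside of the set of pairs of
adapted sides the value is arbitrary. -/
noncomputable def thirdPoint (α : V [⋀^Fin 3]→ₗ[ℂ] ℂ) (w : GrPow V 6 2) : Gr V 6 :=
  if h : w ∈ adaptedSides α then ⟨thirdVertex α h.choose, h.choose_spec.1.finrank_thirdVertex⟩
  else w 0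

theorem thirdPoint_eq {w : GrPow V 6 2} {x : Fin 3 → Fin 3 → V} (hx : IsAdapted α x)
    (h0 : (w 0).1 = side x 0 1) (h1 : (w 1).1 = side x 0 2) :
    (thirdPoint α w).1 = thirdVertex α x := by
  have h : w ∈ adaptedSides α := ⟨x, hx, h0, h1⟩
  obtain ⟨hy, g0, g1⟩ := h.choose_spec
  have e0 : side x 0 1 = side h.choose 0 1 := h0.symm.trans g0
  have e1 : side x 0 2 = side h.choose 0 2 := h1.symm.trans g1
  rw [thirdPoint, dif_pos h]
  refine hx.eq_thirdVertex hy.finrank_thirdVertex hy.isIsotropic_thirdVertex ?_ ?_ ?_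
  · rw [e0]; exact hy.le_finrank_inf₁
  · rw [e1]; exact hy.le_finrank_inf₂
  · rw [e0, e1]; exact hy.side_inf_thirdVertex

variable (α) in
/-- The triangle on a pair of adapted sides. -/
noncomputable def triangle (w : GrPow V 6 2) : GrPow V 6 3 := ![w 0, w 1, thirdPoint α w]

omit [FiniteDimensional ℂ V] in
theorem π₁₂_triangle (w : GrPow V 6 2) : π₁₂ (triangle α w) = w := by
  funext i
  fin_cases i <;> rfl

theorem triangle_mem_openTriangles {w : GrPow V 6 2} (hw : w ∈ adaptedSides α) :
    triangle α w ∈ openTriangles α := by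
  obtain ⟨x, hx, h0, h1⟩ := hw
  have h2 := thirdPoint_eq hx h0 h1
  have e0 : (triangle α w 0).1 = side x 0 1 := h0
  have e1 : (triangle α w 1).1 = side x 0 2 := h1
  have e2 : (triangle α w 2).1 = thirdVertex α x := h2
  refine ⟨fun i => ?_, fun i j => ?_, ?_⟩
  · rw [mem_fano_iff]
    fin_cases i
    · exact e0 ▸ hx.iso₁
    · exact e1 ▸ hx.iso₂
    · exact e2 ▸ hx.isIsotropic_thirdVertex
  · have hself : ∀ W : Gr V 6, 3 ≤ finrank ℂ (W.1 ⊓ W.1 : Submodule ℂ V) := fun W => by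
      rw [inf_idem, W.2]; norm_num
    have h01 : 3 ≤ finrank ℂ ((triangle α w 0).1 ⊓ (triangle α w 1).1 : Submodule ℂ V) := by
      rw [e0, e1]; exact hx.le_finrank_inf
    have h02 : 3 ≤ finrank ℂ ((triangle α w 0).1 ⊓ (triangle α w 2).1 : Submodule ℂ V) := by
      rw [e0, e2]; exact hx.le_finrank_inf₁
    have h12 : 3 ≤ finrank ℂ ((triangle α w 1).1 ⊓ (triangle α w 2).1 : Submodule ℂ V) := by
      rw [e1, e2]; exact hx.le_finrank_inf₂
    fin_cases i <;> fin_cases j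
    exacts [hself _, h01, h02, inf_comm (triangle α w 0).1 _ ▸ h01, hself _, h12,
      inf_comm (triangle α w 0).1 _ ▸ h02, inf_comm (triangle α w 1).1 _ ▸ h12, hself _]
  · rw [e0, e1, e2, hx.side_inf_thirdVertex, finrank_bot]

/-- A triangle over a pair of adapted sides is the one constructed from them. -/
theorem eq_triangle {q : GrPow V 6 3} (hq : q ∈ openTriangles α)
    (hw : π₁₂ q ∈ adaptedSides α) : triangle α (π₁₂ q) = q := by
  obtain ⟨x, hx, h0, h1⟩ := hw
  have e0 : (q 0).1 = side x 0 1 := h0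
  have e1 : (q 1).1 = side x 0 2 := h1
  funext i
  fin_cases i
  · rfl
  · rfl
  · refine Subtype.ext ((thirdPoint_eq hx h0 h1).trans (Eq.symm ?_))
    refine hx.eq_thirdVertex (q 2).2 (mem_fano_iff.1 (hq.1 2)) ?_ ?_ ?_
    · rw [← e0]; exact hq.2.1 0 2
    · rw [← e1]; exact hq.2.1 1 2
    · rw [← e0, ← e1]; exact Submodule.finrank_eq_zero.1 hq.2.2

/-- Near a pair of adapted sides the third vertex has a frame which is polynomial in frames of the
sides. -/
theorem exists_polynomial_thirdPoint (hV : finrank ℂ V = 10) {w : GrPow V 6 2}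
    (hw : w ∈ adaptedSides α) : ∃ N : Set (GrPow V 6 2), IsOpen N ∧ w ∈ N ∧
      ∃ B : (Fin 2 → Fin 6 → V) → Fin 6 → V, IsPolyMap B ∧
        ∀ b : Frames V 6 2, b.span ∈ adaptedSides α ∩ N → LinearIndependent ℂ (B b.1) ∧
          Submodule.span ℂ (Set.range (B b.1)) = (thirdPoint α b.span).1 := by
  obtain ⟨x, hx, h0, h1⟩ := hw
  obtain ⟨C, hC⟩ := FrameChart.exists_denom_ne_zero hx
  refine ⟨C.domain α, FrameChart.isOpen_domain, ?_, _, isPolyMap_thirdFrame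
      (α := α) C.isPolyMap_tuple,
    fun b hb => ?_⟩
  · obtain ⟨b, rfl⟩ := GrPow.exists_frames w
    exact FrameChart.span_mem_domain_iff.2 (hC b h0 h1)
  · have hinc := adaptedSides_subset_incidence hb.1
    obtain ⟨had, e0, e1⟩ := FrameChart.isAdapted_tuple (FrameChart.span_mem_domain_iff.1 hb.2)
      hinc.1 (three_le_finrank_of_mem_incidence hV hinc)
    exact ⟨had.linearIndependent_thirdFrame, (thirdPoint_eq had e0.symm e1.symm).symm⟩

theorem isRegularOn_triangle (hV : finrank ℂ V = 10) :
    IsRegularOn (triangle α) (adaptedSides α) := by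
  intro w hw
  obtain ⟨N, hN, hwN, B, hB, h⟩ := exists_polynomial_thirdPoint hV hw
  refine ⟨N, hN, hwN, fun b => ![b 0, b 1, B b], ?_, fun b hb => ⟨fun i => ?_, ?_⟩⟩
  · refine isPolyMap_pi fun i => ?_
    fin_cases i
    exacts [isPolyMap_id.apply 0, isPolyMap_id.apply 1, hB]
  · fin_cases i
    exacts [b.2 0, b.2 1, (h b hb).1]
  · funext i
    refine Subtype.ext ?_
    fin_cases i
    exacts [rfl, rfl, (h b hb).2]

theorem isRegularOn_π₃_triangle (hV : finrank ℂ V = 10) :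
    IsRegularOn (fun w => π₃ (triangle α w)) (adaptedSides α) := by
  intro w hw
  obtain ⟨N, hN, hwN, B, hB, h⟩ := exists_polynomial_thirdPoint hV hw
  refine ⟨N, hN, hwN, fun b => ![B b], ?_, fun b hb => ⟨fun i => ?_, ?_⟩⟩
  · refine isPolyMap_pi fun i => ?_
    fin_cases i
    exact hB
  · fin_cases i
    exact (h b hb).1
  · funext i
    refine Subtype.ext ?_
    fin_cases i
    exact (h b hb).2

omit [FiniteDimensional ℂ V] in
theorem isRegularOn_π₁₂ (S : Set (GrPow V 6 3)) : IsRegularOn π₁₂ S := fun _ _ =>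
  ⟨Set.univ, isOpen_univ, trivial, fun b i => b (![0, 1] i),
    isPolyMap_pi fun _ => isPolyMap_id.apply _, fun b _ => ⟨fun _ => b.2 _, rfl⟩⟩

end Inverse

end DebarreVoisin

open DebarreVoisin

theorem mainTheorem3 {V : Type*} [AddCommGroup V] [Module ℂ V] (hV : Module.finrank ℂ V = 10) :
    ∃ G : Set (V [⋀^Fin 3]→ₗ[ℂ] ℂ),
      (DebarreVoisin.zariskiTopology (V [⋀^Fin 3]→ₗ[ℂ] ℂ)).IsOpen G ∧ G.Nonempty ∧
      ∀ α ∈ G,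
        DebarreVoisin.HasDegree DebarreVoisin.π₁₂
          (DebarreVoisin.openTriangles α) (DebarreVoisin.incidence α) 1 ∧
        ∃ (ψ : DebarreVoisin.RationalMap (DebarreVoisin.incidence α)
                (DebarreVoisin.openTriangles α))
          (φ : DebarreVoisin.RationalMap (DebarreVoisin.incidence α)
                (DebarreVoisin.fanoPow α 1)),
          (∀ p ∈ ψ.domain, DebarreVoisin.π₁₂ (ψ.toFun p) = p) ∧
          (∀ q ∈ DebarreVoisin.openTriangles α, DebarreVoisin.π₁₂ q ∈ ψ.domain →
            ψ.toFun (DebarreVoisin.π₁₂ q) = q) ∧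
          φ.domain = ψ.domain ∧
          (∀ p ∈ φ.domain, φ.toFun p = DebarreVoisin.π₃ (ψ.toFun p)) := by
  have : FiniteDimensional ℂ V := FiniteDimensional.of_finrank_pos (by omega)
  obtain ⟨s₁, hs₁, hne₁, h₁⟩ := exists_generic_adaptedPairs (V := V)
  obtain ⟨s₂, hs₂, hne₂, h₂⟩ := exists_generic_adaptedTriangles (V := V)
  obtain ⟨s₃, hs₃, hne₃, h₃⟩ := exists_generic_isAdapted hV
  refine ⟨{α | s₁ α * s₂ α * s₃ α ≠ 0},
    isOpen_zariski_ne_zero (polyFun_mul (polyFun_mul hs₁ hs₂) hs₃),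
    polyFun_mul_ne_zero (polyFun_mul hs₁ hs₂) hs₃ (polyFun_mul_ne_zero hs₁ hs₂ hne₁ hne₂) hne₃,
    fun α hα => ?_⟩
  have hα₁ : s₁ α ≠ 0 := left_ne_zero_of_mul (left_ne_zero_of_mul hα)
  have hα₂ : s₂ α ≠ 0 := right_ne_zero_of_mul (left_ne_zero_of_mul hα)
  have hα₃ : s₃ α ≠ 0 := right_ne_zero_of_mul hα
  have hdense : IsDenseOpenIn (adaptedSides α) (incidence α) :=
    ⟨exists_isOpen_adaptedSides hV, incidence_subset_closure hV (h₁ α hα₁)⟩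
  have hnonempty : (incidence α).Nonempty := by
    obtain ⟨x, hx⟩ := h₃ α hα₃
    obtain ⟨x', hx'⟩ := (h₁ α hα₁ x hx).nonempty
    exact ⟨![⟨_, hx'.finrank_side (i := 0) (j := 1) (by decide)⟩,
      ⟨_, hx'.finrank_side (i := 0) (j := 2) (by decide)⟩],
      adaptedSides_subset_incidence ⟨x', hx', rfl, rfl⟩⟩
  refine ⟨⟨isRegularOn_π₁₂ _, fun w hw => π₁₂_mem_incidence hw, hnonempty, adaptedSides α, hdense,
    openTriangles_subset_closure (h₂ α hα₂), fun w hw => ?_⟩,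
    ⟨adaptedSides α, triangle α, hdense, isRegularOn_triangle hV,
      fun w hw => triangle_mem_openTriangles hw⟩,
    ⟨adaptedSides α, fun w => π₃ (triangle α w), hdense, isRegularOn_π₃_triangle hV,
      fun w hw i => (triangle_mem_openTriangles hw).1 _⟩,
    fun w _ => π₁₂_triangle w, fun q hq hw => eq_triangle hq hw, rfl, fun w _ => rfl⟩
  rw [Nat.cast_one, Set.encard_eq_one]
  refine ⟨triangle α w, Set.Subset.antisymm ?_ ?_⟩
  · rintro q ⟨hq, rfl⟩
    exact (eq_triangle hq hw).symm
  · rintro _ rfl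
    exact ⟨triangle_mem_openTriangles hw, π₁₂_triangle w⟩
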